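/- Let $M$ be a simple matroid on a finite ground set $E(M)$, with rank $r(M)$, which is graphic (the cycle matroid $M(G)$ of a finite graph $G$, possibly with loops and parallel edges) or cographic (the dual of a graphic matroid). Let $c : E(M) \to S$ be a colouring of its elements, where $|S| = r(M)+1$ and every colour class $c^{-1}(s)$, $s \in S$, has exactly two elements. Call a circuit of $M$ *rainbow* if its elements have pairwise distinct colours. Then there are four (not necessarily distinct) rainbow circuits $C_1, C_2, C_3, C_4$ of $M$ such that $\sum_{i=1}^4 |C_i| \le 2r(M)+4$ and no element of $M$ belongs to $C_i$ for more than two of the indices $i \in \{1,2,3,4\}$. If $M$ is cographic, then there are moreover two disjoint rainbow circuits $C_1, C_2$ of $M$ with $|C_1| + |C_2| \le r(M)+2$. -/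

import Mathlib

/-- `C` is the edge set of a cycle of the multigraph `G`: there are distinct vertices
`v 0, …, v k` and distinct edges `e 0, …, e k` such that `e i` joins `v i` to `v (i + 1)`, with
indices modulo `k + 1`. A loop is a cycle with one edge, and two parallel edges form a cycle. -/
def Graph.IsCycleEdgeSet {V α : Type*} (G : Graph V α) (C : Set α) : Prop :=
  ∃ (k : ℕ) (v : Fin (k + 1) → V) (e : Fin (k + 1) → α),
    Function.Injective v ∧ Function.Injective e ∧
    (∀ i, G.IsLink (e i) (v i) (v (i + 1))) ∧ Set.range e = C

/-- `M` is the cycle matroid `M(G)`: its elements are the edges of `G` and its circuits are the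
edge sets of the cycles of `G`. A matroid is determined by its ground set and its circuits. -/
def Matroid.IsCycleMatroidOf {V α : Type*} (M : Matroid α) (G : Graph V α) : Prop :=
  M.E = G.edgeSet ∧ ∀ C : Set α, M.IsCircuit C ↔ G.IsCycleEdgeSet C

/-- A matroid is graphic if it is the cycle matroid of a multigraph with finitely many vertices
(loops and parallel edges allowed). Since the edges of the graph may be taken from any type, no
further isomorphism is needed. -/
def Matroid.IsGraphic {α : Type*} (M : Matroid α) : Prop :=
  ∃ (V : Type) (_ : Finite V) (G : Graph V α), M.IsCycleMatroidOf G

/-- A matroid is cographic if its dual is graphic. -/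
def Matroid.IsCographic {α : Type*} (M : Matroid α) : Prop :=
  M✶.IsGraphic

/-- A matroid is simple if it has no loops and no parallel pairs, that is, no circuits with one
or two elements. -/
def Matroid.IsSimpleMatroid {α : Type*} (M : Matroid α) : Prop :=
  ∀ C : Set α, M.IsCircuit C → 3 ≤ C.encard

/-- The colouring `c` of the elements of `M` is `k`-uniform: each colour class has exactly `k`
elements. Only the values of `c` on the ground set of `M` matter. -/
def Matroid.IsUniformColouring {α κ : Type*} (M : Matroid α) (c : α → κ) (k : ℕ) : Prop :=
  ∀ s : κ, {e | e ∈ M.E ∧ c e = s}.encard = k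

/-- A rainbow circuit: a circuit whose elements have distinct colours. -/
def Matroid.IsRainbowCircuit {α κ : Type*} (M : Matroid α) (c : α → κ) (C : Set α) : Prop :=
  M.IsCircuit C ∧ Set.InjOn c C

/-- A short rainbow circuit pair: two disjoint rainbow circuits with `|C₁| + |C₂| ≤ r(M) + 2`. -/
def Matroid.IsShortRainbowCircuitPair {α κ : Type*} (M : Matroid α) (c : α → κ)
    (C₁ C₂ : Set α) : Prop :=
  M.IsRainbowCircuit c C₁ ∧ M.IsRainbowCircuit c C₂ ∧ Disjoint C₁ C₂ ∧
    C₁.encard + C₂.encard ≤ M.eRank + 2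

/-- A short rainbow circuit 4-tuple: four rainbow circuits, not necessarily distinct, of total
size at most `2 r(M) + 4`, such that no element belongs to more than two of them (counted with
multiplicity). -/
def Matroid.IsShortRainbowCircuitFourTuple {α κ : Type*} (M : Matroid α) (c : α → κ)
    (C : Fin 4 → Set α) : Prop :=
  (∀ i, M.IsRainbowCircuit c (C i)) ∧
    ∑ i, (C i).encard ≤ 2 * M.eRank + 4 ∧
    ∀ e ∈ M.E, {i | e ∈ C i}.encard ≤ 2

/-! Write `n = r(M) + 1` for the number of colours.

Graphic case. `M` is represented by a graph without loops or parallel edges on at most `n` vertices.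
It is enough to find two disjoint rainbow cycles of total size at most `n + 1`, since each can be
taken twice (`HasShortTuple.of_pair`).

Suppose first that every vertex `v` is an end of both edges of some colour. Distinct vertices have
distinct such colours, and sending `v` to the other ends of its two edges gives a digraph with all
out-degrees two. Such a digraph has two arc-disjoint directed cycles with at most one common vertex
(`hasOutPair_of_outDegree_two`), and these give the two rainbow cycles.

Otherwise some vertex is avoided by an edge of each colour, so there are `n` edges of distinct
colours on at most `n - 1` vertices. Take a smallest nonempty rainbow set `T` with more edges than
vertices. Two disjoint cycles in a rainbow set have total size at most `n`, so `T` may be assumed to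
be a theta graph (`isTheta`), and so may every rainbow set of the same size on the vertices of `T`.
The three cycles of `T` cover each edge of `T` twice. Add a rainbow cycle `D` disjoint from `T`: the
total exceeds `2n + 2` by at most the number of edges of `D` joining vertices of `T`. Each such
chord can be exchanged for the edge of its colour in `T`, giving another theta graph. This shortens
one of the three cycles or directly yields four good cycles (`exchange`). Each chord costs a branch
vertex its degree three, so there are at most two chords; if both shorten the same cycle, the two
exchanges combine (`exists_double_exchange`).

Cographic case. Circuits of `M` lie inside the vertex stars of a connected graph for the dual, which
has at least `n + 2` vertices and `2n` edges. After identifying the ends of monochromatic parallel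
pairs, counting gives two nonadjacent vertices with rainbow stars of total size at most `n`
(`exists_pair`). Taking each circuit twice gives the four circuits as well. -/

/-! ### Graphic matroids through parities on edge cuts. -/

/-- The maps `x` and `y` give the two ends, in the vertex set `S`, of the elements of `M`, so that
every circuit meets every edge cut in an even number of elements, and every nonempty set that meets
all edge cuts in an even number of elements is dependent. -/
structure Matroid.IsCutRep {α V : Type*} (M : Matroid α) (x y : α → V) (S : Finset V) : Prop where
  left_mem : ∀ e ∈ M.E, x e ∈ S
  right_mem : ∀ e ∈ M.E, y e ∈ S
  circuit_sum : ∀ C : Finset α, M.IsCircuit C → ∀ g : V → ZMod 2, ∑ e ∈ C, (g (x e) + g (y e)) = 0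
  not_indep : ∀ X : Finset α, ↑X ⊆ M.E → X.Nonempty →
    (∀ g : V → ZMod 2, ∑ e ∈ X, (g (x e) + g (y e)) = 0) → ¬ M.Indep X

theorem Graph.IsCycleEdgeSet.sum_eq_zero {V α : Type*} {G : Graph V α} {x y : α → V}
    (hxy : ∀ e ∈ G.edgeSet, G.IsLink e (x e) (y e)) {C : Finset α} (hC : G.IsCycleEdgeSet C)
    (g : V → ZMod 2) : ∑ e ∈ C, (g (x e) + g (y e)) = 0 := by
  classical
  obtain ⟨k, v, e, hv, he, hl, hr⟩ := hC
  have hC' : C = Finset.univ.image e := by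
    ext a
    have := Set.ext_iff.1 hr a
    simp only [Set.mem_range, Finset.mem_coe] at this
    simp [this]
  rw [hC', Finset.sum_image (fun a _ b _ h => he h)]
  have h1 : ∀ i, g (x (e i)) + g (y (e i)) = g (v i) + g (v (i + 1)) := by
    intro i
    rcases (hxy _ (hl i).edge_mem).eq_and_eq_or_eq_and_eq (hl i) with ⟨h, h'⟩ | ⟨h, h'⟩
    · rw [h, h']
    · rw [h, h', add_comm]
  rw [Finset.sum_congr rfl (fun i _ => h1 i), Finset.sum_add_distrib]
  have h2 : ∑ i, g (v (i + 1)) = ∑ i, g (v i) :=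
    Fintype.sum_equiv (Equiv.addRight (1 : Fin (k + 1))) _ _ (fun i => rfl)
  rw [h2]
  exact CharTwo.add_self_eq_zero _

theorem Graph.exists_isCycleEdgeSet_of_sum_eq_zero {V α : Type*} [Finite V] {G : Graph V α}
    {x y : α → V} (hxy : ∀ e ∈ G.edgeSet, G.IsLink e (x e) (y e)) {X : Finset α}
    (hX : ↑X ⊆ G.edgeSet) (hne : X.Nonempty)
    (h0 : ∀ g : V → ZMod 2, ∑ e ∈ X, (g (x e) + g (y e)) = 0) :
    ∃ C : Set α, C ⊆ X ∧ G.IsCycleEdgeSet C := by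
  classical
  by_cases hloop : ∃ e ∈ X, x e = y e
  · obtain ⟨e, he, hl⟩ := hloop
    refine ⟨{e}, by simpa using he, 0, fun _ => x e, fun _ => e,
      fun a b _ => Subsingleton.elim (α := Fin 1) a b,
      fun a b _ => Subsingleton.elim (α := Fin 1) a b, fun _ => ?_, by simp⟩
    have := hxy e (hX he)
    rwa [← hl] at this
  push Not at hloop
  -- A state is a vertex together with the edge last used. Without loops, even degree forces a
  -- second edge of `X` at that vertex, so the walk can go on without repeating the previous edge.
  have hstep : ∀ p : {p : V × α // p.2 ∈ X ∧ (x p.2 = p.1 ∨ y p.2 = p.1)},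
      ∃ q : {p : V × α // p.2 ∈ X ∧ (x p.2 = p.1 ∨ y p.2 = p.1)},
        q.1.2 ≠ p.1.2 ∧ G.IsLink q.1.2 p.1.1 q.1.1 := by
    rintro ⟨⟨v, e⟩, heX, hev⟩
    simp only at heX hev
    have : ∃ f ∈ X, f ≠ e ∧ (x f = v ∨ y f = v) := by
      by_contra hcon
      push Not at hcon
      have hs := h0 (fun w => if w = v then 1 else 0)
      rw [Finset.sum_eq_single e] at hs
      · have := hloop e heX
        rcases hev with h | h
        · rw [if_pos h, if_neg (fun h' => this (h.trans h'.symm))] at hs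
          simp at hs
        · rw [if_pos h, if_neg (fun h' => this (h'.trans h.symm))] at hs
          simp at hs
      · intro f hf hfe
        have := hcon f hf hfe
        rw [if_neg this.1, if_neg this.2, add_zero]
      · exact fun h => absurd heX h
    obtain ⟨f, hf, hfe, h | h⟩ := this
    · exact ⟨⟨(y f, f), hf, Or.inr rfl⟩, hfe, by simpa [h] using hxy f (hX hf)⟩
    · exact ⟨⟨(x f, f), hf, Or.inl rfl⟩, hfe, by simpa [h] using (hxy f (hX hf)).symm⟩
  choose next hnext using hstep
  obtain ⟨e₀, he₀⟩ := hne
  let s : ℕ → {p : V × α // p.2 ∈ X ∧ (x p.2 = p.1 ∨ y p.2 = p.1)} :=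
    fun i => next^[i] ⟨(x e₀, e₀), he₀, Or.inl rfl⟩
  have hs : ∀ i, s (i + 1) = next (s i) := fun i => Function.iterate_succ_apply' _ _ _
  let v : ℕ → V := fun i => (s i).1.1
  let f : ℕ → α := fun i => (s (i + 1)).1.2
  have hlink : ∀ i, G.IsLink (f i) (v i) (v (i + 1)) := by
    intro i
    have := (hnext (s i)).2
    rw [← hs] at this
    exact this
  have hff : ∀ i, f (i + 1) ≠ f i := by
    intro i
    have := (hnext (s (i + 1))).1
    rw [← hs] at this
    exact this
  have hfX : ∀ i, f i ∈ X := fun i => (s (i + 1)).2.1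
  have hex : ∃ d, 1 ≤ d ∧ ∃ i, v i = v (i + d) := by
    obtain ⟨i, j, hij, h⟩ := Finite.exists_ne_map_eq_of_infinite v
    rcases lt_or_gt_of_ne hij with h' | h'
    · exact ⟨j - i, by omega, i, by rw [h]; congr 1; omega⟩
    · exact ⟨i - j, by omega, j, by rw [← h]; congr 1; omega⟩
  -- The gap `d` is least among the repetitions at all starting indices, which makes the vertices
  -- between the two visits distinct.
  obtain ⟨hd1, i, hi⟩ := Nat.find_spec hex
  have hmin : ∀ m, m < Nat.find hex → 1 ≤ m → ∀ j, v j ≠ v (j + m) := by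
    intro m hm h1 j hj
    exact Nat.find_min hex hm ⟨h1, j, hj⟩
  generalize Nat.find hex = d at *
  obtain ⟨k, rfl⟩ : ∃ k, d = k + 1 := ⟨d - 1, by omega⟩
  have hvne : ∀ a b, a < b → b < k + 1 → v (i + a) ≠ v (i + b) := by
    intro a b hab hb h
    refine hmin (b - a) (by omega) (by omega) (i + a) ?_
    rw [h]; congr 1; omega
  have hfne : ∀ a b, a < b → b < k + 1 → f (i + a) ≠ f (i + b) := by
    intro a b hab hb h
    have h1 := hlink (i + a)
    rw [h] at h1
    rcases h1.eq_and_eq_or_eq_and_eq (hlink (i + b)) with ⟨h2, -⟩ | ⟨-, h2⟩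
    · exact hvne a b hab hb h2
    · rcases Nat.lt_or_ge (a + 1) b with h3 | h3
      · exact hvne (a + 1) b h3 hb h2
      · have : b = a + 1 := by omega
        subst this
        exact hff (i + a) h.symm
  refine ⟨Set.range (fun a : Fin (k + 1) => f (i + a)), ?_, k, fun a => v (i + a),
    fun a => f (i + a), ?_, ?_, ?_, rfl⟩
  · rintro _ ⟨a, rfl⟩
    exact hfX _
  · intro a b h
    by_contra hab
    rcases lt_or_gt_of_ne (fun h' => hab (Fin.ext h')) with h' | h'
    · exact hvne a b h' b.2 h
    · exact hvne b a h' a.2 h.symm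
  · intro a b h
    by_contra hab
    rcases lt_or_gt_of_ne (fun h' => hab (Fin.ext h')) with h' | h'
    · exact hfne a b h' b.2 h
    · exact hfne b a h' a.2 h.symm
  · intro a
    have h1 := hlink (i + a)
    have h2 : v (i + a + 1) = v (i + ((a + 1 : Fin (k + 1)) : ℕ)) := by
      by_cases ha : a = Fin.last k
      · subst ha
        simp only [Fin.last_add_one, Fin.val_zero, add_zero, Fin.val_last]
        exact hi.symm
      · rw [Fin.val_add_one_of_lt (Fin.lt_last_iff_ne_last.2 ha)]
        rfl
    rw [h2] at h1
    exact h1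

theorem Matroid.IsGraphic.exists_isCutRep {α : Type*} {M : Matroid α} (hM : M.IsGraphic) :
    ∃ (V : Type) (x y : α → V) (S : Finset V), M.IsCutRep x y S := by
  classical
  obtain ⟨V, hV, G, hE, hC⟩ := hM
  have := Fintype.ofFinite V
  by_cases hne : G.edgeSet.Nonempty
  swap
  · rw [Set.not_nonempty_iff_eq_empty] at hne
    -- Without edges the type `V` may be empty, so a one-point vertex set is used instead.
    refine ⟨PUnit, fun _ => ⟨⟩, fun _ => ⟨⟩, {⟨⟩}, by simp, by simp, ?_, ?_⟩
    · intro C _ g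
      exact Finset.sum_eq_zero fun _ _ => CharTwo.add_self_eq_zero _
    · rintro X hX ⟨e, he⟩
      have := hX he
      rw [hE, hne] at this
      exact this.elim
  have hl : ∀ e, ∃ p : V × V, e ∈ G.edgeSet → G.IsLink e p.1 p.2 := by
    intro e
    by_cases he : e ∈ G.edgeSet
    · obtain ⟨a, b, h⟩ := G.exists_isLink_of_mem_edgeSet he
      exact ⟨(a, b), fun _ => h⟩
    · obtain ⟨e', he'⟩ := hne
      obtain ⟨a, b, h⟩ := G.exists_isLink_of_mem_edgeSet he'
      exact ⟨(a, b), fun h => absurd h he⟩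
  choose p hp using hl
  refine ⟨V, fun e => (p e).1, fun e => (p e).2, Finset.univ, by simp, by simp, ?_, ?_⟩
  · intro C hCc g
    exact ((hC _).1 hCc).sum_eq_zero hp g
  · intro X hX hXne h0
    obtain ⟨C, hCX, hCc⟩ := G.exists_isCycleEdgeSet_of_sum_eq_zero hp (hE ▸ hX) hXne h0
    exact fun hi => ((hC _).2 hCc).not_indep (hi.subset hCX)

namespace Matroid.IsCutRep

variable {α V : Type*} {M : Matroid α} {x y : α → V} {S : Finset V}

/-- Identifying two vertices on different sides of an empty cut gives another representation. -/
theorem merge [DecidableEq V] (h : M.IsCutRep x y S) {K : Set V}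
    (hK : ∀ e ∈ M.E, x e ∈ K ↔ y e ∈ K) {a b : V} (ha : a ∈ K) (hb : b ∉ K) (hbS : b ∈ S) :
    M.IsCutRep (fun e => if x e = a then b else x e) (fun e => if y e = a then b else y e)
      (S.erase a) := by
  classical
  have hba : b ≠ a := fun h => hb (h ▸ ha)
  refine ⟨fun e he => ?_, fun e he => ?_, fun C hC g => ?_, fun X hX hne h0 => ?_⟩
  · have := h.left_mem e he
    split_ifs <;> simp_all
  · have := h.right_mem e he
    split_ifs <;> simp_all
  · exact h.circuit_sum C hC (fun v => g (if v = a then b else v))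
  · refine h.not_indep X hX hne fun g => ?_
    -- Adding a constant on `K` changes no sum, as no element crosses `K`; this constant makes the
    -- values at `a` and `b` agree.
    set d : V → ZMod 2 := fun v => if v ∈ K then g a + g b else 0 with hd
    have hg' := h0 (fun v => g v + d v)
    have key : ∀ v, g (if v = a then b else v) + d (if v = a then b else v) = g v + d v := by
      intro v
      by_cases hva : v = a
      · subst hva
        simp only [if_true, hd, if_pos ha, if_neg hb]
        rw [← add_assoc, CharTwo.add_self_eq_zero, zero_add, add_zero]
      · simp [hva]
    simp only [key] at hg'
    rw [← hg']
    refine Finset.sum_congr rfl fun e he => ?_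
    have : d (x e) = d (y e) := by
      have := hK e (hX he)
      simp only [hd, this]
    rw [this]
    have h2 := CharTwo.add_self_eq_zero (d (y e))
    linear_combination -h2

/-- A representation on a vertex set of minimum size has no empty cuts. -/
theorem exists_connected (h : M.IsCutRep x y S) :
    ∃ (x' y' : α → V) (S' : Finset V), M.IsCutRep x' y' S' ∧
      ∀ K : Set V, (∃ a ∈ S', a ∈ K) → (∃ b ∈ S', b ∉ K) →
        ∃ e ∈ M.E, ¬ (x' e ∈ K ↔ y' e ∈ K) := by
  classical
  induction hn : S.card using Nat.strong_induction_on generalizing x y S with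
  | _ n ih =>
    by_cases hc : ∀ K : Set V, (∃ a ∈ S, a ∈ K) → (∃ b ∈ S, b ∉ K) →
        ∃ e ∈ M.E, ¬ (x e ∈ K ↔ y e ∈ K)
    · exact ⟨x, y, S, h, hc⟩
    · push Not at hc
      obtain ⟨K, ⟨a, haS, haK⟩, ⟨b, hbS, hbK⟩, hK⟩ := hc
      exact ih _ (hn ▸ Finset.card_erase_lt_of_mem haS) (h.merge hK haK hbK hbS) rfl

/-- The degree parities at the vertices other than `k₀` separate the subsets of `X`: the symmetric
difference of two subsets with equal parities would meet all cuts evenly and be dependent. Hence `2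
^ |X| ≤ 2 ^ (|K| - 1)`. -/
theorem card_add_one_le (h : M.IsCutRep x y S) {X : Finset α} (hX : M.Indep X) {K : Finset V}
    (hK : K.Nonempty) (hx : ∀ e ∈ X, x e ∈ K) (hy : ∀ e ∈ X, y e ∈ K) : X.card + 1 ≤ K.card := by
  classical
  obtain ⟨k₀, hk₀⟩ := hK
  let F : Finset α → (V → ZMod 2) → ZMod 2 := fun Y g => ∑ e ∈ Y, (g (x e) + g (y e))
  let Φ : X.powerset → (K.erase k₀ → ZMod 2) := fun Y v => F Y.1 (fun w => if w = v.1 then 1 else 0)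
  have hΦ : Function.Injective Φ := by
    rintro ⟨Y, hY⟩ ⟨Z, hZ⟩ hYZ
    rw [Finset.mem_powerset] at hY hZ
    by_contra hne
    have hne' : Y ≠ Z := fun h' => hne (Subtype.ext h')
    have hsub : symmDiff Y Z ⊆ X := by
      intro e he
      rcases Finset.mem_symmDiff.1 he with h' | h'
      · exact hY h'.1
      · exact hZ h'.1
    have hnn : (symmDiff Y Z).Nonempty := by
      rw [Finset.nonempty_iff_ne_empty]
      exact fun h' => hne' (symmDiff_eq_bot.1 h')
    refine h.not_indep _ (fun e he => hX.subset_ground (hsub he)) hnn (fun g => ?_)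
      (hX.subset (by exact_mod_cast hsub))
    have hsd : ∀ φ : α → ZMod 2, ∑ e ∈ symmDiff Y Z, φ e = ∑ e ∈ Y, φ e + ∑ e ∈ Z, φ e := by
      intro φ
      have h1 : symmDiff Y Z = (Y \ Z) ∪ (Z \ Y) := rfl
      have hd : Disjoint (Y \ Z) (Z \ Y) := disjoint_sdiff_sdiff
      rw [h1, Finset.sum_union hd]
      have h2 := Finset.sum_inter_add_sum_sdiff Y Z φ
      have h3 := Finset.sum_inter_add_sum_sdiff Z Y φ
      rw [Finset.inter_comm] at h3
      have := CharTwo.add_self_eq_zero (∑ e ∈ Y ∩ Z, φ e)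
      linear_combination h2 + h3 - this
    rw [hsd]
    -- Every cut sum is a combination of sums at single vertices. The vertex `k₀` can be omitted
    -- because each edge has two ends, so `g k₀` cancels modulo 2.
    have hFe : ∀ W : Finset α, W ⊆ X → ∑ e ∈ W, (g (x e) + g (y e)) =
        ∑ v ∈ K.erase k₀, (g v - g k₀) * F W (fun w => if w = v then 1 else 0) := by
      intro W hW
      simp only [F, Finset.mul_sum]
      rw [Finset.sum_comm]
      refine Finset.sum_congr rfl fun e he => ?_
      have hone : ∀ u ∈ K, ∑ v ∈ K.erase k₀, (g v - g k₀) * (if u = v then 1 else 0) =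
          g u - g k₀ := by
        intro u hu
        by_cases huk : u = k₀
        · rw [huk, sub_self]
          refine Finset.sum_eq_zero fun v hv => ?_
          rw [if_neg (Finset.ne_of_mem_erase hv).symm, mul_zero]
        · simp [huk, hu]
      simp only [mul_add, Finset.sum_add_distrib]
      rw [hone _ (hx e (hW he)), hone _ (hy e (hW he))]
      have := CharTwo.add_self_eq_zero (g k₀)
      linear_combination this
    rw [hFe Y hY, hFe Z hZ, ← Finset.sum_add_distrib]
    refine Finset.sum_eq_zero fun v hv => ?_
    have : F Y (fun w => if w = v then 1 else 0) = F Z (fun w => if w = v then 1 else 0) :=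
      congrFun hYZ ⟨v, hv⟩
    rw [this]
    exact CharTwo.add_self_eq_zero _
  have hcard := Fintype.card_le_of_injective Φ hΦ
  rw [Fintype.card_coe, Finset.card_powerset, Fintype.card_fun, Fintype.card_coe, ZMod.card,
    Finset.card_erase_of_mem hk₀] at hcard
  have h1 := (Nat.pow_le_pow_iff_right (by norm_num : 1 < 2)).1 hcard
  have h2 : 0 < K.card := Finset.card_pos.2 ⟨k₀, hk₀⟩
  omega

/-- Grow a spanning tree. An edge leaving `K` preserves independence, since a circuit through it
would meet the cut of `K` in that edge alone. This bounds the number of vertices by `r(M) + 1`. -/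
theorem exists_indep_card (h : M.IsCutRep x y S)
    (hconn : ∀ K : Set V, (∃ a ∈ S, a ∈ K) → (∃ b ∈ S, b ∉ K) →
      ∃ e ∈ M.E, ¬ (x e ∈ K ↔ y e ∈ K)) (hS : S.Nonempty) :
    ∃ I : Finset α, M.Indep I ∧ I.card + 1 = S.card := by
  classical
  have key : ∀ m, m + 1 ≤ S.card → ∃ (K : Finset V) (I : Finset α), K ⊆ S ∧ K.card = m + 1 ∧
      M.Indep I ∧ I.card = m ∧ ∀ e ∈ I, x e ∈ K ∧ y e ∈ K := by
    intro m
    induction m with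
    | zero =>
      intro _
      obtain ⟨a, ha⟩ := hS
      exact ⟨{a}, ∅, by simpa using ha, by simp, by simp, by simp, by simp⟩
    | succ m ih =>
      intro hm
      obtain ⟨K, I, hKS, hK, hI, hIc, hends⟩ := ih (by omega)
      have hKne : K.Nonempty := Finset.card_pos.1 (by omega)
      obtain ⟨a, ha⟩ := hKne
      obtain ⟨b, hb, hbK⟩ := Finset.exists_mem_notMem_of_card_lt_card (show K.card < S.card by omega)
      obtain ⟨e, he, hcross⟩ := hconn (K : Set V) ⟨a, hKS ha, ha⟩ ⟨b, hb, by simpa using hbK⟩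
      have heI : e ∉ I := fun h' => hcross (by simp [hends e h'])
      have hind : M.Indep (insert e I : Finset α) := by
        by_contra hdep
        have hdep' : M.Dep (insert e I : Finset α) :=
          ⟨hdep, by
            rw [Finset.coe_insert]
            exact Set.insert_subset he hI.subset_ground⟩
        obtain ⟨C, hCsub, hC⟩ := hdep'.exists_isCircuit_subset
        have hfin : C.Finite := (Finset.finite_toSet _).subset hCsub
        lift C to Finset α using hfin
        have hCsub' : C ⊆ insert e I := by exact_mod_cast hCsub
        have heC : e ∈ C := by
          by_contra hn
          exact hC.not_indep (hI.subset (by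
            exact_mod_cast (Finset.subset_insert_iff_of_notMem hn).1 hCsub'))
        have hsum := h.circuit_sum C hC (fun v => if v ∈ K then 1 else 0)
        rw [Finset.sum_eq_single_of_mem e heC] at hsum
        · simp only [Finset.mem_coe] at hcross
          by_cases h1 : x e ∈ K <;> by_cases h2 : y e ∈ K <;> simp_all
        · intro f hf hfe
          have := hends f (Finset.mem_of_mem_insert_of_ne (hCsub' hf) hfe)
          simp only [this, if_true]
          exact CharTwo.add_self_eq_zero _
      simp only [Finset.mem_coe] at hcross
      by_cases h1 : x e ∈ K
      · have h2 : y e ∉ K := fun h2 => hcross (by simp [h1, h2])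
        refine ⟨insert (y e) K, insert e I, Finset.insert_subset (h.right_mem e he) hKS,
          by rw [Finset.card_insert_of_notMem h2, hK], hind,
          by rw [Finset.card_insert_of_notMem heI, hIc], ?_⟩
        intro f hf
        rcases Finset.mem_insert.1 hf with rfl | hf
        · simp [h1]
        · simp [hends f hf]
      · have h2 : y e ∈ K := by
          by_contra h2
          exact hcross (by simp [h1, h2])
        refine ⟨insert (x e) K, insert e I, Finset.insert_subset (h.left_mem e he) hKS,
          by rw [Finset.card_insert_of_notMem h1, hK], hind,
          by rw [Finset.card_insert_of_notMem heI, hIc], ?_⟩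
        intro f hf
        rcases Finset.mem_insert.1 hf with rfl | hf
        · simp [h2]
        · simp [hends f hf]
  have hpos := Finset.card_pos.2 hS
  obtain ⟨K, I, -, -, hI, hIc, -⟩ := key (S.card - 1) (by omega)
  exact ⟨I, hI, by omega⟩

end Matroid.IsCutRep

/-! ### Degrees of vertices in edge sets. -/

section Degree

variable {α V : Type*} [DecidableEq V]

/-- The number of elements of `X` that have `v` as an end. -/
def endDeg (x y : α → V) (X : Finset α) (v : V) : ℕ :=
  (X.filter fun e => x e = v ∨ y e = v).card

/-- The set of ends of the elements of `X`. -/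
def endSet (x y : α → V) (X : Finset α) : Finset V :=
  X.image x ∪ X.image y

variable {x y : α → V}

theorem left_mem_endSet {X : Finset α} {e : α} (he : e ∈ X) : x e ∈ endSet x y X :=
  Finset.mem_union_left _ (Finset.mem_image_of_mem _ he)

theorem right_mem_endSet {X : Finset α} {e : α} (he : e ∈ X) : y e ∈ endSet x y X :=
  Finset.mem_union_right _ (Finset.mem_image_of_mem _ he)

theorem mem_endSet {X : Finset α} {v : V} :
    v ∈ endSet x y X ↔ ∃ e ∈ X, x e = v ∨ y e = v := by
  simp only [endSet, Finset.mem_union, Finset.mem_image]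
  constructor
  · rintro (⟨e, he, h⟩ | ⟨e, he, h⟩)
    · exact ⟨e, he, Or.inl h⟩
    · exact ⟨e, he, Or.inr h⟩
  · rintro ⟨e, he, h | h⟩
    · exact Or.inl ⟨e, he, h⟩
    · exact Or.inr ⟨e, he, h⟩

theorem endSet_subset_iff {X : Finset α} {K : Finset V} :
    endSet x y X ⊆ K ↔ ∀ e ∈ X, x e ∈ K ∧ y e ∈ K := by
  constructor
  · exact fun h e he => ⟨h (left_mem_endSet he), h (right_mem_endSet he)⟩
  · intro h v hv
    obtain ⟨e, he, rfl | rfl⟩ := mem_endSet.1 hv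
    · exact (h e he).1
    · exact (h e he).2

theorem endSet_mono {X Y : Finset α} (h : X ⊆ Y) : endSet x y X ⊆ endSet x y Y :=
  endSet_subset_iff.2 fun _ he => ⟨left_mem_endSet (h he), right_mem_endSet (h he)⟩

theorem endDeg_mono {X Y : Finset α} (h : X ⊆ Y) (v : V) : endDeg x y X v ≤ endDeg x y Y v :=
  Finset.card_le_card (Finset.filter_subset_filter _ h)

theorem endDeg_pos_iff {X : Finset α} {v : V} : 0 < endDeg x y X v ↔ v ∈ endSet x y X := by
  rw [endDeg, Finset.card_pos, mem_endSet]
  exact ⟨fun ⟨e, he⟩ => ⟨e, (Finset.mem_filter.1 he).1, (Finset.mem_filter.1 he).2⟩,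
    fun ⟨e, he, h⟩ => ⟨e, Finset.mem_filter.2 ⟨he, h⟩⟩⟩

theorem endDeg_pos_of_mem {X : Finset α} {v : V} {e : α} (he : e ∈ X) (hv : x e = v ∨ y e = v) :
    0 < endDeg x y X v :=
  endDeg_pos_iff.2 (mem_endSet.2 ⟨e, he, hv⟩)

theorem endDeg_union [DecidableEq α] {X Y : Finset α} (h : Disjoint X Y) (v : V) :
    endDeg x y (X ∪ Y) v = endDeg x y X v + endDeg x y Y v := by
  rw [endDeg, Finset.filter_union, Finset.card_union_of_disjoint (Finset.disjoint_filter_filter h)]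
  rfl

theorem endDeg_sdiff [DecidableEq α] {X Y : Finset α} (h : Y ⊆ X) (v : V) :
    endDeg x y (X \ Y) v + endDeg x y Y v = endDeg x y X v := by
  rw [← endDeg_union Finset.sdiff_disjoint, Finset.sdiff_union_of_subset h]

theorem endDeg_union_add_inter [DecidableEq α] (X Y : Finset α) (v : V) :
    endDeg x y (X ∪ Y) v + endDeg x y (X ∩ Y) v = endDeg x y X v + endDeg x y Y v := by
  simp only [endDeg, Finset.filter_union, Finset.filter_inter_distrib]
  exact Finset.card_union_add_card_inter _ _

theorem endDeg_insert [DecidableEq α] {X : Finset α} {e : α} (he : e ∉ X) (v : V) :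
    endDeg x y (insert e X) v = endDeg x y X v + if x e = v ∨ y e = v then 1 else 0 := by
  rw [endDeg, Finset.filter_insert]
  split_ifs with h
  · rw [Finset.card_insert_of_notMem (by simp [he])]
    rfl
  · rfl

theorem endDeg_erase [DecidableEq α] {X : Finset α} {e : α} (he : e ∈ X) (v : V) :
    endDeg x y (X.erase e) v + (if x e = v ∨ y e = v then 1 else 0) = endDeg x y X v := by
  rw [← endDeg_insert (Finset.notMem_erase e X), Finset.insert_erase he]

theorem endDeg_symmDiff [DecidableEq α] (X Y : Finset α) (v : V) :
    endDeg x y (symmDiff X Y) v + 2 * endDeg x y (X ∩ Y) v =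
      endDeg x y X v + endDeg x y Y v := by
  have h1 : symmDiff X Y = (X \ Y) ∪ (Y \ X) := rfl
  have h2 := endDeg_sdiff (x := x) (y := y) (Finset.inter_subset_left : X ∩ Y ⊆ X) v
  have h3 := endDeg_sdiff (x := x) (y := y) (Finset.inter_subset_right : X ∩ Y ⊆ Y) v
  rw [Finset.sdiff_inter_self_left] at h2
  rw [Finset.inter_comm, Finset.sdiff_inter_self_left, Finset.inter_comm] at h3
  rw [h1, endDeg_union disjoint_sdiff_sdiff]
  omega

theorem even_endDeg_symmDiff [DecidableEq α] {X Y : Finset α} {v : V}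
    (hX : Even (endDeg x y X v)) (hY : Even (endDeg x y Y v)) :
    Even (endDeg x y (symmDiff X Y) v) := by
  have := endDeg_symmDiff (x := x) (y := y) X Y v
  obtain ⟨a, ha⟩ := hX
  obtain ⟨b, hb⟩ := hY
  exact ⟨a + b - endDeg x y (X ∩ Y) v, by omega⟩

theorem sum_endDeg {X : Finset α} (hl : ∀ e ∈ X, x e ≠ y e) {K : Finset V}
    (hK : endSet x y X ⊆ K) : ∑ v ∈ K, endDeg x y X v = 2 * X.card := by
  simp only [endDeg, Finset.card_filter]
  rw [Finset.sum_comm, mul_comm, ← smul_eq_mul, ← Finset.sum_const]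
  refine Finset.sum_congr rfl fun e he => ?_
  rw [← Finset.card_filter]
  have : K.filter (fun v => x e = v ∨ y e = v) = {x e, y e} := by
    have := endSet_subset_iff.1 hK e he
    ext v
    simp only [Finset.mem_filter, Finset.mem_insert, Finset.mem_singleton]
    constructor
    · rintro ⟨-, rfl | rfl⟩ <;> simp
    · rintro (rfl | rfl) <;> simp [this]
  rw [this, Finset.card_pair (hl e he)]

theorem sum_ends_eq_sum_endDeg {X : Finset α} (hl : ∀ e ∈ X, x e ≠ y e) (g : V → ZMod 2) :
    ∑ e ∈ X, (g (x e) + g (y e)) = ∑ v ∈ endSet x y X, g v * (endDeg x y X v : ZMod 2) := by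
  simp only [endDeg, Finset.card_filter, Nat.cast_sum, Finset.mul_sum]
  rw [Finset.sum_comm]
  refine Finset.sum_congr rfl fun e he => ?_
  have h1 : ∀ v, g v * (((if x e = v ∨ y e = v then 1 else 0 : ℕ)) : ZMod 2) =
      (if x e = v then g v else 0) + (if y e = v then g v else 0) := by
    intro v
    have := hl e he
    by_cases h1 : x e = v <;> by_cases h2 : y e = v <;> simp_all
  simp only [h1, Finset.sum_add_distrib, Finset.sum_ite_eq, left_mem_endSet he,
    right_mem_endSet he, if_true]

end Degree

/-! ### Cycle systems and theta graphs. -/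

/-- The combinatorial properties of the cycles of a simple graph on the edge set `E`, where `x` and
`y` give the ends of the edges. -/
structure IsCycleSystem {α V : Type*} [DecidableEq V] (x y : α → V) (E : Finset α)
    (Circ : Finset α → Prop) : Prop where
  loopless : ∀ e ∈ E, x e ≠ y e
  subset : ∀ {C}, Circ C → C ⊆ E
  deg : ∀ {C}, Circ C → ∀ v, endDeg x y C v = 0 ∨ endDeg x y C v = 2
  eq_of_subset : ∀ {C D}, Circ C → Circ D → C ⊆ D → C = D
  exists_of_even : ∀ {X : Finset α}, X ⊆ E → X.Nonempty → (∀ v, Even (endDeg x y X v)) →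
    ∃ C ⊆ X, Circ C
  exists_of_card : ∀ {X : Finset α} {K : Finset V}, X ⊆ E → X.Nonempty → endSet x y X ⊆ K →
    K.card ≤ X.card → ∃ C ⊆ X, Circ C
  three_le : ∀ {C}, Circ C → 3 ≤ C.card

/-- For the degree clause: a circuit minus one element is independent, so a circuit has at most as
many elements as ends. Its degrees are even and positive at the ends and sum to twice its size, so
they all equal two. -/
theorem Matroid.IsCutRep.isCycleSystem {α V : Type*} [DecidableEq α] [DecidableEq V] {M : Matroid α}
    {x y : α → V} {S : Finset V} (h : M.IsCutRep x y S) (hM : M.IsSimpleMatroid) {E : Finset α}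
    (hE : (E : Set α) = M.E) : IsCycleSystem x y E (fun C => M.IsCircuit (C : Set α)) := by
  have hdep : ∀ {X : Finset α}, X ⊆ E → ¬ M.Indep X → ∃ C ⊆ X, M.IsCircuit (C : Set α) := by
    intro X hX hi
    have hd : M.Dep X := ⟨hi, by rw [← hE]; exact_mod_cast hX⟩
    obtain ⟨C, hCX, hC⟩ := hd.exists_isCircuit_subset
    have hfin : C.Finite := X.finite_toSet.subset hCX
    lift C to Finset α using hfin
    exact ⟨C, by exact_mod_cast hCX, hC⟩
  have hloop : ∀ e ∈ E, x e ≠ y e := by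
    intro e he hxy
    obtain ⟨C, hCe, hC⟩ := hdep (X := {e}) (by simpa using he)
      (h.not_indep {e} (by rw [← hE]; simpa using he) (by simp) (fun g => by
        rw [Finset.sum_singleton, hxy]
        exact CharTwo.add_self_eq_zero _))
    have h3 := hM _ hC
    rw [Set.encard_coe_eq_coe_finsetCard] at h3
    have h3' : 3 ≤ C.card := by exact_mod_cast h3
    have := Finset.card_le_card hCe
    simp at this
    omega
  have hsub : ∀ {C : Finset α}, M.IsCircuit (C : Set α) → C ⊆ E := by
    intro C hC
    have := hC.subset_ground
    rw [← hE] at this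
    exact_mod_cast this
  refine ⟨hloop, hsub, ?_, ?_, ?_, ?_, ?_⟩
  · intro C hC
    have hlC : ∀ e ∈ C, x e ≠ y e := fun e he => hloop e (hsub hC he)
    have heven : ∀ v, Even (endDeg x y C v) := by
      intro v
      by_cases hv : v ∈ endSet x y C
      · have hs := (sum_ends_eq_sum_endDeg hlC (fun w => if w = v then 1 else 0)).symm.trans
          (h.circuit_sum C hC (fun w => if w = v then 1 else 0))
        simp only [ite_mul, one_mul, zero_mul, Finset.sum_ite_eq', hv, if_true] at hs
        exact (ZMod.natCast_eq_zero_iff_even).1 hs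
      · have : endDeg x y C v = 0 := by
          have := mt endDeg_pos_iff.1 hv
          omega
        rw [this]; exact ⟨0, rfl⟩
    have hge : ∀ v ∈ endSet x y C, 2 ≤ endDeg x y C v := by
      intro v hv
      have h1 := endDeg_pos_iff.2 hv
      obtain ⟨k, hk⟩ := heven v
      omega
    have hne : C.Nonempty := by exact_mod_cast hC.nonempty
    obtain ⟨e, he⟩ := hne
    have hK : (endSet x y C).Nonempty := ⟨_, left_mem_endSet he⟩
    have hcard := h.card_add_one_le (X := C.erase e)
      (by simpa using hC.sdiff_singleton_indep (e := e) (by exact_mod_cast he)) hK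
      (fun f hf => left_mem_endSet (Finset.mem_of_mem_erase hf))
      (fun f hf => right_mem_endSet (Finset.mem_of_mem_erase hf))
    have h0 := Finset.card_erase_add_one he
    have hsum := sum_endDeg hlC (Finset.Subset.refl (endSet x y C))
    intro v
    by_cases hv : v ∈ endSet x y C
    · right
      by_contra hv2
      have hlt : ∑ w ∈ endSet x y C, 2 < ∑ w ∈ endSet x y C, endDeg x y C w :=
        Finset.sum_lt_sum hge ⟨v, hv, lt_of_le_of_ne (hge v hv) (Ne.symm hv2)⟩
      rw [Finset.sum_const, smul_eq_mul] at hlt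
      omega
    · left
      have := mt endDeg_pos_iff.1 hv
      omega
  · intro C D hC hD hCD
    exact_mod_cast hC.eq_of_subset_isCircuit hD (by exact_mod_cast hCD)
  · intro X hX hne hev
    refine hdep hX (h.not_indep X (by rw [← hE]; exact_mod_cast hX) hne fun g => ?_)
    rw [sum_ends_eq_sum_endDeg (fun e he => hloop e (hX he))]
    refine Finset.sum_eq_zero fun v _ => ?_
    rw [(ZMod.natCast_eq_zero_iff_even).2 (hev v), mul_zero]
  · intro X K hX hne hK hcard
    refine hdep hX fun hi => ?_
    obtain ⟨e, he⟩ := hne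
    have := h.card_add_one_le hi ⟨x e, hK (left_mem_endSet he)⟩
      (fun f hf => hK (left_mem_endSet hf)) (fun f hf => hK (right_mem_endSet hf))
    omega
  · intro C hC
    have h3 := hM _ hC
    rw [Set.encard_coe_eq_coe_finsetCard] at h3
    exact_mod_cast h3

/-- `T` is a theta graph: the union of three internally disjoint paths joining two vertices, which
are the only vertices of degree three. Each edge lies in exactly two of the three cycles. -/
structure IsTheta {α V : Type*} [DecidableEq V] (x y : α → V) (Circ : Finset α → Prop)
    (T : Finset α) : Prop where
  exists_triple : ∃ Z A B, (Circ Z ∧ Circ A ∧ Circ B) ∧ (Z ⊆ T ∧ A ⊆ T ∧ B ⊆ T) ∧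
    (∀ f ∈ T, (f ∈ Z ∧ f ∈ A ∧ f ∉ B) ∨ (f ∈ Z ∧ f ∉ A ∧ f ∈ B) ∨ (f ∉ Z ∧ f ∈ A ∧ f ∈ B)) ∧
    ∀ C, Circ C → C ⊆ T → C = Z ∨ C = A ∨ C = B
  card_eq : T.card = (endSet x y T).card + 1
  exists_branch : ∃ p q, p ≠ q ∧ ∀ v, endDeg x y T v = 3 ↔ v = p ∨ v = q
  deg_eq : ∀ v, endDeg x y T v = 0 ∨ endDeg x y T v = 2 ∨ endDeg x y T v = 3
  circ_deg : ∀ C, Circ C → C ⊆ T → ∀ v, endDeg x y T v = 3 → endDeg x y C v = 2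

namespace IsCycleSystem

variable {α V : Type*} [DecidableEq V] {x y : α → V} {E : Finset α}
  {Circ : Finset α → Prop}

theorem nonempty (h : IsCycleSystem x y E Circ) {C : Finset α} (hC : Circ C) : C.Nonempty :=
  Finset.card_pos.1 (by have := h.three_le hC; omega)

theorem even_deg (h : IsCycleSystem x y E Circ) {C : Finset α} (hC : Circ C) (v : V) :
    Even (endDeg x y C v) := by
  rcases h.deg hC v with h' | h' <;> rw [h']
  · exact ⟨0, rfl⟩
  · exact ⟨1, rfl⟩

theorem deg_eq_two_of_mem (h : IsCycleSystem x y E Circ) {C : Finset α} (hC : Circ C) {e : α}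
    (he : e ∈ C) {v : V} (hv : x e = v ∨ y e = v) : endDeg x y C v = 2 := by
  have := endDeg_pos_of_mem he hv
  rcases h.deg hC v with h' | h' <;> omega

variable [DecidableEq α]

/-- The union of two distinct meeting cycles has more edges than vertices. -/
theorem card_endSet_union_lt (h : IsCycleSystem x y E Circ) {C D : Finset α} (hC : Circ C)
    (hD : Circ D) (hne : C ≠ D) (hmeet : ¬ Disjoint C D) :
    (endSet x y (C ∪ D)).card < (C ∪ D).card := by
  by_contra hlt
  push Not at hlt
  have hsubE : C ∪ D ⊆ E := Finset.union_subset (h.subset hC) (h.subset hD)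
  have hge : ∀ v ∈ endSet x y (C ∪ D), 2 ≤ endDeg x y (C ∪ D) v := by
    intro v hv
    obtain ⟨e, he, hev⟩ := mem_endSet.1 hv
    rcases Finset.mem_union.1 he with he | he
    · have h1 := h.deg_eq_two_of_mem hC he hev
      have := endDeg_mono (x := x) (y := y) (Finset.subset_union_left : C ⊆ C ∪ D) v
      omega
    · have h1 := h.deg_eq_two_of_mem hD he hev
      have := endDeg_mono (x := x) (y := y) (Finset.subset_union_right : D ⊆ C ∪ D) v
      omega
  have hsum := sum_endDeg (fun e he => h.loopless e (hsubE he))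
    (Finset.Subset.refl (endSet x y (C ∪ D)))
  have heq : ∀ v ∈ endSet x y (C ∪ D), endDeg x y (C ∪ D) v = 2 := by
    intro v hv
    by_contra hv2
    have hlt' : ∑ w ∈ endSet x y (C ∪ D), 2 < ∑ w ∈ endSet x y (C ∪ D), endDeg x y (C ∪ D) w :=
      Finset.sum_lt_sum hge ⟨v, hv, lt_of_le_of_ne (hge v hv) (Ne.symm hv2)⟩
    rw [Finset.sum_const, smul_eq_mul] at hlt'
    omega
  -- With all degrees of the union equal to two, `D \ C` has even degrees and contains a cycle. That
  -- cycle must be `D`, against `hmeet`.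
  have hev : ∀ v, Even (endDeg x y ((C ∪ D) \ C) v) := by
    intro v
    have h1 := endDeg_sdiff (x := x) (y := y) (Finset.subset_union_left : C ⊆ C ∪ D) v
    have h2 : endDeg x y (C ∪ D) v = 0 ∨ endDeg x y (C ∪ D) v = 2 := by
      by_cases hv : v ∈ endSet x y (C ∪ D)
      · exact Or.inr (heq v hv)
      · left
        have := mt endDeg_pos_iff.1 hv
        omega
    rcases h.deg hC v with h3 | h3 <;> rcases h2 with h2 | h2
    · exact ⟨0, by omega⟩
    · exact ⟨1, by omega⟩
    · exact ⟨0, by omega⟩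
    · exact ⟨0, by omega⟩
  have hnn : ((C ∪ D) \ C).Nonempty := by
    rw [Finset.nonempty_iff_ne_empty, Ne, Finset.sdiff_eq_empty_iff_subset]
    intro hsub
    exact hne (h.eq_of_subset hD hC ((Finset.subset_union_right).trans hsub)).symm
  obtain ⟨F, hF, hFc⟩ := h.exists_of_even (Finset.sdiff_subset.trans hsubE) hnn hev
  have hFD : F ⊆ D := by
    intro e he
    have := hF he
    simp only [Finset.mem_sdiff, Finset.mem_union] at this
    tauto
  have := h.eq_of_subset hFc hD hFD
  subst this
  refine hmeet (Finset.disjoint_left.2 fun e he he' => ?_)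
  have := hF he'
  simp only [Finset.mem_sdiff] at this
  exact this.2 he

/-- Deleting any edge of `T` leaves exactly one cycle: one exists by counting, and two would meet
and have a union with more edges than vertices, against `hmin`. Hence two cycles `Z` and `A` cover
`T`, and their symmetric difference is the third. -/
theorem isTheta (h : IsCycleSystem x y E Circ) {T : Finset α} (hTE : T ⊆ E) (hTne : T.Nonempty)
    (hcard : (endSet x y T).card + 1 ≤ T.card)
    (hmin : ∀ Y ⊂ T, Y.card ≤ (endSet x y Y).card)
    (hdisj : ∀ C D, Circ C → Circ D → C ⊆ T → D ⊆ T → ¬ Disjoint C D) :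
    IsTheta x y Circ T := by
  have huniq : ∀ f ∈ T, ∀ C D, Circ C → Circ D → C ⊆ T.erase f → D ⊆ T.erase f → C = D := by
    intro f hf C D hC hD hCf hDf
    by_contra hne
    have h1 := h.card_endSet_union_lt hC hD hne
      (hdisj C D hC hD (hCf.trans (Finset.erase_subset _ _)) (hDf.trans (Finset.erase_subset _ _)))
    have h2 := hmin (C ∪ D)
      (lt_of_le_of_lt (Finset.union_subset hCf hDf) (Finset.erase_ssubset hf))
    omega
  have hex : ∀ f ∈ T, ∃ C, Circ C ∧ C ⊆ T.erase f := by
    intro f hf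
    have h1 := Finset.card_erase_add_one hf
    have h2 : 0 < (endSet x y T).card := Finset.card_pos.2 ⟨_, left_mem_endSet hf⟩
    obtain ⟨C, hC, hCc⟩ := h.exists_of_card (K := endSet x y T)
      ((Finset.erase_subset f T).trans hTE) (Finset.card_pos.1 (by omega))
      (endSet_mono (Finset.erase_subset f T)) (by omega)
    exact ⟨C, hCc, hC⟩
  obtain ⟨f₀, hf₀⟩ := hTne
  obtain ⟨Z, hZ, hZf⟩ := hex f₀ hf₀
  have hZT : Z ⊆ T := hZf.trans (Finset.erase_subset _ _)
  obtain ⟨g, hg⟩ := h.nonempty hZ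
  obtain ⟨A, hA, hAg⟩ := hex g (hZT hg)
  have hAT : A ⊆ T := hAg.trans (Finset.erase_subset _ _)
  have hgA : g ∉ A := fun h' => Finset.notMem_erase g T (hAg h')
  have hZA : Z ≠ A := fun h' => hgA (h' ▸ hg)
  obtain ⟨k, hkZ, hkA⟩ := Finset.not_disjoint_iff.1 (hdisj Z A hZ hA hZT hAT)
  have hBT : symmDiff Z A ⊆ T := by
    intro e he
    rcases Finset.mem_symmDiff.1 he with he | he
    · exact hZT he.1
    · exact hAT he.1
  have hBk : symmDiff Z A ⊆ T.erase k := by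
    intro e he
    refine Finset.mem_erase.2 ⟨?_, hBT he⟩
    rintro rfl
    rcases Finset.mem_symmDiff.1 he with he | he
    · exact he.2 hkA
    · exact he.2 hkZ
  have hBev : ∀ v, Even (endDeg x y (symmDiff Z A) v) := fun v =>
    even_endDeg_symmDiff (h.even_deg hZ v) (h.even_deg hA v)
  obtain ⟨B, hBsub, hB⟩ := h.exists_of_even (hBT.trans hTE)
    ⟨g, Finset.mem_symmDiff.2 (Or.inl ⟨hg, hgA⟩)⟩ hBev
  -- Otherwise the rest of `symmDiff Z A` contains a second cycle, disjoint from `B`, and both avoid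
  -- the common edge `k` of `Z` and `A`, against `huniq`.
  have hBeq : B = symmDiff Z A := by
    by_contra hne
    have hnn : (symmDiff Z A \ B).Nonempty := by
      rw [Finset.nonempty_iff_ne_empty, Ne, Finset.sdiff_eq_empty_iff_subset]
      exact fun hs => hne (hBsub.antisymm hs)
    obtain ⟨B', hB's, hB'⟩ := h.exists_of_even ((Finset.sdiff_subset.trans hBT).trans hTE) hnn
      (fun v => by
        have h1 := endDeg_sdiff (x := x) (y := y) hBsub v
        obtain ⟨a, ha⟩ := hBev v
        obtain ⟨b, hb⟩ := h.even_deg hB v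
        exact ⟨a - b, by omega⟩)
    have := huniq k (hZT hkZ) B' B hB' hB ((hB's.trans Finset.sdiff_subset).trans hBk)
      (hBsub.trans hBk)
    subst this
    obtain ⟨e, he⟩ := h.nonempty hB'
    exact (Finset.mem_sdiff.1 (hB's he)).2 he
  have hcov : ∀ f ∈ T, f ∈ Z ∨ f ∈ A := by
    intro f hf
    by_contra hcon
    push Not at hcon
    exact hZA (huniq f hf Z A hZ hA (Finset.subset_erase.2 ⟨hZT, hcon.1⟩)
      (Finset.subset_erase.2 ⟨hAT, hcon.2⟩))
  have htriple : ∀ f ∈ T, (f ∈ Z ∧ f ∈ A ∧ f ∉ B) ∨ (f ∈ Z ∧ f ∉ A ∧ f ∈ B) ∨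
      (f ∉ Z ∧ f ∈ A ∧ f ∈ B) := by
    intro f hf
    have := hcov f hf
    rw [hBeq, Finset.mem_symmDiff]
    tauto
  have hBT' : B ⊆ T := hBsub.trans hBT
  have hcirc : ∀ C, Circ C → C ⊆ T → C = Z ∨ C = A ∨ C = B := by
    intro C hC hCT
    have : ∃ f ∈ T, f ∉ C := by
      by_contra hcon
      push Not at hcon
      have h1 := h.eq_of_subset hZ hC (fun e he => hcon e (hZT he))
      have h2 := h.eq_of_subset hA hC (fun e he => hcon e (hAT he))
      exact hZA (h1.trans h2.symm)
    obtain ⟨f, hf, hfC⟩ := this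
    have hCf : C ⊆ T.erase f := Finset.subset_erase.2 ⟨hCT, hfC⟩
    rcases htriple f hf with h' | h' | h'
    · exact Or.inr (Or.inr (huniq f hf C B hC hB hCf (Finset.subset_erase.2 ⟨hBT', h'.2.2⟩)))
    · exact Or.inr (Or.inl (huniq f hf C A hC hA hCf (Finset.subset_erase.2 ⟨hAT, h'.2.1⟩)))
    · exact Or.inl (huniq f hf C Z hC hZ hCf (Finset.subset_erase.2 ⟨hZT, h'.1⟩))
  have hTun : T = Z ∪ A := by
    ext f
    exact ⟨fun hf => Finset.mem_union.2 (hcov f hf), fun hf => Finset.union_subset hZT hAT hf⟩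
  have hdeg3 : ∀ v, endDeg x y Z v + endDeg x y A v + endDeg x y B v = 2 * endDeg x y T v := by
    intro v
    have h1 := endDeg_symmDiff (x := x) (y := y) Z A v
    have h2 := endDeg_union_add_inter (x := x) (y := y) Z A v
    rw [hBeq, hTun]
    omega
  have hdeg : ∀ v, endDeg x y T v = 0 ∨ endDeg x y T v = 2 ∨ endDeg x y T v = 3 := by
    intro v
    have h0 := hdeg3 v
    have h1 := endDeg_mono (x := x) (y := y) hZT v
    have h2 := endDeg_mono (x := x) (y := y) hAT v
    have h3 := endDeg_mono (x := x) (y := y) hBT' v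
    rcases h.deg hZ v with h4 | h4 <;> rcases h.deg hA v with h5 | h5 <;>
      rcases h.deg hB v with h6 | h6 <;> omega
  have hcdeg : ∀ C, Circ C → C ⊆ T → ∀ v, endDeg x y T v = 3 → endDeg x y C v = 2 := by
    intro C hC hCT v hv
    have h0 := hdeg3 v
    have h4 := h.deg hZ v
    have h5 := h.deg hA v
    have h6 := h.deg hB v
    rcases hcirc C hC hCT with rfl | rfl | rfl <;> omega
  have hle : T.card ≤ (endSet x y T).card + 1 := by
    have h1 := hmin _ (Finset.erase_ssubset hf₀)
    have h2 := Finset.card_le_card (endSet_mono (x := x) (y := y) (Finset.erase_subset f₀ T))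
    have h3 := Finset.card_erase_add_one hf₀
    omega
  -- The degrees sum to `2 * |T|`, which is two more than twice the number of vertices, so exactly
  -- two of them are three.
  have hbr : ((endSet x y T).filter fun v => endDeg x y T v = 3).card = 2 := by
    have hsum := sum_endDeg (fun e he => h.loopless e (hTE he)) (Finset.Subset.refl (endSet x y T))
    have h1 : ∀ v ∈ endSet x y T, endDeg x y T v = 2 + if endDeg x y T v = 3 then 1 else 0 := by
      intro v hv
      have := endDeg_pos_iff.2 hv
      split_ifs with h3
      · omega
      · rcases hdeg v with h4 | h4 | h4 <;> omega
    rw [Finset.sum_congr rfl h1, Finset.sum_add_distrib, Finset.sum_const, smul_eq_mul,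
      ← Finset.card_filter] at hsum
    omega
  obtain ⟨p, q, hpq, hset⟩ := Finset.card_eq_two.1 hbr
  refine ⟨⟨Z, A, B, ⟨hZ, hA, hB⟩, ⟨hZT, hAT, hBT'⟩, htriple, hcirc⟩, by omega, ⟨p, q, hpq, ?_⟩,
    hdeg, hcdeg⟩
  intro v
  have := Finset.ext_iff.1 hset v
  simp only [Finset.mem_filter, Finset.mem_insert, Finset.mem_singleton] at this
  rw [← this]
  constructor
  · intro h3
    exact ⟨endDeg_pos_iff.1 (by omega), h3⟩
  · exact fun h3 => h3.2

end IsCycleSystem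

/-- The three cycles play symmetric roles, so the one avoiding `e` can be listed first. -/
theorem IsTheta.exists_triple_of_mem {α V : Type*} [DecidableEq V] {x y : α → V}
    {Circ : Finset α → Prop} {T : Finset α} (h : IsTheta x y Circ T) {e : α} (he : e ∈ T) :
    ∃ Z A B, (Circ Z ∧ Circ A ∧ Circ B) ∧ (Z ⊆ T ∧ A ⊆ T ∧ B ⊆ T) ∧ (e ∉ Z ∧ e ∈ A ∧ e ∈ B) ∧
      (∀ f ∈ T, (f ∈ Z ∧ f ∈ A ∧ f ∉ B) ∨ (f ∈ Z ∧ f ∉ A ∧ f ∈ B) ∨ (f ∉ Z ∧ f ∈ A ∧ f ∈ B)) ∧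
      ∀ C, Circ C → C ⊆ T → C = Z ∨ C = A ∨ C = B := by
  obtain ⟨Z, A, B, ⟨hZ, hA, hB⟩, ⟨hZT, hAT, hBT⟩, htr, hc⟩ := h.exists_triple
  rcases htr e he with h' | h' | h'
  · refine ⟨B, Z, A, ⟨hB, hZ, hA⟩, ⟨hBT, hZT, hAT⟩, ⟨h'.2.2, h'.1, h'.2.1⟩, fun f hf => ?_,
      fun C hC hCT => ?_⟩
    · have := htr f hf; tauto
    · have := hc C hC hCT; tauto
  · refine ⟨A, Z, B, ⟨hA, hZ, hB⟩, ⟨hAT, hZT, hBT⟩, ⟨h'.2.1, h'.1, h'.2.2⟩, fun f hf => ?_,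
      fun C hC hCT => ?_⟩
    · have := htr f hf; tauto
    · have := hc C hC hCT; tauto
  · exact ⟨Z, A, B, ⟨hZ, hA, hB⟩, ⟨hZT, hAT, hBT⟩, h', htr, hc⟩

/-! ### Exchanging an edge of a theta graph. -/

/-- The number of the sets `A`, `B`, `C`, `D` that contain `f`. -/
def multFour {α : Type*} [DecidableEq α] (A B C D : Finset α) (f : α) : ℕ :=
  (if f ∈ A then 1 else 0) + (if f ∈ B then 1 else 0) + (if f ∈ C then 1 else 0) +
    (if f ∈ D then 1 else 0)

theorem card_add_card_le_of_multFour_le {α : Type*} [DecidableEq α] {A B C D U : Finset α}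
    (hA : A ⊆ U) (hB : B ⊆ U) (hC : C ⊆ U) (hD : D ⊆ U) (h : ∀ f, multFour A B C D f ≤ 2) :
    A.card + B.card + C.card + D.card ≤ 2 * U.card := by
  have h1 : ∀ X ⊆ U, X.card = ∑ f ∈ U, if f ∈ X then 1 else 0 := by
    intro X hX
    rw [← Finset.card_filter, Finset.filter_mem_eq_inter, Finset.inter_eq_right.2 hX]
  rw [h1 A hA, h1 B hB, h1 C hC, h1 D hD, ← Finset.sum_add_distrib, ← Finset.sum_add_distrib,
    ← Finset.sum_add_distrib, mul_comm, ← smul_eq_mul, ← Finset.sum_const]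
  exact Finset.sum_le_sum fun f _ => h f

namespace IsCycleSystem

variable {α V : Type*} [DecidableEq V] {x y : α → V} {E : Finset α}
  {Circ : Finset α → Prop}

/-- A nonempty proper subset of a cycle has at least two vertices of odd degree. -/
theorem two_le_card_odd (h : IsCycleSystem x y E Circ) {Z Q : Finset α} (hZ : Circ Z)
    (hQ : Q ⊂ Z) (hne : Q.Nonempty) {W : Finset V}
    (hW : ∀ v, Odd (endDeg x y Q v) → v ∈ W) :
    2 ≤ (W.filter fun v => Odd (endDeg x y Q v)).card := by
  have hQE : Q ⊆ E := hQ.subset.trans (h.subset hZ)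
  have hsum := sum_endDeg (fun e he => h.loopless e (hQE he)) (Finset.Subset.refl (endSet x y Q))
  -- By handshaking the number of odd vertices is even; were it zero, `Q` would contain a cycle
  -- strictly inside `Z`.
  have heven : Even ((endSet x y Q).filter fun v => Odd (endDeg x y Q v)).card := by
    rw [← Finset.even_sum_iff_even_card_odd, hsum]
    exact even_two_mul _
  have heq : ((endSet x y Q).filter fun v => Odd (endDeg x y Q v)) =
      W.filter fun v => Odd (endDeg x y Q v) := by
    ext v
    simp only [Finset.mem_filter, and_congr_left_iff]
    exact fun hv => ⟨fun _ => hW v hv, fun _ => endDeg_pos_iff.1 hv.pos⟩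
  rw [heq] at heven
  by_contra hlt
  have h0 : (W.filter fun v => Odd (endDeg x y Q v)).card = 0 := by
    obtain ⟨k, hk⟩ := heven
    omega
  rw [Finset.card_eq_zero, Finset.filter_eq_empty_iff] at h0
  obtain ⟨C, hC, hCc⟩ := h.exists_of_even hQE hne fun v => by
    by_contra hv
    rw [Nat.not_even_iff_odd] at hv
    exact h0 (hW v hv) hv
  have := h.eq_of_subset hCc hZ (hC.trans hQ.subset)
  subst this
  exact hQ.not_subset hC

variable [DecidableEq α]

/-- At a vertex of degree two of `T`, a cycle of `T` uses both edges or none. -/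
theorem endDeg_inter_eq (h : IsCycleSystem x y E Circ) {T P Q : Finset α} (hP : Circ P)
    (hPT : P ⊆ T) (hQT : Q ⊆ T) {v : V} (hv : endDeg x y T v = 2) {f : α}
    (hfP : f ∈ P) (hf : x f = v ∨ y f = v) : endDeg x y (Q ∩ P) v = endDeg x y Q v := by
  have h1 := h.deg_eq_two_of_mem hP hfP hf
  have h2 : (P.filter fun e => x e = v ∨ y e = v) = T.filter fun e => x e = v ∨ y e = v :=
    Finset.eq_of_subset_of_card_le (Finset.filter_subset_filter _ hPT)
      (by change endDeg x y T v ≤ endDeg x y P v; omega)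
  unfold endDeg
  congr 1
  ext e
  have h3 := Finset.ext_iff.1 h2 e
  have h4 := @hQT e
  simp only [Finset.mem_filter, Finset.mem_inter] at h3 ⊢
  tauto

set_option maxHeartbeats 1000000 in
/-- Exchanging an edge `e` of a theta graph `T` for an edge `e'` so that the result is a theta graph
again: either a cycle through `e` becomes a shorter cycle through `e'`, or four cycles through `e`
or `e'` cover no edge more than twice. -/
theorem exchange (h : IsCycleSystem x y E Circ) {T : Finset α} {e e' : α} (hTE : T ⊆ E)
    (he : e ∈ T) (he' : e' ∉ T) (he'E : e' ∈ E) (hT : IsTheta x y Circ T)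
    (hT' : IsTheta x y Circ (insert e' (T.erase e))) :
    (∃ Z P K K', (Circ Z ∧ Circ P ∧ Circ K ∧ Circ K') ∧ (Z ⊆ T ∧ P ⊆ T ∧ K ⊆ T) ∧
      (e ∉ Z ∧ e ∈ P ∧ e ∈ K) ∧
      (∀ f ∈ T, (f ∈ Z ∧ f ∈ P ∧ f ∉ K) ∨ (f ∈ Z ∧ f ∉ P ∧ f ∈ K) ∨ (f ∉ Z ∧ f ∈ P ∧ f ∈ K)) ∧
      (∀ C, Circ C → C ⊆ T → C = Z ∨ C = P ∨ C = K) ∧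
      K' ⊆ insert e' (K.erase e) ∧ e' ∈ K' ∧ K'.card < K.card) ∨
    ∃ A B A' B', (Circ A ∧ Circ B ∧ Circ A' ∧ Circ B') ∧ (A ⊆ T ∧ B ⊆ T) ∧
      (A' ⊆ insert e' (T.erase e) ∧ B' ⊆ insert e' (T.erase e)) ∧
      ∀ f, multFour A B A' B' f ≤ 2 := by
  set T' := insert e' (T.erase e) with hT'def
  have hee' : e ≠ e' := fun h' => he' (h' ▸ he)
  have heT' : e ∉ T' := by simp [T', hee']
  obtain ⟨Z, A, B, ⟨hZ, hA, hB⟩, ⟨hZT, hAT, hBT⟩, ⟨heZ, heA, heB⟩, htr, hc⟩ :=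
    hT.exists_triple_of_mem he
  obtain ⟨Z', A', B', ⟨hZ', hA', hB'⟩, ⟨hZT', hAT', hBT'⟩, ⟨heZ', heA', heB'⟩, htr', hc'⟩ :=
    hT'.exists_triple_of_mem (Finset.mem_insert_self e' (T.erase e))
  -- The cycle of `T'` avoiding `e'` lies in `T` and avoids `e`, and `T` has only one such cycle.
  have hZZ : Z' = Z := by
    have hsub : Z' ⊆ T := by
      intro f hf
      rcases Finset.mem_insert.1 (hZT' hf) with rfl | h'
      · exact absurd hf heZ'
      · exact Finset.mem_of_mem_erase h'
    rcases hc Z' hZ' hsub with h' | h' | h'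
    · exact h'
    · exact absurd (hZT' (h' ▸ heA)) heT'
    · exact absurd (hZT' (h' ▸ heB)) heT'
  subst hZZ
  -- If `P'` misses the part of `Z'` on `P`, it stays in `K` apart from `e'`. With equal sizes, `K`
  -- and `P'` would differ only in `e` and `e'`, giving a cycle with at most two edges.
  have hshort : ∀ P K P' : Finset α, Circ P → Circ K → Circ P' → P ⊆ T → K ⊆ T → P' ⊆ T' →
      e ∈ P → e ∈ K → e' ∈ P' →
      (∀ f ∈ T, (f ∈ Z' ∧ f ∈ P ∧ f ∉ K) ∨ (f ∈ Z' ∧ f ∉ P ∧ f ∈ K) ∨ (f ∉ Z' ∧ f ∈ P ∧ f ∈ K)) →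
      Z' ∩ P ∩ P' = ∅ → P' ⊆ insert e' (K.erase e) ∧ e' ∈ P' ∧ P'.card < K.card := by
    intro P K P' hP hK hP' hPT hKT hPT' heP heK heP' htr hemp
    have hsub : P' ⊆ insert e' (K.erase e) := by
      intro f hf
      rcases Finset.mem_insert.1 (hPT' hf) with rfl | h'
      · exact Finset.mem_insert_self _ _
      · obtain ⟨hfe, hfT⟩ := Finset.mem_erase.1 h'
        refine Finset.mem_insert_of_mem (Finset.mem_erase.2 ⟨hfe, ?_⟩)
        rcases htr f hfT with h1 | h1 | h1
        · exact absurd (Finset.mem_inter.2 ⟨Finset.mem_inter.2 ⟨h1.1, h1.2.1⟩, hf⟩)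
            (by simp [hemp])
        · exact h1.2.2
        · exact h1.2.2
    refine ⟨hsub, heP', ?_⟩
    have he'K : e' ∉ K := fun h' => he' (hKT h')
    have h1 : (insert e' (K.erase e)).card = K.card := by
      rw [Finset.card_insert_of_notMem (fun h' => he'K (Finset.mem_of_mem_erase h')),
        Finset.card_erase_add_one heK]
    refine lt_of_le_of_ne (h1 ▸ Finset.card_le_card hsub) fun heq => ?_
    have h2 := Finset.eq_of_subset_of_card_le hsub (by omega)
    have h3 : symmDiff K P' ⊆ {e, e'} := by
      intro f hf
      rw [h2] at hf
      simp only [Finset.mem_symmDiff, Finset.mem_insert, Finset.mem_erase,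
        Finset.mem_singleton] at hf ⊢
      tauto
    obtain ⟨C, hC, hCc⟩ := h.exists_of_even (X := symmDiff K P')
      (h3.trans (by
        intro f hf
        rcases Finset.mem_insert.1 hf with rfl | hf
        · exact hTE he
        · rw [Finset.mem_singleton] at hf; exact hf ▸ he'E))
      ⟨e', Finset.mem_symmDiff.2 (Or.inr ⟨heP', he'K⟩)⟩
      fun v => even_endDeg_symmDiff (h.even_deg hK v) (h.even_deg hP' v)
    have h4 := Finset.card_le_card (hC.trans h3)
    have h5 := h.three_le hCc
    have h6 := Finset.card_le_two (a := e) (b := e')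
    omega
  have htrs : ∀ f ∈ T, (f ∈ Z' ∧ f ∈ B ∧ f ∉ A) ∨ (f ∈ Z' ∧ f ∉ B ∧ f ∈ A) ∨
      (f ∉ Z' ∧ f ∈ B ∧ f ∈ A) := by
    intro f hf
    have := htr f hf
    tauto
  have hcs : ∀ C, Circ C → C ⊆ T → C = Z' ∨ C = B ∨ C = A := by
    intro C hC hCT
    have := hc C hC hCT
    tauto
  by_cases hAA : Z' ∩ A ∩ A' = ∅
  · exact Or.inl ⟨Z', A, B, A', ⟨hZ, hA, hB, hA'⟩, ⟨hZT, hAT, hBT⟩, ⟨heZ, heA, heB⟩, htr, hc,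
      hshort A B A' hA hB hA' hAT hBT hAT' heA heB heA' htr hAA⟩
  by_cases hAB : Z' ∩ A ∩ B' = ∅
  · exact Or.inl ⟨Z', A, B, B', ⟨hZ, hA, hB, hB'⟩, ⟨hZT, hAT, hBT⟩, ⟨heZ, heA, heB⟩, htr, hc,
      hshort A B B' hA hB hB' hAT hBT hBT' heA heB heB' htr hAB⟩
  by_cases hBA : Z' ∩ B ∩ A' = ∅
  · exact Or.inl ⟨Z', B, A, A', ⟨hZ, hB, hA, hA'⟩, ⟨hZT, hBT, hAT⟩, ⟨heZ, heB, heA⟩, htrs, hcs,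
      hshort B A A' hB hA hA' hBT hAT hAT' heB heA heA' htrs hBA⟩
  by_cases hBB : Z' ∩ B ∩ B' = ∅
  · exact Or.inl ⟨Z', B, A, B', ⟨hZ, hB, hA, hB'⟩, ⟨hZT, hBT, hAT⟩, ⟨heZ, heB, heA⟩, htrs, hcs,
      hshort B A B' hB hA hB' hBT hAT hBT' heB heA heB' htrs hBB⟩
  right
  rw [← Ne, ← Finset.nonempty_iff_ne_empty] at hAA hAB hBA hBB
  obtain ⟨p, q, hpq, hbr⟩ := hT.exists_branch
  obtain ⟨p', q', hpq', hbr'⟩ := hT'.exists_branch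
  -- `A`, `B` split `Z'` in two, and so do `A'`, `B'`; all four intersections are now nonempty. Each
  -- has at least two odd vertices, all of them branch vertices of `T` or `T'`, while the four
  -- degrees at a vertex sum to at most two. So `8 ≤ 2 * |W|`, and the four branch vertices are
  -- distinct.
  set W : Finset V := {p, q, p', q'} with hW
  have hodd : ∀ P P' : Finset α, Circ P → Circ P' → P ⊆ T → P' ⊆ T' → ∀ v,
      Odd (endDeg x y (Z' ∩ P ∩ P') v) → v ∈ W := by
    intro P P' hP hP' hPT hPT' v hv
    obtain ⟨f, hf, hfv⟩ := mem_endSet.1 (endDeg_pos_iff.1 hv.pos)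
    obtain ⟨⟨hfZ, hfP⟩, hfP'⟩ : (f ∈ Z' ∧ f ∈ P) ∧ f ∈ P' := by
      simpa only [Finset.mem_inter] using hf
    by_contra hvW
    have hZ2 := h.deg_eq_two_of_mem hZ hfZ hfv
    have hT2 : endDeg x y T v = 2 := by
      have h1 := endDeg_mono (x := x) (y := y) hZT v
      have h2 : endDeg x y T v ≠ 3 := fun h' => hvW (by
        rcases (hbr v).1 h' with rfl | rfl <;> simp [W])
      rcases hT.deg_eq v with h3 | h3 | h3 <;> omega
    have hT2' : endDeg x y T' v = 2 := by
      have h1 := endDeg_mono (x := x) (y := y) hZT' v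
      have h2 : endDeg x y T' v ≠ 3 := fun h' => hvW (by
        rcases (hbr' v).1 h' with rfl | rfl <;> simp [W])
      rcases hT'.deg_eq v with h3 | h3 | h3 <;> omega
    have h1 := h.endDeg_inter_eq hP hPT hZT hT2 hfP hfv
    have h2 := h.endDeg_inter_eq (Q := Z' ∩ P) hP' hPT' (Finset.inter_subset_left.trans hZT') hT2'
      hfP' hfv
    rw [h2, h1, hZ2] at hv
    exact absurd hv (by decide)
  have htrZ : ∀ f ∈ Z', (f ∈ A ∧ f ∉ B) ∨ (f ∉ A ∧ f ∈ B) := by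
    intro f hf
    have := htr f (hZT hf)
    tauto
  have htrZ' : ∀ f ∈ Z', (f ∈ A' ∧ f ∉ B') ∨ (f ∉ A' ∧ f ∈ B') := by
    intro f hf
    have := htr' f (hZT' hf)
    tauto
  have hprop : ∀ P P' Q Q' : Finset α, (Z' ∩ Q ∩ Q').Nonempty → (∀ f ∈ Z', f ∈ Q → f ∉ P) →
      Z' ∩ P ∩ P' ⊂ Z' := by
    intro P P' Q Q' hne hd
    refine Finset.ssubset_iff_subset_ne.2 ⟨Finset.inter_subset_left.trans
      Finset.inter_subset_left, fun heq => ?_⟩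
    obtain ⟨f, hf⟩ := hne
    obtain ⟨⟨hfZ, hfQ⟩, -⟩ : (f ∈ Z' ∧ f ∈ Q) ∧ f ∈ Q' := by
      simpa only [Finset.mem_inter] using hf
    have : f ∈ Z' ∩ P ∩ P' := heq.symm.subset hfZ
    exact hd f hfZ hfQ (Finset.mem_inter.1 (Finset.mem_inter.1 this).1).2
  have hABd : ∀ f ∈ Z', f ∈ A → f ∉ B := fun f hf h1 => by have := htrZ f hf; tauto
  have hBAd : ∀ f ∈ Z', f ∈ B → f ∉ A := fun f hf h1 => by have := htrZ f hf; tauto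
  have o1 := h.two_le_card_odd hZ (hprop A A' B B' hBB hBAd) hAA (hodd A A' hA hA' hAT hAT')
  have o2 := h.two_le_card_odd hZ (hprop A B' B B' hBB hBAd) hAB (hodd A B' hA hB' hAT hBT')
  have o3 := h.two_le_card_odd hZ (hprop B A' A B' hAB hABd) hBA (hodd B A' hB hA' hBT hAT')
  have o4 := h.two_le_card_odd hZ (hprop B B' A B' hAB hABd) hBB (hodd B B' hB hB' hBT hBT')
  have hW4 : 4 ≤ W.card := by
    have hle : (W.filter fun v => Odd (endDeg x y (Z' ∩ A ∩ A') v)).card +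
        (W.filter fun v => Odd (endDeg x y (Z' ∩ A ∩ B') v)).card +
        (W.filter fun v => Odd (endDeg x y (Z' ∩ B ∩ A') v)).card +
        (W.filter fun v => Odd (endDeg x y (Z' ∩ B ∩ B') v)).card ≤ W.card * 2 := by
      simp only [Finset.card_filter]
      rw [← Finset.sum_add_distrib, ← Finset.sum_add_distrib, ← Finset.sum_add_distrib,
        ← smul_eq_mul, ← Finset.sum_const]
      refine Finset.sum_le_sum fun v _ => ?_
      have hsplit : ∀ (Q P P' : Finset α), (∀ f ∈ Q, (f ∈ P ∧ f ∉ P') ∨ (f ∉ P ∧ f ∈ P')) →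
          endDeg x y (Q ∩ P) v + endDeg x y (Q ∩ P') v = endDeg x y Q v := by
        intro Q P P' hQ
        rw [← endDeg_union]
        · congr 1
          ext f
          have := hQ f
          simp only [Finset.mem_union, Finset.mem_inter]
          tauto
        · refine Finset.disjoint_left.2 fun f hf hf' => ?_
          have := hQ f (Finset.mem_inter.1 hf).1
          rw [Finset.mem_inter] at hf hf'
          tauto
      have s1 := hsplit Z' A B htrZ
      have s2 := hsplit (Z' ∩ A) A' B' fun f hf => htrZ' f (Finset.mem_inter.1 hf).1
      have s3 := hsplit (Z' ∩ B) A' B' fun f hf => htrZ' f (Finset.mem_inter.1 hf).1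
      have hi : ∀ m : ℕ, (if Odd m then 1 else 0) ≤ m := by
        intro m
        split_ifs with hm
        · exact hm.pos
        · exact Nat.zero_le _
      have i1 := hi (endDeg x y (Z' ∩ A ∩ A') v)
      have i2 := hi (endDeg x y (Z' ∩ A ∩ B') v)
      have i3 := hi (endDeg x y (Z' ∩ B ∩ A') v)
      have i4 := hi (endDeg x y (Z' ∩ B ∩ B') v)
      have hd := h.deg hZ v
      omega
    omega
  have hnotBr : ∀ v, v = p ∨ v = q → endDeg x y T' v ≠ 3 := by
    intro v hv h3
    have hv' := (hbr' v).1 h3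
    have h1 : W = {p, q} ∪ {p', q'} := by
      simp only [W, Finset.insert_union, Finset.singleton_union]
    have h2 := Finset.card_union_add_card_inter {p, q} {p', q'}
    have h4 : 0 < (({p, q} : Finset V) ∩ {p', q'}).card :=
      Finset.card_pos.2 ⟨v, by simp [hv, hv']⟩
    have h5 := Finset.card_le_two (a := p) (b := q)
    have h6 := Finset.card_le_two (a := p') (b := q')
    rw [h1] at hW4
    omega
  -- Both branch vertices of `T` stop being branch vertices in `T'`, so removing `e` must lower
  -- their degrees: `e` joins `p` and `q`.
  have hend : ∀ v, v = p ∨ v = q → x e = v ∨ y e = v := by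
    intro v hv
    by_contra hev
    have h1 := endDeg_erase (x := x) (y := y) he v
    have h2 := endDeg_insert (x := x) (y := y)
      (fun h' => he' (Finset.mem_of_mem_erase h') : e' ∉ T.erase e) v
    have h3 := (hbr v).2 hv
    have h4 := hnotBr v hv
    rw [if_neg hev] at h1
    rw [← hT'def] at h2
    rcases hT'.deg_eq v with h5 | h5 | h5 <;> omega
  have hend' : ∀ v, x e = v ∨ y e = v → v = p ∨ v = q := by
    have h1 := hend p (Or.inl rfl)
    have h2 := hend q (Or.inr rfl)
    intro v hv
    by_contra hne
    push Not at hne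
    rcases h1 with h1 | h1 <;> rcases h2 with h2 | h2
    · exact hpq (h1.symm.trans h2)
    · rcases hv with hv | hv
      · exact hne.1 (hv.symm.trans h1)
      · exact hne.2 (hv.symm.trans h2)
    · rcases hv with hv | hv
      · exact hne.2 (hv.symm.trans h2)
      · exact hne.1 (hv.symm.trans h1)
    · exact hpq (h1.symm.trans h2)
  -- Thus `e` is a chord of `Z'` and nothing else of `T` is left: any remaining edges outside `Z'`
  -- would have even degrees and contain a cycle strictly inside `A`.
  have hTZ : ∀ f ∈ T, f ∉ Z' → f = e := by
    by_contra hcon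
    push Not at hcon
    obtain ⟨f, hfT, hfZ, hfe⟩ := hcon
    have heTZ : e ∈ T \ Z' := Finset.mem_sdiff.2 ⟨he, heZ⟩
    obtain ⟨C, hC, hCc⟩ := h.exists_of_even (X := (T \ Z').erase e)
      (((Finset.erase_subset _ _).trans Finset.sdiff_subset).trans hTE)
      ⟨f, Finset.mem_erase.2 ⟨hfe, Finset.mem_sdiff.2 ⟨hfT, hfZ⟩⟩⟩ fun v => by
        have h1 := endDeg_sdiff (x := x) (y := y) hZT v
        have h2 := endDeg_erase (x := x) (y := y) heTZ v
        by_cases hv : v = p ∨ v = q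
        · have h3 := (hbr v).2 hv
          have h4 := hT.circ_deg _ hZ hZT v h3
          rw [if_pos (hend v hv)] at h2
          exact ⟨0, by omega⟩
        · rw [if_neg (fun h' => hv (hend' v h'))] at h2
          have h3 : endDeg x y T v ≠ 3 := fun h' => hv ((hbr v).1 h')
          have h4 := hT.deg_eq v
          rcases h.deg hZ v with h5 | h5 <;> rcases h4 with h4 | h4 | h4
          · exact ⟨0, by omega⟩
          · exact ⟨1, by omega⟩
          · exact absurd h4 h3
          · exact ⟨0, by omega⟩
          · exact ⟨0, by omega⟩
          · exact absurd h4 h3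
    have hCA : C ⊆ A := by
      intro g hg
      have h1 := Finset.mem_erase.1 (hC hg)
      have h2 := Finset.mem_sdiff.1 h1.2
      have := htr g h2.1
      tauto
    have := h.eq_of_subset hCc hA hCA
    subst this
    exact Finset.notMem_erase e _ (hC heA)
  refine ⟨A, B, A', B', ⟨hA, hB, hA', hB'⟩, ⟨hAT, hBT⟩, ⟨hAT', hBT'⟩, fun f => ?_⟩
  unfold multFour
  by_cases hfZ : f ∈ Z'
  · have h1 := htrZ f hfZ
    have h2 := htrZ' f hfZ
    rcases h1 with h1 | h1 <;> rcases h2 with h2 | h2 <;> simp [h1, h2]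
  · by_cases hfe : f = e
    · have h1 : f ∉ A' := fun h' => heT' (hfe ▸ hAT' h')
      have h2 : f ∉ B' := fun h' => heT' (hfe ▸ hBT' h')
      rw [if_neg h1, if_neg h2]
      split_ifs <;> omega
    · have h1 : f ∉ A := fun h' => hfe (hTZ f (hAT h') hfZ)
      have h2 : f ∉ B := fun h' => hfe (hTZ f (hBT h') hfZ)
      rw [if_neg h1, if_neg h2]
      split_ifs <;> omega

end IsCycleSystem

/-! ### Two arc-disjoint cycles in a digraph of out-degree two. -/

/-- In the digraph where each vertex `w` has the out-neighbours `a w` and `b w`, the function `f`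
selects an out-neighbour inside `X` for each vertex of the nonempty set `X`. -/
structure IsOutSystem {V : Type*} (a b : V → V) (X : Finset V) (f : V → V) : Prop where
  nonempty : X.Nonempty
  step : ∀ w ∈ X, f w = a w ∨ f w = b w
  mapsTo : ∀ w ∈ X, f w ∈ X

/-- There are two arc-disjoint selections of out-neighbours on sets with at most one common
vertex. -/
def HasOutPair {V : Type*} [DecidableEq V] (a b : V → V) (S : Finset V) : Prop :=
  ∃ S₁ f₁ S₂ f₂, IsOutSystem a b S₁ f₁ ∧ IsOutSystem a b S₂ f₂ ∧ S₁ ⊆ S ∧ S₂ ⊆ S ∧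
    (S₁ ∩ S₂).card ≤ 1 ∧ ∀ w ∈ S₁ ∩ S₂, f₁ w ≠ f₂ w

/-- Two selections that share exactly the arc from `u` to `v`. -/
structure IsTangle {V : Type*} [DecidableEq V] (a b : V → V) (S : Finset V) (u v : V)
    (S₁ : Finset V) (f₁ : V → V) (S₂ : Finset V) (f₂ : V → V) : Prop where
  left : IsOutSystem a b S₁ f₁
  right : IsOutSystem a b S₂ f₂
  left_subset : S₁ ⊆ S
  right_subset : S₂ ⊆ S
  left_inj : ∀ w ∈ S₁, ∀ w' ∈ S₁, f₁ w = f₁ w' → w = w'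
  right_inj : ∀ w ∈ S₂, ∀ w' ∈ S₂, f₂ w = f₂ w' → w = w'
  mem_inter : ∀ w, w ∈ S₁ ∧ w ∈ S₂ ↔ w = u ∨ w = v
  left_eq : f₁ u = v
  right_eq : f₂ u = v

section

variable {V : Type*} [DecidableEq V] {a b : V → V} {S : Finset V}

/-- A minimal invariant subset is its own image, because the image is invariant too. So a selection
may be assumed to permute its set, that is, to consist of directed cycles. -/
theorem IsOutSystem.exists_injOn {X : Finset V} {f : V → V} (h : IsOutSystem a b X f) :
    ∃ Y ⊆ X, IsOutSystem a b Y f ∧ ∀ w ∈ Y, ∀ w' ∈ Y, f w = f w' → w = w' := by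
  classical
  obtain ⟨Y, ⟨hYX, hY⟩, hmin⟩ := WellFounded.has_min (measure (Finset.card (α := V))).wf
    {Y | Y ⊆ X ∧ IsOutSystem a b Y f} ⟨X, Finset.Subset.refl X, h⟩
  refine ⟨Y, hYX, hY, ?_⟩
  have himg : Y.image f ⊆ Y := Finset.image_subset_iff.2 hY.mapsTo
  have hcard : ¬ (Y.image f).card < Y.card := by
    refine hmin (Y.image f) ⟨himg.trans hYX, hY.nonempty.image f, fun w hw => hY.step w (himg hw),
      fun w hw => Finset.mem_image_of_mem f (himg hw)⟩
  have := Finset.card_image_iff.1 (le_antisymm Finset.card_image_le (not_lt.1 hcard))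
  exact fun w hw w' hw' hf => this hw hw' hf

/-- The loop is one selection; the other uses all of `S` and leaves `v` by its second arc. -/
theorem HasOutPair.of_loop (hS : ∀ w ∈ S, a w ∈ S ∧ b w ∈ S ∧ a w ≠ b w) {v o : V} (hv : v ∈ S)
    (hvv : v = a v ∨ v = b v) (ho : o = a v ∨ o = b v) (hne : o ≠ v) : HasOutPair a b S := by
  refine ⟨{v}, fun _ => v, S, fun w => if w = v then o else a w, ⟨⟨v, by simp⟩, ?_, ?_⟩,
    ⟨⟨v, hv⟩, ?_, ?_⟩, by simpa using hv, Finset.Subset.refl S,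
    (Finset.card_le_card Finset.inter_subset_left).trans (by simp), ?_⟩
  · intro w hw
    rw [Finset.mem_singleton] at hw
    exact hw ▸ hvv
  · simp
  · intro w _
    split_ifs with h
    · exact h ▸ ho
    · exact Or.inl rfl
  · intro w hw
    split_ifs with h
    · rcases ho with rfl | rfl
      · exact (hS v hv).1
      · exact (hS v hv).2.1
    · exact (hS w hw).1
  · intro w hw
    have : w = v := by simpa using (Finset.mem_inter.1 hw).1
    simp [this, hne.symm]

/-- The digon is one selection. Each vertex other than `u` has an out-neighbour different from `u`,
so the other selection lives on `S.erase u` and shares only `v` with the digon. -/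
theorem HasOutPair.of_digon (hS : ∀ w ∈ S, a w ∈ S ∧ b w ∈ S ∧ a w ≠ b w) {u v : V} (hu : u ∈ S)
    (hv : v ∈ S) (hne : u ≠ v) (huv : v = a u ∨ v = b u) (hvu : u = a v ∨ u = b v) :
    HasOutPair a b S := by
  refine ⟨{u, v}, fun w => if w = u then v else u, S.erase u, fun w => if a w = u then b w else a w,
    ⟨⟨v, by simp⟩, ?_, ?_⟩, ⟨⟨v, Finset.mem_erase.2 ⟨hne.symm, hv⟩⟩, ?_, ?_⟩, ?_,
    Finset.erase_subset _ _, ?_, ?_⟩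
  · intro w hw
    simp only [Finset.mem_insert, Finset.mem_singleton] at hw
    rcases hw with rfl | rfl
    · simpa using huv
    · simpa [hne.symm] using hvu
  · intro w _
    split_ifs <;> simp
  · intro w _
    split_ifs <;> simp
  · intro w hw
    have h1 := hS w (Finset.mem_of_mem_erase hw)
    split_ifs with h
    · exact Finset.mem_erase.2 ⟨fun h' => h1.2.2 (h.trans h'.symm), h1.2.1⟩
    · exact Finset.mem_erase.2 ⟨h, h1.1⟩
  · intro w hw
    simp only [Finset.mem_insert, Finset.mem_singleton] at hw
    rcases hw with rfl | rfl <;> assumption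
  · refine (Finset.card_le_card (t := {v}) ?_).trans (by simp)
    intro w hw
    simp only [Finset.mem_inter, Finset.mem_insert, Finset.mem_singleton, Finset.mem_erase] at hw ⊢
    tauto
  · intro w hw
    simp only [Finset.mem_inter, Finset.mem_insert, Finset.mem_singleton, Finset.mem_erase] at hw
    have h1 : w = v := by tauto
    subst h1
    have h2 := hS w hv
    beta_reduce
    rw [if_neg hne.symm]
    split_ifs with h
    · exact fun h' => h2.2.2 (h.trans h')
    · exact fun h' => h h'.symm

/-- Contracting an arc from `u` to `v` such that no vertex has both as out-neighbours. -/
theorem HasOutPair.of_contract {u v : V} (hu : u ∈ S)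
    (huv : v = a u ∨ v = b u) (hne : u ≠ v)
    (hpair : HasOutPair (fun w => if a w = u then v else a w) (fun w => if b w = u then v else b w)
      (S.erase u)) :
    HasOutPair a b S ∨ ∃ S₁ f₁ S₂ f₂, IsTangle a b S u v S₁ f₁ S₂ f₂ := by
  classical
  have hlift : ∀ X f, IsOutSystem (fun w => if a w = u then v else a w)
      (fun w => if b w = u then v else b w) X f → X ⊆ S.erase u → ∃ Y g, IsOutSystem a b Y g ∧
      Y ⊆ S ∧ (∀ w ∈ Y, w ≠ u → w ∈ X) ∧ g u = v ∧
      (∀ w ∈ X, (g w = f w ∧ g w ≠ u) ∨ (g w = u ∧ f w = v)) ∧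
      ∀ w ∈ Y, ∀ w' ∈ Y, g w = g w' → w = w' := by
    intro X f hX hXS
    have hXu : ∀ w ∈ X, w ≠ u := fun w hw => Finset.ne_of_mem_erase (hXS hw)
    -- A contracted arc into `v` that is not an arc of the original digraph comes from an arc into
    -- `u`: it is redirected to `u`, and `u` is sent on to `v`.
    let g : V → V := fun w => if w = u then v else if f w = a w ∨ f w = b w then f w else u
    have hgX : ∀ w ∈ X, (g w = f w ∧ (f w = a w ∨ f w = b w)) ∨
        (g w = u ∧ f w = v ∧ (u = a w ∨ u = b w)) := by
      intro w hw
      have h1 := hX.step w hw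
      simp only [g, if_neg (hXu w hw)]
      split_ifs with h2
      · exact Or.inl ⟨rfl, h2⟩
      · right
        by_cases ha : a w = u <;> by_cases hb : b w = u <;> simp only [ha, hb, if_true, if_false,
          or_self] at h1 <;> grind
    have hsys : ∃ Y ⊆ S, IsOutSystem a b Y g ∧ ∀ w ∈ Y, w ≠ u → w ∈ X := by
      by_cases hex : ∃ w ∈ X, g w = u
      · obtain ⟨w₀, hw₀, hgw₀⟩ := hex
        have hvX : v ∈ X := by
          have h1 := hX.mapsTo w₀ hw₀
          rcases hgX w₀ hw₀ with h2 | h2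
          · exact absurd (h2.1.symm.trans hgw₀) (hXu _ h1)
          · exact h2.2.1 ▸ h1
        refine ⟨insert u X, Finset.insert_subset hu (hXS.trans (Finset.erase_subset _ _)),
          ⟨⟨u, Finset.mem_insert_self _ _⟩, ?_, ?_⟩, ?_⟩
        · intro w hw
          rcases Finset.mem_insert.1 hw with rfl | hw
          · simpa [g] using huv
          · rcases hgX w hw with h2 | h2
            · rw [h2.1]; exact h2.2
            · rw [h2.1]; exact h2.2.2
        · intro w hw
          rcases Finset.mem_insert.1 hw with rfl | hw
          · simpa [g] using Or.inr hvX
          · rcases hgX w hw with h2 | h2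
            · rw [h2.1]; exact Finset.mem_insert_of_mem (hX.mapsTo w hw)
            · rw [h2.1]; exact Finset.mem_insert_self _ _
        · intro w hw hwu
          exact Finset.mem_of_mem_insert_of_ne hw hwu
      · push Not at hex
        refine ⟨X, hXS.trans (Finset.erase_subset _ _), ⟨hX.nonempty, ?_, ?_⟩, fun w hw _ => hw⟩
        · intro w hw
          rcases hgX w hw with h2 | h2
          · rw [h2.1]; exact h2.2
          · exact absurd h2.1 (hex w hw)
        · intro w hw
          rcases hgX w hw with h2 | h2
          · rw [h2.1]; exact hX.mapsTo w hw
          · exact absurd h2.1 (hex w hw)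
    obtain ⟨Y, hYS, hY, hYX⟩ := hsys
    obtain ⟨Y', hY'Y, hY', hinj⟩ := hY.exists_injOn
    refine ⟨Y', g, hY', hY'Y.trans hYS, fun w hw => hYX w (hY'Y hw), by simp [g], ?_, hinj⟩
    intro w hw
    rcases hgX w hw with h2 | h2
    · exact Or.inl ⟨h2.1, h2.1 ▸ hXu _ (hX.mapsTo w hw)⟩
    · exact Or.inr ⟨h2.1, h2.2.1⟩
  obtain ⟨X₁, k₁, X₂, k₂, hX₁, hX₂, hXS₁, hXS₂, hcard, hdiff⟩ := hpair
  obtain ⟨S₁, f₁, h₁, hS₁, hSX₁, hu₁, hg₁, hinj₁⟩ := hlift X₁ k₁ hX₁ hXS₁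
  obtain ⟨S₂, f₂, h₂, hS₂, hSX₂, hu₂, hg₂, hinj₂⟩ := hlift X₂ k₂ hX₂ hXS₂
  have hdiff' : ∀ w ∈ S₁ ∩ S₂, w ≠ u → f₁ w ≠ f₂ w := by
    intro w hw hwu heq
    rw [Finset.mem_inter] at hw
    have m₁ := hSX₁ w hw.1 hwu
    have m₂ := hSX₂ w hw.2 hwu
    have h3 := hdiff w (Finset.mem_inter.2 ⟨m₁, m₂⟩)
    rcases hg₁ w m₁ with h4 | h4 <;> rcases hg₂ w m₂ with h5 | h5
    · exact h3 (h4.1.symm.trans (heq.trans h5.1))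
    · exact h4.2 (heq.trans h5.1)
    · exact h5.2 (heq.symm.trans h4.1)
    · exact h3 (h4.2.trans h5.2.symm)
  -- If both lifts use `u`, both contain the arc from `u` to `v`. Then `v` is already the only
  -- common vertex in the contraction, so the lifts share just `u` and `v`.
  by_cases hmem : u ∈ S₁ ∧ u ∈ S₂
  · right
    refine ⟨S₁, f₁, S₂, f₂, h₁, h₂, hS₁, hS₂, hinj₁, hinj₂, fun w => ⟨fun hw => ?_, ?_⟩, hu₁, hu₂⟩
    · by_cases hwu : w = u
      · exact Or.inl hwu
      · right
        have hv₁ := hSX₁ v (hu₁ ▸ h₁.mapsTo u hmem.1) hne.symm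
        have hv₂ := hSX₂ v (hu₂ ▸ h₂.mapsTo u hmem.2) hne.symm
        exact Finset.card_le_one.1 hcard w
          (Finset.mem_inter.2 ⟨hSX₁ w hw.1 hwu, hSX₂ w hw.2 hwu⟩) v (Finset.mem_inter.2 ⟨hv₁, hv₂⟩)
    · rintro (rfl | rfl)
      · exact hmem
      · exact ⟨hu₁ ▸ h₁.mapsTo u hmem.1, hu₂ ▸ h₂.mapsTo u hmem.2⟩
  · left
    have hnu : ∀ w ∈ S₁ ∩ S₂, w ≠ u := fun w hw hwu => hmem (Finset.mem_inter.1 (hwu ▸ hw))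
    refine ⟨S₁, f₁, S₂, f₂, h₁, h₂, hS₁, hS₂, (Finset.card_le_card fun w hw => ?_).trans hcard,
      fun w hw => hdiff' w hw (hnu w hw)⟩
    have h3 := hnu w hw
    rw [Finset.mem_inter] at hw ⊢
    exact ⟨hSX₁ w hw.1 h3, hSX₂ w hw.2 h3⟩

/-- A path from `s` to a vertex of `K` avoiding `v`, cut at its first vertex in `K`. -/
theorem exists_path_to {K : Finset V} {s t v : V}
    (hS : ∀ w ∈ S, a w ∈ S ∧ b w ∈ S ∧ a w ≠ b w)
    (hst : Relation.ReflTransGen (fun w w' => (w' = a w ∨ w' = b w) ∧ w' ≠ v) s t) (ht : t ∈ K)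
    (hs : s ∈ S) (hsv : s ≠ v) :
    ∃ (R : Finset V) (f : V → V) (p : V), R ⊆ S ∧ Disjoint R K ∧ p ∈ K ∧ p ≠ v ∧ s ∈ insert p R ∧
      ∀ w ∈ R, (f w = a w ∨ f w = b w) ∧ f w ∈ insert p R := by
  induction hst using Relation.ReflTransGen.head_induction_on with
  | refl => exact ⟨∅, id, t, by simp, by simp, ht, hsv, by simp, by simp⟩
  | @head s s' hst _ ih =>
    have hs' : s' ∈ S := by
      rcases hst.1 with rfl | rfl
      · exact (hS s hs).1
      · exact (hS s hs).2.1
    by_cases hsK : s ∈ K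
    · exact ⟨∅, id, s, by simp, by simp, hsK, hsv, by simp, by simp⟩
    obtain ⟨R, f, p, hRS, hRK, hp, hpv, hs'R, hf⟩ := ih hs' hst.2
    by_cases hsR : s ∈ R
    · exact ⟨R, f, p, hRS, hRK, hp, hpv, Finset.mem_insert_of_mem hsR, hf⟩
    refine ⟨insert s R, Function.update f s s', p, Finset.insert_subset hs hRS,
      Finset.disjoint_insert_left.2 ⟨hsK, hRK⟩, hp, hpv, by simp, ?_⟩
    intro w hw
    rcases Finset.mem_insert.1 hw with rfl | hw
    · rw [Function.update_self]
      refine ⟨hst.1, ?_⟩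
      rw [Finset.mem_insert] at hs'R ⊢
      exact hs'R.imp id Finset.mem_insert_of_mem
    · rw [Function.update_of_ne (fun h : w = s => hsR (h ▸ hw))]
      refine ⟨(hf w hw).1, ?_⟩
      have := (hf w hw).2
      rw [Finset.mem_insert] at this ⊢
      exact this.imp id Finset.mem_insert_of_mem

theorem IsTangle.symm {u v : V} {S₁ S₂ : Finset V} {f₁ f₂ : V → V}
    (h : IsTangle a b S u v S₁ f₁ S₂ f₂) : IsTangle a b S u v S₂ f₂ S₁ f₁ :=
  ⟨h.right, h.left, h.right_subset, h.left_subset, h.right_inj, h.left_inj,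
    fun w => and_comm.trans (h.mem_inter w), h.right_eq, h.left_eq⟩

/-- Leave `u` through `o` and follow the path to its first vertex in `S₁ ∪ S₂`. The selection
containing that vertex takes this detour and drops `v`; the other one then shares only `u` with it,
and the arcs chosen at `u` differ. -/
theorem IsTangle.hasOutPair {u v o : V} {S₁ S₂ : Finset V} {f₁ f₂ : V → V}
    (hS : ∀ w ∈ S, a w ∈ S ∧ b w ∈ S ∧ a w ≠ b w) (h : IsTangle a b S u v S₁ f₁ S₂ f₂)
    (ho : o = a u ∨ o = b u) (hov : o ≠ v)
    (hr : Relation.ReflTransGen (fun w w' => (w' = a w ∨ w' = b w) ∧ w' ≠ v) o u) :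
    HasOutPair a b S := by
  have hu := (h.mem_inter u).2 (Or.inl rfl)
  have huS := h.left_subset hu.1
  have hoS : o ∈ S := by
    rcases ho with rfl | rfl
    · exact (hS u huS).1
    · exact (hS u huS).2.1
  obtain ⟨R, f, p, hRS, hRK, hp, hpv, hoR, hf⟩ :=
    exists_path_to (K := S₁ ∪ S₂) hS hr (Finset.mem_union_left _ hu.1) hoS hov
  have key : ∀ S₁ f₁ S₂ f₂, IsTangle a b S u v S₁ f₁ S₂ f₂ → p ∈ S₁ → Disjoint R S₁ →
      Disjoint R S₂ → HasOutPair a b S := by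
    clear h hu hRK hp S₁ S₂ f₁ f₂
    intro S₁ f₁ S₂ f₂ h hp hR₁ hR₂
    have hu := (h.mem_inter u).2 (Or.inl rfl)
    have hsub : insert p R ⊆ R ∪ S₁.erase v := by
      refine Finset.insert_subset ?_ Finset.subset_union_left
      exact Finset.mem_union_right _ (Finset.mem_erase.2 ⟨hpv, hp⟩)
    have huR : u ∉ R := fun h' => Finset.disjoint_left.1 hR₁ h' hu.1
    refine ⟨R ∪ S₁.erase v, fun w => if w ∈ R then f w else if w = u then o else f₁ w, S₂, f₂,
      ⟨⟨p, hsub (by simp)⟩, ?_, ?_⟩, h.right, ?_, h.right_subset, ?_, ?_⟩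
    · intro w hw
      split_ifs with h1 h2
      · exact (hf w h1).1
      · exact h2 ▸ ho
      · refine h.left.step w ?_
        rcases Finset.mem_union.1 hw with h3 | h3
        · exact absurd h3 h1
        · exact Finset.mem_of_mem_erase h3
    · intro w hw
      split_ifs with h1 h2
      · exact hsub (hf w h1).2
      · exact hsub hoR
      · have hw1 : w ∈ S₁ := by
          rcases Finset.mem_union.1 hw with h3 | h3
          · exact absurd h3 h1
          · exact Finset.mem_of_mem_erase h3
        refine Finset.mem_union_right _ (Finset.mem_erase.2 ⟨fun h3 => h2 ?_, h.left.mapsTo w hw1⟩)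
        exact h.left_inj w hw1 u hu.1 (h3.trans h.left_eq.symm)
    · exact Finset.union_subset hRS ((Finset.erase_subset _ _).trans h.left_subset)
    · refine (Finset.card_le_card (t := {u}) ?_).trans (by simp)
      intro w hw
      rw [Finset.mem_inter, Finset.mem_union, Finset.mem_erase] at hw
      rw [Finset.mem_singleton]
      rcases hw with ⟨h1 | h1, h2⟩
      · exact absurd h2 (Finset.disjoint_left.1 hR₂ h1)
      · exact ((h.mem_inter w).1 ⟨h1.2, h2⟩).resolve_right h1.1
    · intro w hw
      rw [Finset.mem_inter, Finset.mem_union, Finset.mem_erase] at hw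
      have hwu : w = u := by
        rcases hw with ⟨h1 | h1, h2⟩
        · exact absurd h2 (Finset.disjoint_left.1 hR₂ h1)
        · exact ((h.mem_inter w).1 ⟨h1.2, h2⟩).resolve_right h1.1
      beta_reduce
      rw [hwu, if_neg huR, if_pos rfl, h.right_eq]
      exact hov
  rw [Finset.disjoint_union_right] at hRK
  rcases Finset.mem_union.1 hp with hp | hp
  · exact key S₁ f₁ S₂ f₂ h hp hRK.1 hRK.2
  · exact key S₂ f₂ S₁ f₁ h.symm hp hRK.2 hRK.1

/-- A set invariant under an injective function contains the preimages of its elements. -/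
theorem mem_of_apply_mem {X Y : Finset V} {f : V → V} (hXY : X ⊆ Y)
    (hX : ∀ w ∈ X, f w ∈ X) (hinj : ∀ w ∈ Y, ∀ w' ∈ Y, f w = f w' → w = w') {w : V} (hw : w ∈ Y)
    (hfw : f w ∈ X) : w ∈ X := by
  have himg : X.image f = X := Finset.eq_of_subset_of_card_le (Finset.image_subset_iff.2 hX)
    (le_of_eq (Finset.card_image_of_injOn fun w hw w' hw' h =>
      hinj w (hXY hw) w' (hXY hw') h).symm)
  rw [← himg] at hfw
  obtain ⟨w', hw', h⟩ := Finset.mem_image.1 hfw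
  exact hinj w' (hXY hw') w hw h ▸ hw'

/-- As the selections share only `u` and `v`, one of them avoids `q`; its cycle through the arc from
`u` to `v` leads from `v` back to `u`. -/
theorem IsTangle.reaches {u v q : V} {S₁ S₂ : Finset V} {f₁ f₂ : V → V}
    (h : IsTangle a b S u v S₁ f₁ S₂ f₂) (hqu : q ≠ u) (hqv : q ≠ v) :
    Relation.ReflTransGen (fun w w' => (w' = a w ∨ w' = b w) ∧ w' ≠ q) v u := by
  classical
  have key : ∀ S₁ f₁ S₂ f₂, IsTangle a b S u v S₁ f₁ S₂ f₂ → q ∉ S₁ →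
      Relation.ReflTransGen (fun w w' => (w' = a w ∨ w' = b w) ∧ w' ≠ q) v u := by
    clear h S₁ S₂ f₁ f₂
    intro S₁ f₁ S₂ f₂ h hq
    have hu := ((h.mem_inter u).2 (Or.inl rfl)).1
    have hv := ((h.mem_inter v).2 (Or.inr rfl)).1
    have := mem_of_apply_mem (X := S₁.filter fun w =>
      Relation.ReflTransGen (fun w w' => (w' = a w ∨ w' = b w) ∧ w' ≠ q) v w)
      (Finset.filter_subset _ _) (f := f₁) (fun w hw => ?_) h.left_inj hu ?_
    · exact (Finset.mem_filter.1 this).2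
    · rw [Finset.mem_filter] at hw ⊢
      have h1 := h.left.mapsTo w hw.1
      exact ⟨h1, hw.2.tail ⟨h.left.step w hw.1, fun h' => hq (h' ▸ h1)⟩⟩
    · rw [h.left_eq]
      exact Finset.mem_filter.2 ⟨hv, Relation.ReflTransGen.refl⟩
  by_cases hq : q ∈ S₁
  · refine key S₂ f₂ S₁ f₁ h.symm fun hq' => ?_
    rcases (h.mem_inter q).1 ⟨hq, hq'⟩ with h' | h'
    · exact hqu h'
    · exact hqv h'
  · exact key S₁ f₁ S₂ f₂ h hq

/-- A permutation with several orbits splits `S` into two disjoint invariant sets. The clause `w ≠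
u` makes the path in the alternative stop at its first visit to `u`. -/
theorem HasOutPair.of_orbit {σ : V → V} (hσ : ∀ w ∈ S, σ w ∈ S)
    (hinj : ∀ w ∈ S, ∀ w' ∈ S, σ w = σ w' → w = w') (hstep : ∀ w ∈ S, σ w = a w ∨ σ w = b w)
    {s u : V} (hs : s ∈ S) (hu : u ∈ S) :
    HasOutPair a b S ∨ Relation.ReflTransGen (fun w w' => w ∈ S ∧ w' = σ w ∧ w ≠ u) s u := by
  classical
  by_cases hr : Relation.ReflTransGen (fun w w' => w ∈ S ∧ w' = σ w ∧ w ≠ u) s u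
  · exact Or.inr hr
  left
  set X := S.filter fun w => Relation.ReflTransGen (fun w w' => w ∈ S ∧ w' = σ w ∧ w ≠ u) s w
    with hX
  have hXS : X ⊆ S := Finset.filter_subset _ _
  have huX : u ∉ X := fun h => hr (Finset.mem_filter.1 h).2
  have hXσ : ∀ w ∈ X, σ w ∈ X := by
    intro w hw
    have hwu : w ≠ u := fun h => huX (h ▸ hw)
    rw [hX, Finset.mem_filter] at hw ⊢
    exact ⟨hσ w hw.1, hw.2.tail ⟨hw.1, rfl, hwu⟩⟩
  refine ⟨X, σ, S \ X, σ, ⟨⟨s, Finset.mem_filter.2 ⟨hs, .refl⟩⟩, fun w hw => hstep w (hXS hw), hXσ⟩,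
    ⟨⟨u, Finset.mem_sdiff.2 ⟨hu, huX⟩⟩, fun w hw => hstep w (Finset.mem_sdiff.1 hw).1, ?_⟩, hXS,
    Finset.sdiff_subset, by simp, by simp⟩
  intro w hw
  rw [Finset.mem_sdiff] at hw ⊢
  exact ⟨hσ w hw.1, fun h => hw.2 (mem_of_apply_mem hXS hXσ hinj hw.1 h)⟩

/-- A digraph in which every vertex has two out-neighbours has two arc-disjoint cycles with at most
one common vertex, stated in terms of selections of out-neighbours. -/
theorem hasOutPair_of_outDegree_two (hne : S.Nonempty)
    (hS : ∀ w ∈ S, a w ∈ S ∧ b w ∈ S ∧ a w ≠ b w) : HasOutPair a b S := by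
  classical
  induction hn : S.card using Nat.strong_induction_on generalizing S a b with
  | _ n ih =>
  subst hn
  by_contra hnot
  have hmem : ∀ {w z}, w ∈ S → (z = a w ∨ z = b w) → z ∈ S := by
    rintro w z hw (rfl | rfl)
    · exact (hS w hw).1
    · exact (hS w hw).2.1
  have hother : ∀ {w z}, w ∈ S → (z = a w ∨ z = b w) → ∃ o, (o = a w ∨ o = b w) ∧ o ≠ z := by
    rintro w z hw (rfl | rfl)
    · exact ⟨b w, Or.inr rfl, (hS w hw).2.2.symm⟩
    · exact ⟨a w, Or.inl rfl, (hS w hw).2.2⟩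
  have hloop : ∀ {w z}, w ∈ S → (z = a w ∨ z = b w) → z ≠ w := by
    rintro w z hw hz rfl
    obtain ⟨o, ho, hoz⟩ := hother hw hz
    exact hnot (HasOutPair.of_loop hS hw hz ho hoz)
  have hdigon : ∀ {u v}, u ∈ S → (v = a u ∨ v = b u) → ¬ (u = a v ∨ u = b v) := by
    intro u v hu huv hvu
    exact hnot (HasOutPair.of_digon hS hu (hmem hu huv) (hloop hu huv).symm huv hvu)
  have hthree : ∀ {w p q r}, w ∈ S → (p = a w ∨ p = b w) → (q = a w ∨ q = b w) →
      (r = a w ∨ r = b w) → p ≠ q → r = p ∨ r = q := by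
    intro w p q r hw hp hq hr hpq
    grind
  have htangle : ∀ {u v}, u ∈ S → (v = a u ∨ v = b u) →
      (∀ w ∈ S, (u = a w ∨ u = b w) → ¬ (v = a w ∨ v = b w)) →
      ∃ S₁ f₁ S₂ f₂, IsTangle a b S u v S₁ f₁ S₂ f₂ := by
    intro u v hu huv hblock
    have hvu := hloop hu huv
    refine (HasOutPair.of_contract hu huv hvu.symm (ih _ (Finset.card_erase_lt_of_mem hu)
      ⟨v, Finset.mem_erase.2 ⟨hvu, hmem hu huv⟩⟩ (fun w hw => ?_) rfl)).resolve_left hnot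
    have hwS := Finset.mem_of_mem_erase hw
    have h1 := hS w hwS
    have h2 := hblock w hwS
    have hvE : v ∈ S.erase u := Finset.mem_erase.2 ⟨hvu, hmem hu huv⟩
    refine ⟨?_, ?_, ?_⟩
    · split_ifs with h3
      · exact hvE
      · exact Finset.mem_erase.2 ⟨h3, h1.1⟩
    · split_ifs with h3
      · exact hvE
      · exact Finset.mem_erase.2 ⟨h3, h1.2.1⟩
    · split_ifs with h3 h4 h4
      · exact absurd (h3.trans h4.symm) h1.2.2
      · exact fun h5 => h2 (Or.inl h3.symm) (Or.inr h5)
      · exact fun h5 => h2 (Or.inr h4.symm) (Or.inl h5.symm)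
      · exact h1.2.2
  -- If both arcs leaving `u` could be contracted, there would be two tangles, and the second would
  -- supply the return path to `u` that turns the first into a pair.
  have hblocked : ∀ u ∈ S, ∃ v w, (v = a u ∨ v = b u) ∧ w ∈ S ∧ (u = a w ∨ u = b w) ∧
      (v = a w ∨ v = b w) := by
    intro u hu
    by_contra hcon
    push Not at hcon
    have hcon' : ∀ v, (v = a u ∨ v = b u) → ∀ w ∈ S, (u = a w ∨ u = b w) →
        ¬ (v = a w ∨ v = b w) := by
      intro v hv w hw huw hvw
      have := hcon v w hv hw huw
      tauto
    obtain ⟨S₁, f₁, S₂, f₂, ht⟩ := htangle hu (Or.inl rfl) (hcon' _ (Or.inl rfl))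
    obtain ⟨T₁, g₁, T₂, g₂, ht'⟩ := htangle hu (Or.inr rfl) (hcon' _ (Or.inr rfl))
    exact hnot (ht.hasOutPair hS (Or.inr rfl) (hS u hu).2.2.symm
      (ht'.reaches (hloop hu (Or.inl rfl)) (hS u hu).2.2))
  choose! η ω hη hωS hωu hωη using hblocked
  -- If `ω u = ω u'` with `u ≠ u'`, its out-neighbours are `u` and `u'`, so `η u = u'` and `η u' =
  -- u` form a digon. The inverse `σ` of `ω` then follows an arc at every vertex.
  have hωinj : Set.InjOn ω S := by
    intro u hu u' hu' heq
    by_contra hne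
    have h1 := hωη u hu
    have h2 := hωη u' hu'
    have h3 := hωu u' hu'
    rw [← heq] at h2 h3
    have h4 := (hthree (hωS u hu) (hωu u hu) h3 h1 hne).resolve_left (hloop hu (hη u hu))
    have h5 := (hthree (hωS u hu) (hωu u hu) h3 h2 hne).resolve_right (hloop hu' (hη u' hu'))
    exact hdigon hu (h4 ▸ hη u hu) (h5 ▸ hη u' hu')
  have hsurj : ∀ p ∈ S, ∃ u ∈ S, ω u = p := by
    have : S.image ω = S := Finset.eq_of_subset_of_card_le (Finset.image_subset_iff.2 hωS)
      (le_of_eq (Finset.card_image_of_injOn hωinj).symm)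
    intro p hp
    rw [← this] at hp
    exact Finset.mem_image.1 hp
  choose! σ hσS hσ using hsurj
  have hσinj : ∀ w ∈ S, ∀ w' ∈ S, σ w = σ w' → w = w' := fun w hw w' hw' h => by
    rw [← hσ w hw, ← hσ w' hw', h]
  have hσstep : ∀ w ∈ S, σ w = a w ∨ σ w = b w := by
    intro w hw
    have := hωu (σ w) (hσS w hw)
    rwa [hσ w hw] at this
  -- By `of_orbit`, `σ` is a single cycle. If the arc from `u` to `σ u` can be contracted, the orbit
  -- of the other out-neighbour returns to `u` before reaching `σ u` and resolves the tangle.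
  by_cases hunb : ∃ u ∈ S, ∀ w ∈ S, (u = a w ∨ u = b w) → ¬ (σ u = a w ∨ σ u = b w)
  · obtain ⟨u, hu, hub⟩ := hunb
    obtain ⟨S₁, f₁, S₂, f₂, ht⟩ := htangle hu (hσstep u hu) hub
    obtain ⟨o, ho, hoσ⟩ := hother hu (hσstep u hu)
    have hr := (HasOutPair.of_orbit hσS hσinj hσstep (hmem hu ho) hu).resolve_left hnot
    refine hnot (ht.hasOutPair hS ho hoσ (Relation.ReflTransGen.mono ?_ _ _ hr))
    rintro w w' ⟨hwS, rfl, hwu⟩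
    exact ⟨hσstep w hwS, fun h => hwu (hσinj w hwS u hu h)⟩
  · push Not at hunb
    -- Otherwise the vertex blocking the arc from `σ p` to `σ (σ p)` can only be `p`, so the
    -- out-neighbours of `p` are `σ p` and `σ (σ p)`. Then the arc from `u` to `σ (σ u)` can be
    -- contracted, and the path that goes from `σ u` to `σ (σ (σ u))` and on along `σ` to `u` avoids
    -- `σ (σ u)`.
    have hsq : ∀ p ∈ S, σ (σ p) = a p ∨ σ (σ p) = b p := by
      intro p hp
      obtain ⟨w, hw, hw1, hw2⟩ := hunb (σ p) (hσS p hp)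
      have h1 : σ w = σ p := by
        rcases hthree hw hw1 hw2 (hσstep w hw)
          (hloop (hσS p hp) (hσstep _ (hσS p hp))).symm with h | h
        · exact h
        · have := hσinj w hw _ (hσS p hp) h
          exact absurd (this ▸ rfl) (hloop hw hw1)
      rwa [hσinj w hw p hp h1] at hw2
    obtain ⟨u, hu⟩ := hne
    have hu1 := hσS u hu
    have hu2 := hσS _ hu1
    have hu3 := hσS _ hu2
    have hne2 : σ (σ u) ≠ u := hloop hu (hsq u hu)
    have hne12 : σ (σ u) ≠ σ u := hloop hu1 (hσstep _ hu1)
    have hne23 : σ (σ (σ u)) ≠ σ (σ u) := hloop hu2 (hσstep _ hu2)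
    have hne13 : σ (σ (σ u)) ≠ σ u := hloop hu1 (hsq _ hu1)
    obtain ⟨S₁, f₁, S₂, f₂, ht⟩ := htangle hu (hsq u hu) (by
      intro w hw h1 h2
      rcases hthree hw (hσstep w hw) (hsq w hw) h1
        (hloop (hσS w hw) (hσstep _ (hσS w hw))).symm with h3 | h3 <;>
      rcases hthree hw (hσstep w hw) (hsq w hw) h2
        (hloop (hσS w hw) (hσstep _ (hσS w hw))).symm with h4 | h4
      · exact hne2 (h4.trans h3.symm)
      · rw [← h3] at h4
        exact hne12 h4
      · have h5 := hσinj _ hu1 w hw h4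
        rw [← h5] at h3
        exact hdigon hu (hsq u hu) (by rw [← h3.symm]; exact h3 ▸ hσstep _ hu2)
      · exact hne2 (h4.trans h3.symm))
    have hr := (HasOutPair.of_orbit hσS hσinj hσstep hu3 hu).resolve_left hnot
    refine hnot (ht.hasOutPair hS (hσstep u hu) hne12.symm
      (Relation.ReflTransGen.head ⟨hsq _ hu1, hne23⟩ ?_))
    have hinv : ∀ w, Relation.ReflTransGen (fun w w' => w ∈ S ∧ w' = σ w ∧ w ≠ u) (σ (σ (σ u))) w →
        w ≠ σ u ∧ w ≠ σ (σ u) ∧ Relation.ReflTransGen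
          (fun w w' => (w' = a w ∨ w' = b w) ∧ w' ≠ σ (σ u)) (σ (σ (σ u))) w := by
      intro w hw
      induction hw with
      | refl => exact ⟨hne13, hne23, .refl⟩
      | tail _ hstep ih' =>
        obtain ⟨hwS, rfl, hwu⟩ := hstep
        have h1 := fun h => ih'.1 (hσinj _ hwS _ hu1 h)
        exact ⟨fun h => hwu (hσinj _ hwS u hu h), h1, ih'.2.2.tail ⟨hσstep _ hwS, h1⟩⟩
    exact (hinv u hr).2.2

end

/-! ### Combining two exchanges on one cycle. -/

namespace IsCycleSystem

variable {α V : Type*} [DecidableEq α] [DecidableEq V] {x y : α → V} {E : Finset α}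
  {Circ : Finset α → Prop}

theorem not_parallel (h : IsCycleSystem x y E Circ) {e f : α} (he : e ∈ E) (hf : f ∈ E)
    (hef : e ≠ f) {v w : V} (hvw : v ≠ w) (hev : x e = v ∨ y e = v) (hew : x e = w ∨ y e = w)
    (hfv : x f = v ∨ y f = v) (hfw : x f = w ∨ y f = w) : False := by
  have hends : ∀ g ∈ ({e, f} : Finset α), x g ∈ ({v, w} : Finset V) ∧ y g ∈ ({v, w} : Finset V) := by
    intro g hg
    simp only [Finset.mem_insert, Finset.mem_singleton] at hg ⊢
    rcases hg with rfl | rfl <;> grind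
  obtain ⟨C, hC, hCc⟩ := h.exists_of_card (X := {e, f}) (K := {v, w})
    (Finset.insert_subset he (by simpa using hf)) ⟨e, by simp⟩ (endSet_subset_iff.2 hends)
    (by rw [Finset.card_pair hvw, Finset.card_pair hef])
  have h1 := Finset.card_le_card hC
  have h2 := h.three_le hCc
  have h3 := Finset.card_le_two (a := e) (b := f)
  omega

set_option maxHeartbeats 400000 in
/-- Two exchanges that shorten the same cycle `K` of a theta graph can be combined. -/
theorem exists_double_exchange (h : IsCycleSystem x y E Circ) {T : Finset α} {e₁ e₂ k₁ k₂ : α}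
    (hTE : T ⊆ E) (he₁ : e₁ ∈ T) (he₂ : e₂ ∈ T) (he : e₁ ≠ e₂) (hk₁ : k₁ ∉ T) (hk₂ : k₂ ∉ T)
    (hk : k₁ ≠ k₂) (hkE₁ : k₁ ∈ E) (hkE₂ : k₂ ∈ E) (hT : IsTheta x y Circ T)
    (hT₁ : IsTheta x y Circ (insert k₁ (T.erase e₁)))
    (hT₂ : IsTheta x y Circ (insert k₂ (T.erase e₂)))
    (hT₁₂ : IsTheta x y Circ (insert k₂ ((insert k₁ (T.erase e₁)).erase e₂)))
    {K K₁ K₂ : Finset α} (hK : Circ K) (hK₁ : Circ K₁) (hK₂ : Circ K₂) (hKT : K ⊆ T)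
    (heK₁ : e₁ ∈ K) (heK₂ : e₂ ∈ K) (hsub₁ : K₁ ⊆ insert k₁ (K.erase e₁))
    (hsub₂ : K₂ ⊆ insert k₂ (K.erase e₂)) (hkK₁ : k₁ ∈ K₁) {p q : V} (hpq : p ≠ q)
    (hp : endDeg x y T p = 3) (hq : endDeg x y T q = 3) (hpe : x e₁ = p ∨ y e₁ = p)
    (hpk : ¬ (x k₁ = p ∨ y k₁ = p)) (hqe : x e₂ = q ∨ y e₂ = q) (hqk : ¬ (x k₂ = q ∨ y k₂ = q)) :
    ∃ C, Circ C ∧ C ⊆ insert k₁ (insert k₂ ((K.erase e₁).erase e₂)) ∧ C.card + 2 ≤ K.card := by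
  have he₂' : e₂ ∈ insert k₁ (T.erase e₁) :=
    Finset.mem_insert_of_mem (Finset.mem_erase.2 ⟨he.symm, he₂⟩)
  have hk₂' : k₂ ∉ (insert k₁ (T.erase e₁)).erase e₂ := by
    simp only [Finset.mem_erase, Finset.mem_insert]
    tauto
  have hk₁' : k₁ ∉ T.erase e₁ := fun h' => hk₁ (Finset.mem_of_mem_erase h')
  have hd1 := fun v => endDeg_erase (x := x) (y := y) he₁ v
  have hd2 := fun v => endDeg_insert (x := x) (y := y) hk₁' v
  have hd3 := fun v => endDeg_erase (x := x) (y := y) he₂' v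
  have hd4 := fun v => endDeg_insert (x := x) (y := y) hk₂' v
  have hd5 := fun v => endDeg_erase (x := x) (y := y) he₂ v
  have hd6 := fun v => endDeg_insert (x := x) (y := y)
    (fun h' => hk₂ (Finset.mem_of_mem_erase h') : k₂ ∉ T.erase e₂) v
  have hkK₁' : k₁ ∉ K := fun h' => hk₁ (hKT h')
  have hkK₂' : k₂ ∉ K := fun h' => hk₂ (hKT h')
  -- The first exchange lowers the degree at `p` to two. If the second lowered it as well, degree
  -- one would result after both; if it raised it, degree four would result from the second alone.
  have hbal₂ : (x e₂ = p ∨ y e₂ = p ↔ x k₂ = p ∨ y k₂ = p) ∧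
      endDeg x y (insert k₂ (T.erase e₂)) p = 3 := by
    have a1 := hd1 p
    have a2 := hd2 p
    have a3 := hd3 p
    have a4 := hd4 p
    have a5 := hd5 p
    have a6 := hd6 p
    rw [if_pos hpe] at a1
    rw [if_neg hpk] at a2
    have b1 := hT₁₂.deg_eq p
    have b2 := hT₂.deg_eq p
    by_cases c1 : x e₂ = p ∨ y e₂ = p <;> by_cases c2 : x k₂ = p ∨ y k₂ = p <;>
      simp only [if_pos, c1, c2, if_false] at a3 a4 a5 a6 <;>
      simp only [c1, c2] <;> first | (refine ⟨trivial, ?_⟩; omega) | (exfalso; omega)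
  have hbal₁ : (x e₁ = q ∨ y e₁ = q ↔ x k₁ = q ∨ y k₁ = q) ∧
      endDeg x y (insert k₁ (T.erase e₁)) q = 3 := by
    have a1 := hd1 q
    have a2 := hd2 q
    have a3 := hd3 q
    have a4 := hd4 q
    rw [if_pos hqe] at a3
    rw [if_neg hqk] at a4
    have b1 := hT₁₂.deg_eq q
    have b2 := hT₁.deg_eq q
    by_cases c1 : x e₁ = q ∨ y e₁ = q <;> by_cases c2 : x k₁ = q ∨ y k₁ = q <;>
      simp only [if_pos, c1, c2, if_false] at a1 a2 <;>
      simp only [c1, c2] <;> first | (refine ⟨trivial, ?_⟩; omega) | (exfalso; omega)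
  have hnone : ∀ {K' : Finset α} {e k : α} {v : V}, Circ K' → e ∈ K → k ∉ K →
      K' ⊆ insert k (K.erase e) → endDeg x y T v = 3 → (x e = v ∨ y e = v) →
      ¬ (x k = v ∨ y k = v) → endDeg x y K' v = 0 := by
    intro K' e k v hK' heK hkK hsub hv hev hkv
    have a1 := endDeg_mono (x := x) (y := y) hsub v
    have a2 := endDeg_insert (x := x) (y := y)
      (fun h' => hkK (Finset.mem_of_mem_erase h') : k ∉ K.erase e) v
    have a3 := endDeg_erase (x := x) (y := y) heK v
    have a4 := hT.circ_deg K hK hKT v hv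
    rw [if_neg hkv] at a2
    rw [if_pos hev] at a3
    rcases h.deg hK' v with a5 | a5 <;> omega
  have hp0 := hnone hK₁ heK₁ hkK₁' hsub₁ hp hpe hpk
  have hq0 := hnone hK₂ heK₂ hkK₂' hsub₂ hq hqe hqk
  have hKT₁ : K₁ ⊆ insert k₁ (T.erase e₁) :=
    hsub₁.trans (Finset.insert_subset_insert _ (Finset.erase_subset_erase _ hKT))
  have hKT₂ : K₂ ⊆ insert k₂ (T.erase e₂) :=
    hsub₂.trans (Finset.insert_subset_insert _ (Finset.erase_subset_erase _ hKT))
  have hall : ∀ {K' : Finset α} {e k : α} {v : V}, K' ⊆ insert k (K.erase e) →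
      endDeg x y T v = 3 → endDeg x y K' v = 2 → ¬ (x k = v ∨ y k = v) →
      ∀ f ∈ K, (x f = v ∨ y f = v) → f ∈ K' := by
    intro K' e k v hsub hv hv' hkv f hf hfv
    have a4 := hT.circ_deg K hK hKT v hv
    have : (K'.filter fun e => x e = v ∨ y e = v) = K.filter fun e => x e = v ∨ y e = v := by
      refine Finset.eq_of_subset_of_card_le (fun g hg => ?_) (a4.trans hv'.symm).le
      rw [Finset.mem_filter] at hg ⊢
      refine ⟨?_, hg.2⟩
      rcases Finset.mem_insert.1 (hsub hg.1) with rfl | h'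
      · exact absurd hg.2 hkv
      · exact Finset.mem_of_mem_erase h'
    exact (Finset.mem_filter.1 (this.symm.subset (Finset.mem_filter.2 ⟨hf, hfv⟩))).1
  have hnq : ¬ (x e₂ = p ∨ y e₂ = p) := by
    intro hpe₂
    have hqe₁ : ¬ (x e₁ = q ∨ y e₁ = q) := fun hqe₁ =>
      h.not_parallel (hTE he₁) (hTE he₂) he hpq hpe hqe₁ hpe₂ hqe
    have := hall hsub₁ hq (hT₁.circ_deg K₁ hK₁ hKT₁ q hbal₁.2)
      (fun h' => hqe₁ (hbal₁.1.2 h')) e₂ heK₂ hqe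
    have := endDeg_pos_of_mem this hpe₂
    omega
  have hnp : ¬ (x e₁ = q ∨ y e₁ = q) := by
    intro hqe₁
    have := hall hsub₂ hp (hT₂.circ_deg K₂ hK₂ hKT₂ p hbal₂.2)
      (fun h' => hnq (hbal₂.1.2 h')) e₁ heK₁ hpe
    have := endDeg_pos_of_mem this hqe₁
    omega
  have hall₂ := hall hsub₂ hp (hT₂.circ_deg K₂ hK₂ hKT₂ p hbal₂.2) (fun h' => hnq (hbal₂.1.2 h'))
  have hall₁ := hall hsub₁ hq (hT₁.circ_deg K₁ hK₁ hKT₁ q hbal₁.2) (fun h' => hnp (hbal₁.1.2 h'))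
  have hno₁ : ∀ f ∈ K₁, ¬ (x f = p ∨ y f = p) := fun f hf hfp => by
    have := endDeg_pos_of_mem hf hfp
    omega
  have hno₂ : ∀ f ∈ K₂, ¬ (x f = q ∨ y f = q) := fun f hf hfq => by
    have := endDeg_pos_of_mem hf hfq
    omega
  set Kp := K.filter fun e => x e = p ∨ y e = p with hKp
  set Kq := K.filter fun e => x e = q ∨ y e = q with hKq
  have hdisj : Disjoint Kp Kq := by
    refine Finset.disjoint_left.2 fun f hf hf' => ?_
    rw [hKp, Finset.mem_filter] at hf
    rw [hKq, Finset.mem_filter] at hf'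
    exact hno₂ f (hall₂ f hf.1 hf.2) hf'.2
  have hcardp : Kp.card = 2 := hT.circ_deg K hK hKT p hp
  have hcardq : Kq.card = 2 := hT.circ_deg K hK hKT q hq
  -- `K₁` misses `p` and contains both edges of `K` at `q`; `K₂` misses `q` and contains both edges
  -- of `K` at `p`. These four edges cancel, and only `k₁` and `k₂` are new, which saves two.
  have hU : symmDiff (symmDiff K K₁) K₂ ⊆ insert k₁ (insert k₂ (K \ (Kp ∪ Kq))) := by
    intro f hf
    have s1 := @hsub₁ f
    have s2 := @hsub₂ f
    have a1 := hall₁ f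
    have a2 := hall₂ f
    have n1 := hno₁ f
    have n2 := hno₂ f
    simp only [Finset.mem_symmDiff, Finset.mem_insert, Finset.mem_erase, Finset.mem_sdiff,
      Finset.mem_union, hKp, hKq, Finset.mem_filter] at hf s1 s2 ⊢
    clear * - hf s1 s2 a1 a2 n1 n2
    tauto
  have hpK : e₁ ∈ Kp := Finset.mem_filter.2 ⟨heK₁, hpe⟩
  have hqK : e₂ ∈ Kq := Finset.mem_filter.2 ⟨heK₂, hqe⟩
  have hk₁K₂ : k₁ ∉ K₂ := fun h' => by
    rcases Finset.mem_insert.1 (hsub₂ h') with h1 | h1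
    · exact hk h1
    · exact hkK₁' (Finset.mem_of_mem_erase h1)
  have hUE : insert k₁ (insert k₂ (K \ (Kp ∪ Kq))) ⊆ E :=
    Finset.insert_subset hkE₁ (Finset.insert_subset hkE₂
      ((Finset.sdiff_subset.trans hKT).trans hTE))
  obtain ⟨C, hC, hCc⟩ := h.exists_of_even (X := symmDiff (symmDiff K K₁) K₂) (hU.trans hUE)
    ⟨k₁, by simp [Finset.mem_symmDiff, hkK₁, hkK₁', hk₁K₂]⟩ fun v =>
      even_endDeg_symmDiff (even_endDeg_symmDiff (h.even_deg hK v) (h.even_deg hK₁ v))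
        (h.even_deg hK₂ v)
  refine ⟨C, hCc, (hC.trans hU).trans (Finset.insert_subset_insert _
    (Finset.insert_subset_insert _ fun f hf => ?_)), ?_⟩
  · rw [Finset.mem_sdiff, Finset.mem_union] at hf
    refine Finset.mem_erase.2 ⟨?_, Finset.mem_erase.2 ⟨?_, hf.1⟩⟩
    · rintro rfl
      exact hf.2 (Or.inr hqK)
    · rintro rfl
      exact hf.2 (Or.inl hpK)
  · have c1 := Finset.card_le_card (hC.trans hU)
    have c2 := Finset.card_insert_le k₁ (insert k₂ (K \ (Kp ∪ Kq)))
    have c3 := Finset.card_insert_le k₂ (K \ (Kp ∪ Kq))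
    have c4 := Finset.card_sdiff_add_card_eq_card (Finset.union_subset (Finset.filter_subset _ _)
      (Finset.filter_subset _ _) : Kp ∪ Kq ⊆ K)
    have c5 := Finset.card_union_of_disjoint hdisj
    omega

end IsCycleSystem

/-! ### Rainbow cycles in the graphic case. -/

/-- Four rainbow cycles of total size at most `m` that cover no element more than twice. -/
def HasShortTuple {α κ : Type*} [DecidableEq α] (Circ : Finset α → Prop) (c : α → κ) (m : ℕ) :
    Prop :=
  ∃ A B C D : Finset α, (Circ A ∧ Circ B ∧ Circ C ∧ Circ D) ∧
    (Set.InjOn c A ∧ Set.InjOn c B ∧ Set.InjOn c C ∧ Set.InjOn c D) ∧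
    (∀ f, multFour A B C D f ≤ 2) ∧ A.card + B.card + C.card + D.card ≤ m

theorem HasShortTuple.of_pair {α κ : Type*} [DecidableEq α] {Circ : Finset α → Prop} {c : α → κ}
    {m : ℕ} {A B : Finset α} (hA : Circ A) (hB : Circ B) (hcA : Set.InjOn c A)
    (hcB : Set.InjOn c B) (hdisj : Disjoint A B) (hm : 2 * (A.card + B.card) ≤ m) :
    HasShortTuple Circ c m := by
  refine ⟨A, A, B, B, ⟨hA, hA, hB, hB⟩, ⟨hcA, hcA, hcB, hcB⟩, fun f => ?_, by omega⟩
  have h1 : f ∈ A → f ∉ B := fun h => Finset.disjoint_left.1 hdisj h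
  unfold multFour
  split_ifs <;> simp_all

namespace IsCycleSystem

variable {α V κ : Type*} [DecidableEq α] [DecidableEq V] [Fintype κ] [DecidableEq κ]
  {x y : α → V} {E : Finset α} {Circ : Finset α → Prop} {S : Finset V} {c : α → κ}

/-- The case in which each vertex is an end of both edges of some colour. -/
theorem hasShortTuple_of_dominating (h : IsCycleSystem x y E Circ)
    (hS : ∀ e ∈ E, x e ∈ S ∧ y e ∈ S) (hne : S.Nonempty) (hcard : S.card ≤ Fintype.card κ)
    (hc : ∀ s, (E.filter fun e => c e = s).card = 2)
    (hdom : ∀ v ∈ S, ∃ s, ∀ e ∈ E, c e = s → x e = v ∨ y e = v) :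
    HasShortTuple Circ c (2 * Fintype.card κ + 2) := by
  have hpairs : ∀ v ∈ S, ∃ s d e, (d ∈ E ∧ c d = s) ∧ (e ∈ E ∧ c e = s) ∧ d ≠ e ∧
      ∀ f ∈ E, c f = s → x f = v ∨ y f = v := by
    intro v hv
    obtain ⟨s, hs⟩ := hdom v hv
    obtain ⟨d, e, hde, heq⟩ := Finset.card_eq_two.1 (hc s)
    have hd : d ∈ E.filter fun e => c e = s := by simp [heq]
    have he : e ∈ E.filter fun e => c e = s := by simp [heq]
    exact ⟨s, d, e, Finset.mem_filter.1 hd, Finset.mem_filter.1 he, hde, hs⟩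
  obtain ⟨v₀, hv₀⟩ := hne
  obtain ⟨s₀, d₀, -⟩ := hpairs v₀ hv₀
  have : Nonempty κ := ⟨s₀⟩
  have : Nonempty α := ⟨d₀⟩
  choose! s d e hd he hde hs using hpairs
  -- A colour serving two vertices would consist of two parallel edges.
  have hsinj : ∀ v ∈ S, ∀ w ∈ S, s v = s w → v = w := by
    intro v hv w hw hvw
    by_contra hne
    exact h.not_parallel (hd v hv).1 (he v hv).1 (hde v hv) hne (hs v hv _ (hd v hv).1 (hd v hv).2)
      (hs w hw _ (hd v hv).1 ((hd v hv).2.trans hvw)) (hs v hv _ (he v hv).1 (he v hv).2)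
      (hs w hw _ (he v hv).1 ((he v hv).2.trans hvw))
  let o : V → α → V := fun v f => if x f = v then y f else x f
  have hoS : ∀ v, ∀ f ∈ E, o v f ∈ S := by
    intro v f hf
    simp only [o]
    split_ifs
    · exact (hS f hf).2
    · exact (hS f hf).1
  have hoe : ∀ v, ∀ f ∈ E, (x f = v ∨ y f = v) → (x f = o v f ∨ y f = o v f) ∧ o v f ≠ v := by
    intro v f hf hfv
    have := h.loopless f hf
    simp only [o]
    split_ifs with h1
    · exact ⟨Or.inr rfl, fun h2 => this (h1.trans h2.symm)⟩
    · exact ⟨Or.inl rfl, h1⟩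
  have hends : ∀ v, ∀ f ∈ E, (x f = v ∨ y f = v) → ∀ K : Finset V, v ∈ K → o v f ∈ K →
      x f ∈ K ∧ y f ∈ K := by
    intro v f hf hfv K hv hov
    simp only [o] at hov
    split_ifs at hov with h1
    · exact ⟨h1 ▸ hv, hov⟩
    · exact ⟨hov, (hfv.resolve_left h1) ▸ hv⟩
  obtain ⟨S₁, f₁, S₂, f₂, h₁, h₂, hS₁, hS₂, hcap, hdiff⟩ :=
    hasOutPair_of_outDegree_two (a := fun v => o v (d v)) (b := fun v => o v (e v)) ⟨v₀, hv₀⟩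
      fun v hv => ⟨hoS v _ (hd v hv).1, hoS v _ (he v hv).1, fun heq => by
        have a1 := hoe v _ (hd v hv).1 (hs v hv _ (hd v hv).1 (hd v hv).2)
        have a2 := hoe v _ (he v hv).1 (hs v hv _ (he v hv).1 (he v hv).2)
        rw [← heq] at a2
        exact h.not_parallel (hd v hv).1 (he v hv).1 (hde v hv) a1.2.symm
          (hs v hv _ (hd v hv).1 (hd v hv).2) a1.1 (hs v hv _ (he v hv).1 (he v hv).2) a2.1⟩
  let g : (V → V) → V → α := fun f v => if f v = o v (d v) then d v else e v
  have hg : ∀ f, ∀ v ∈ S, g f v ∈ E ∧ c (g f v) = s v := by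
    intro f v hv
    simp only [g]
    split_ifs
    · exact hd v hv
    · exact he v hv
  -- A selection on `X` gives `|X|` edges of distinct colours with all ends in `X`, hence a rainbow
  -- cycle.
  have hcirc : ∀ X f, IsOutSystem (fun v => o v (d v)) (fun v => o v (e v)) X f → X ⊆ S →
      ∃ C ⊆ X.image (g f), Circ C ∧ Set.InjOn c C ∧ C.card ≤ X.card := by
    intro X f hX hXS
    have hinj : Set.InjOn (g f) X := by
      intro v hv w hw hvw
      refine hsinj v (hXS hv) w (hXS hw) ?_
      rw [← (hg f v (hXS hv)).2, ← (hg f w (hXS hw)).2, hvw]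
    have hXcard := Finset.card_image_of_injOn hinj
    obtain ⟨C, hC, hCc⟩ := h.exists_of_card (X := X.image (g f)) (K := X)
      (Finset.image_subset_iff.2 fun v hv => (hg f v (hXS hv)).1) (hX.nonempty.image _)
      (endSet_subset_iff.2 fun e' he' => by
        obtain ⟨v, hv, rfl⟩ := Finset.mem_image.1 he'
        have a1 := hg f v (hXS hv)
        refine hends v _ a1.1 (hs v (hXS hv) _ a1.1 a1.2) X hv ?_
        have a2 : o v (g f v) = f v := by
          simp only [g]
          split_ifs with h3
          · exact h3.symm
          · exact ((hX.step v hv).resolve_left h3).symm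
        rw [a2]
        exact hX.mapsTo v hv) hXcard.ge
    refine ⟨C, hC, hCc, ?_, (Finset.card_le_card hC).trans hXcard.le⟩
    intro e₁ he₁ e₂ he₂ heq
    obtain ⟨v, hv, rfl⟩ := Finset.mem_image.1 (hC he₁)
    obtain ⟨w, hw, rfl⟩ := Finset.mem_image.1 (hC he₂)
    rw [(hg f v (hXS hv)).2, (hg f w (hXS hw)).2] at heq
    rw [hsinj v (hXS hv) w (hXS hw) heq]
  obtain ⟨C₁, hC₁, hCc₁, hr₁, hn₁⟩ := hcirc S₁ f₁ h₁ hS₁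
  obtain ⟨C₂, hC₂, hCc₂, hr₂, hn₂⟩ := hcirc S₂ f₂ h₂ hS₂
  refine HasShortTuple.of_pair hCc₁ hCc₂ hr₁ hr₂ (Finset.disjoint_left.2 fun e' he₁ he₂ => ?_) ?_
  · obtain ⟨v, hv, rfl⟩ := Finset.mem_image.1 (hC₁ he₁)
    obtain ⟨w, hw, heq⟩ := Finset.mem_image.1 (hC₂ he₂)
    have hvw : w = v := by
      refine hsinj w (hS₂ hw) v (hS₁ hv) ?_
      rw [← (hg f₂ w (hS₂ hw)).2, ← (hg f₁ v (hS₁ hv)).2, heq]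
    subst hvw
    have a1 := hdiff w (Finset.mem_inter.2 ⟨hv, hw⟩)
    have a2 := h₁.step w hv
    have a3 := h₂.step w hw
    have a4 := hde w (hS₁ hv)
    simp only [g] at heq
    split_ifs at heq with b1 b2 b2
    · exact a1 (b2.trans b1.symm)
    · exact a4 heq
    · exact a4 heq.symm
    · exact a1 ((a2.resolve_left b2).trans (a3.resolve_left b1).symm)
  · have a1 := Finset.card_union_add_card_inter S₁ S₂
    have a2 := Finset.card_le_card (Finset.union_subset hS₁ hS₂)
    omega

/-- A rainbow cycle avoiding a given rainbow set. -/
theorem exists_rainbow_disjoint (h : IsCycleSystem x y E Circ)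
    (hS : ∀ e ∈ E, x e ∈ S ∧ y e ∈ S) (hne : S.Nonempty) (hcard : S.card ≤ Fintype.card κ)
    (hc : ∀ s, (E.filter fun e => c e = s).card = 2) {T : Finset α} (hT : Set.InjOn c T) :
    ∃ D, Circ D ∧ Disjoint T D ∧ Set.InjOn c D := by
  -- A rainbow set leaves an edge of each colour unused, and these edges are at least as many as the
  -- vertices.
  have hpick : ∀ s, ∃ e ∈ E, c e = s ∧ e ∉ T := by
    intro s
    obtain ⟨d, e, hde, heq⟩ := Finset.card_eq_two.1 (hc s)
    have hd := Finset.mem_filter.1 (heq.symm.subset (Finset.mem_insert_self d {e}))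
    have he := Finset.mem_filter.1
      (heq.symm.subset (Finset.mem_insert_of_mem (Finset.mem_singleton_self e)))
    by_cases hdT : d ∈ T
    · exact ⟨e, he.1, he.2, fun heT => hde (hT hdT heT (hd.2.trans he.2.symm))⟩
    · exact ⟨d, hd.1, hd.2, hdT⟩
  choose d hdE hdc hdT using hpick
  have hdinj : Function.Injective d := fun s s' hs => by rw [← hdc s, ← hdc s', hs]
  have hcd : (Finset.univ.image d).card = Fintype.card κ := by
    rw [Finset.card_image_of_injective _ hdinj, Finset.card_univ]
  have hpos := Finset.card_pos.2 hne
  obtain ⟨D, hD, hDc⟩ := h.exists_of_card (X := Finset.univ.image d) (K := S)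
    (Finset.image_subset_iff.2 fun s _ => hdE s) (Finset.card_pos.1 (by omega))
    (endSet_subset_iff.2 fun e he => by
      obtain ⟨s, -, rfl⟩ := Finset.mem_image.1 he
      exact hS _ (hdE s)) (by omega)
  refine ⟨D, hDc, Finset.disjoint_left.2 fun e he he' => ?_, fun e he e' he' hee => ?_⟩
  · obtain ⟨s, -, rfl⟩ := Finset.mem_image.1 (hD he')
    exact hdT s he
  · obtain ⟨s, -, rfl⟩ := Finset.mem_image.1 (hD he)
    obtain ⟨s', -, rfl⟩ := Finset.mem_image.1 (hD he')
    rw [hdc, hdc] at hee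
    rw [hee]

/-- A cycle `D` is bounded by the number of vertices outside `W` and of its chords inside `W`. -/
theorem card_le_of_chords (h : IsCycleSystem x y E Circ) (hS : ∀ e ∈ E, x e ∈ S ∧ y e ∈ S)
    {D : Finset α} (hD : Circ D) {W : Finset V} (hW : W ⊆ S) :
    D.card + 2 * W.card ≤ 2 * S.card + (D.filter fun e => x e ∈ W ∧ y e ∈ W).card := by
  have h1 := Finset.card_filter_add_card_filter_not (s := D) (fun e => x e ∈ W ∧ y e ∈ W)
  -- An edge of `D` that is not a chord has an end outside `W`, where `D` has degree at most two.
  have h2 : (D.filter fun e => ¬ (x e ∈ W ∧ y e ∈ W)) ⊆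
      (S \ W).biUnion fun v => D.filter fun e => x e = v ∨ y e = v := by
    intro e he
    rw [Finset.mem_filter] at he
    have h3 := hS e (h.subset hD he.1)
    rw [Finset.mem_biUnion]
    by_cases hx : x e ∈ W
    · exact ⟨y e, Finset.mem_sdiff.2 ⟨h3.2, fun hy => he.2 ⟨hx, hy⟩⟩,
        Finset.mem_filter.2 ⟨he.1, Or.inr rfl⟩⟩
    · exact ⟨x e, Finset.mem_sdiff.2 ⟨h3.1, hx⟩, Finset.mem_filter.2 ⟨he.1, Or.inl rfl⟩⟩
  have h3 := (Finset.card_le_card h2).trans (Finset.card_biUnion_le_card_mul _ _ 2 fun v _ => by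
    change endDeg x y D v ≤ 2
    rcases h.deg hD v with h' | h' <;> omega)
  have h4 := Finset.card_sdiff_add_card_eq_card hW
  omega

set_option maxHeartbeats 1000000 in
/-- The case of a rainbow theta graph `T` such that every rainbow set of the same size on the
vertices of `T` is a theta graph as well. -/
theorem hasShortTuple_of_theta (h : IsCycleSystem x y E Circ)
    (hS : ∀ e ∈ E, x e ∈ S ∧ y e ∈ S) (hne : S.Nonempty) (hcard : S.card ≤ Fintype.card κ)
    (hc : ∀ s, (E.filter fun e => c e = s).card = 2) {T : Finset α} (hTE : T ⊆ E)
    (hTc : Set.InjOn c T)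
    (hθ : ∀ X ⊆ E, Set.InjOn c X → endSet x y X ⊆ endSet x y T → X.card = T.card →
      IsTheta x y Circ X) :
    HasShortTuple Circ c (2 * Fintype.card κ + 2) := by
  by_contra hnot
  have hT := hθ T hTE hTc (Finset.Subset.refl _) rfl
  have htn : T.card ≤ Fintype.card κ :=
    Finset.card_le_card_of_injOn c (fun _ _ => Finset.mem_univ _) hTc
  have hTcard := hT.card_eq
  obtain ⟨e₀, he₀⟩ : T.Nonempty := Finset.card_pos.1 (by omega)
  have hα : Nonempty α := ⟨e₀⟩
  have hV : Nonempty V := ⟨x e₀⟩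
  -- Cycles inside `insert e' T` that cover no edge more than twice have total size at most `2 *
  -- (|T| + 1)`, which is already short.
  have hbig : ∀ A B C D : Finset α, ∀ e' : α, (Circ A ∧ Circ B ∧ Circ C ∧ Circ D) →
      (Set.InjOn c A ∧ Set.InjOn c B ∧ Set.InjOn c C ∧ Set.InjOn c D) →
      A ⊆ insert e' T → B ⊆ insert e' T → C ⊆ insert e' T → D ⊆ insert e' T →
      (∀ f, multFour A B C D f ≤ 2) → False := by
    intro A B C D e' hcirc hr hA hB hC hD hm
    have h1 := card_add_card_le_of_multFour_le hA hB hC hD hm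
    have h2 := Finset.card_insert_le e' T
    exact hnot ⟨A, B, C, D, hcirc, hr, hm, by omega⟩
  have hstep : ∀ {X : Finset α} {e e' : α}, X ⊆ E → endSet x y X ⊆ endSet x y T →
      X.card = T.card → e ∈ X → e' ∉ X → e' ∈ E → (x e' ∈ endSet x y T ∧ y e' ∈ endSet x y T) →
      insert e' (X.erase e) ⊆ E ∧ endSet x y (insert e' (X.erase e)) ⊆ endSet x y T ∧
      (insert e' (X.erase e)).card = T.card := by
    intro X e e' hXE hXT hXc he he' he'E hends
    refine ⟨Finset.insert_subset he'E ((Finset.erase_subset _ _).trans hXE),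
      endSet_subset_iff.2 fun f hf => ?_, ?_⟩
    · rcases Finset.mem_insert.1 hf with rfl | hf
      · exact hends
      · exact endSet_subset_iff.1 hXT f (Finset.mem_of_mem_erase hf)
    · rw [Finset.card_insert_of_notMem (fun h' => he' (Finset.mem_of_mem_erase h')),
        Finset.card_erase_add_one he, hXc]
  have hrain : ∀ {X : Finset α} {e e' : α}, Set.InjOn c X → e ∈ X → c e = c e' →
      Set.InjOn c (insert e' (X.erase e) : Finset α) := by
    intro X e e' hX he hee f hf g hg hfg
    have hback : ∀ f' ∈ X.erase e, c f' ≠ c e' := fun f' hf' h' =>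
      Finset.ne_of_mem_erase hf' (hX (Finset.mem_of_mem_erase hf') he (h'.trans hee.symm))
    rw [Finset.mem_coe] at hf hg
    rcases Finset.mem_insert.1 hf with rfl | hf' <;> rcases Finset.mem_insert.1 hg with rfl | hg'
    · rfl
    · exact absurd hfg.symm (hback g hg')
    · exact absurd hfg (hback f hf')
    · exact hX (Finset.mem_of_mem_erase hf') (Finset.mem_of_mem_erase hg') hfg
  -- If the colour of `e'` were new, `insert e' T` would be rainbow. In the first outcome of
  -- `exchange`, `K'` and a cycle in `symmDiff K K'` share at most `e'`, so together they can
  -- replace `K`.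
  have hpartner : ∀ e' ∈ E, e' ∉ T → (x e' ∈ endSet x y T ∧ y e' ∈ endSet x y T) →
      ∃ e ∈ T, c e = c e' := by
    intro e' he'E he' hends
    by_contra hcon
    push Not at hcon
    have hinj : Set.InjOn c (insert e' T : Finset α) := by
      rw [Finset.coe_insert, Set.injOn_insert (by simpa using he')]
      exact ⟨hTc, by rintro ⟨f, hf, hfe⟩; exact hcon f hf hfe⟩
    have hsub : insert e' (T.erase e₀) ⊆ insert e' T :=
      Finset.insert_subset_insert _ (Finset.erase_subset _ _)
    have hle : ∀ X ⊆ insert e' T, Set.InjOn c (X : Finset α) := fun X hX =>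
      hinj.mono (Finset.coe_subset.2 hX)
    have hTs := Finset.subset_insert e' T
    obtain ⟨q1, q2, q3⟩ := hstep hTE (Finset.Subset.refl _) rfl he₀ he' he'E hends
    rcases h.exchange hTE he₀ he' he'E hT (hθ _ q1 (hle _ hsub) q2 q3) with
      ⟨Z, P, K, K', ⟨hZ, hP, hK, hK'⟩, ⟨hZT, hPT, hKT⟩, -, htr, -, hsubK, heK', -⟩ |
      ⟨A, B, A', B', hcirc, ⟨hA, hB⟩, ⟨hA', hB'⟩, hm⟩
    · have he'K : e' ∉ K := fun h' => he' (hKT h')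
      have hK'sub : K' ⊆ insert e' K :=
        hsubK.trans (Finset.insert_subset_insert _ (Finset.erase_subset _ _))
      have hKs : insert e' K ⊆ insert e' T := Finset.insert_subset_insert _ hKT
      have hKE : symmDiff K K' ⊆ insert e' K := by
        intro f hf
        rcases Finset.mem_symmDiff.1 hf with hf | hf
        · exact Finset.mem_insert_of_mem hf.1
        · exact hK'sub hf.1
      obtain ⟨C, hC, hCc⟩ := h.exists_of_even
        ((hKE.trans hKs).trans (Finset.insert_subset he'E hTE))
        ⟨e', Finset.mem_symmDiff.2 (Or.inr ⟨heK', he'K⟩)⟩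
        fun v => even_endDeg_symmDiff (h.even_deg hK v) (h.even_deg hK' v)
      refine hbig Z P K' C e' ⟨hZ, hP, hK', hCc⟩ ⟨hle _ (hZT.trans hTs), hle _ (hPT.trans hTs),
        hle _ (hK'sub.trans hKs), hle _ ((hC.trans hKE).trans hKs)⟩ (hZT.trans hTs)
        (hPT.trans hTs) (hK'sub.trans hKs) ((hC.trans hKE).trans hKs) fun f => ?_
      have a1 : f ∈ C → (f ∈ K ∧ f ∉ K') ∨ (f ∈ K' ∧ f ∉ K) := fun hf =>
        Finset.mem_symmDiff.1 (hC hf)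
      have a2 : f ∈ K' → f = e' ∨ f ∈ K := fun hf => Finset.mem_insert.1 (hK'sub hf)
      unfold multFour
      by_cases hfT : f ∈ T
      · have a3 := htr f hfT
        have a4 : f ≠ e' := fun h' => he' (h' ▸ hfT)
        clear * - a1 a2 a3 a4
        split_ifs <;> first | omega | (exfalso; tauto)
      · rw [if_neg (fun h' => hfT (hZT h')), if_neg (fun h' => hfT (hPT h'))]
        split_ifs <;> omega
    · exact hbig A B A' B' e' hcirc ⟨hle _ (hA.trans hTs), hle _ (hB.trans hTs),
        hle _ (hA'.trans hsub), hle _ (hB'.trans hsub)⟩ (hA.trans hTs) (hB.trans hTs)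
        (hA'.trans hsub) (hB'.trans hsub) hm
  -- The three cycles of `T` and `D` have total size at most `2 * |T| + |D|`. By `card_eq` and
  -- `hchord` this is at most `2n + 2 + |J|`, so one edge must be saved for each chord in `J`.
  obtain ⟨D, hD, hTD, hDc⟩ := h.exists_rainbow_disjoint hS hne hcard hc hTc
  have hDT : ∀ f ∈ D, f ∉ T := fun f hf hf' => Finset.disjoint_left.1 hTD hf' hf
  have hDE := h.subset hD
  have hchord := h.card_le_of_chords hS hD (W := endSet x y T)
    (endSet_subset_iff.2 fun e he => hS e (hTE he))
  set J := D.filter fun e => x e ∈ endSet x y T ∧ y e ∈ endSet x y T with hJ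
  have hJmem : ∀ k ∈ J, k ∈ D ∧ k ∈ E ∧ k ∉ T ∧ (x k ∈ endSet x y T ∧ y k ∈ endSet x y T) := by
    intro k hk
    have := Finset.mem_filter.1 hk
    exact ⟨this.1, hDE this.1, hDT k this.1, this.2⟩
  have hπ : ∀ k ∈ J, ∃ e ∈ T, c e = c k := fun k hk =>
    hpartner k (hJmem k hk).2.1 (hJmem k hk).2.2.1 (hJmem k hk).2.2.2
  choose! π hπT hπc using hπ
  have hπinj : ∀ k ∈ J, ∀ l ∈ J, k ≠ l → π k ≠ π l := by
    intro k hk l hl hkl heq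
    refine hkl (hDc (hJmem k hk).1 (hJmem l hl).1 ?_)
    rw [← hπc k hk, ← hπc l hl, heq]
  have hs1 : ∀ k ∈ J, IsTheta x y Circ (insert k (T.erase (π k))) ∧
      Set.InjOn c (insert k (T.erase (π k)) : Finset α) := by
    intro k hk
    obtain ⟨q0, q1, q2, q3⟩ := hJmem k hk
    obtain ⟨r1, r2, r3⟩ := hstep hTE (Finset.Subset.refl _) rfl (hπT k hk) q2 q1 q3
    have r4 := hrain hTc (hπT k hk) (hπc k hk)
    exact ⟨hθ _ r1 r4 r2 r3, r4⟩
  have hs2 : ∀ k ∈ J, ∀ l ∈ J, k ≠ l →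
      IsTheta x y Circ (insert l ((insert k (T.erase (π k))).erase (π l))) ∧
      Set.InjOn c (insert l ((insert k (T.erase (π k))).erase (π l)) : Finset α) := by
    intro k hk l hl hkl
    obtain ⟨q0, q1, q2, q3⟩ := hJmem k hk
    obtain ⟨q0', q1', q2', q3'⟩ := hJmem l hl
    obtain ⟨r1, r2, r3⟩ := hstep hTE (Finset.Subset.refl _) rfl (hπT k hk) q2 q1 q3
    have m1 : π l ∈ insert k (T.erase (π k)) := Finset.mem_insert_of_mem
      (Finset.mem_erase.2 ⟨(hπinj k hk l hl hkl).symm, hπT l hl⟩)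
    have m2 : l ∉ insert k (T.erase (π k)) := by
      simp only [Finset.mem_insert, Finset.mem_erase]
      exact fun h' => h'.elim (fun h' => hkl h'.symm) fun h' => q2' h'.2
    obtain ⟨p1, p2, p3⟩ := hstep r1 r2 r3 m1 m2 q1' q3'
    have r4 := hrain (hs1 k hk).2 m1 (hπc l hl)
    exact ⟨hθ _ p1 r4 p2 p3, r4⟩
  -- As `k` and `π k` are not parallel, the exchange takes an edge away from some vertex `ℓ k`,
  -- whose degree must then drop from three to two.
  have hloss : ∀ k ∈ J, ∃ v, (x (π k) = v ∨ y (π k) = v) ∧ ¬ (x k = v ∨ y k = v) := by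
    intro k hk
    by_contra hcon
    push Not at hcon
    have a1 := hcon (x (π k)) (Or.inl rfl)
    have a2 := hcon (y (π k)) (Or.inr rfl)
    refine h.not_parallel (hTE (hπT k hk)) (hJmem k hk).2.1
      (fun h' => (hJmem k hk).2.2.1 (h' ▸ hπT k hk)) (h.loopless _ (hTE (hπT k hk))) (Or.inl rfl)
      (Or.inr rfl) ?_ ?_
    · by_contra h'; exact h' (by tauto)
    · by_contra h'; exact h' (by tauto)
  choose! ℓ hℓe hℓk using hloss
  have hdeg1 : ∀ k ∈ J, ∀ v, endDeg x y (insert k (T.erase (π k))) v +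
      (if x (π k) = v ∨ y (π k) = v then 1 else 0) =
      endDeg x y T v + if x k = v ∨ y k = v then 1 else 0 := by
    intro k hk v
    have a1 := endDeg_erase (x := x) (y := y) (hπT k hk) v
    have a2 := endDeg_insert (x := x) (y := y)
      (fun h' => (hJmem k hk).2.2.1 (Finset.mem_of_mem_erase h') : k ∉ T.erase (π k)) v
    omega
  have hℓ3 : ∀ k ∈ J, endDeg x y T (ℓ k) = 3 := by
    intro k hk
    have a1 := hdeg1 k hk (ℓ k)
    rw [if_pos (hℓe k hk), if_neg (hℓk k hk)] at a1
    have a2 := (hs1 k hk).1.deg_eq (ℓ k)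
    have a3 := hT.deg_eq (ℓ k)
    omega
  -- Two losses at one vertex would leave it with degree one after both exchanges.
  have hℓinj : ∀ k ∈ J, ∀ l ∈ J, k ≠ l → ℓ k ≠ ℓ l := by
    intro k hk l hl hkl heq
    have a1 := hdeg1 k hk (ℓ k)
    rw [if_pos (hℓe k hk), if_neg (hℓk k hk), hℓ3 k hk] at a1
    have m1 : π l ∈ insert k (T.erase (π k)) := Finset.mem_insert_of_mem
      (Finset.mem_erase.2 ⟨(hπinj k hk l hl hkl).symm, hπT l hl⟩)
    have m2 : l ∉ (insert k (T.erase (π k))).erase (π l) := by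
      simp only [Finset.mem_insert, Finset.mem_erase]
      exact fun h' => h'.2.elim (fun h' => hkl h'.symm) fun h' => (hJmem l hl).2.2.1 h'.2
    have a2 := endDeg_erase (x := x) (y := y) m1 (ℓ k)
    have a3 := endDeg_insert (x := x) (y := y) m2 (ℓ k)
    have a4 := (hs2 k hk l hl hkl).1.deg_eq (ℓ k)
    rw [if_pos (heq ▸ hℓe l hl)] at a2
    rw [if_neg (heq ▸ hℓk l hl)] at a3
    omega
  have hJ2 : J.card ≤ 2 := by
    obtain ⟨p, q, -, hbr⟩ := hT.exists_branch
    refine (Finset.card_le_card_of_injOn (t := {p, q}) ℓ (fun k hk => ?_) ?_).trans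
      Finset.card_le_two
    · simpa using (hbr _).1 (hℓ3 k hk)
    · intro k hk l hl heq
      by_contra hkl
      exact hℓinj k hk l hl hkl heq
  have hex : ∀ k ∈ J, ∃ Z P K K', (Circ Z ∧ Circ P ∧ Circ K ∧ Circ K') ∧ (Z ⊆ T ∧ P ⊆ T ∧ K ⊆ T) ∧
      (π k ∉ Z ∧ π k ∈ P ∧ π k ∈ K) ∧
      (∀ f ∈ T, (f ∈ Z ∧ f ∈ P ∧ f ∉ K) ∨ (f ∈ Z ∧ f ∉ P ∧ f ∈ K) ∨ (f ∉ Z ∧ f ∈ P ∧ f ∈ K)) ∧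
      (∀ C, Circ C → C ⊆ T → C = Z ∨ C = P ∨ C = K) ∧
      K' ⊆ insert k (K.erase (π k)) ∧ k ∈ K' ∧ K'.card < K.card := by
    intro k hk
    refine (h.exchange hTE (hπT k hk) (hJmem k hk).2.2.1 (hJmem k hk).2.1 hT
      (hs1 k hk).1).resolve_right ?_
    rintro ⟨A, B, A', B', hcirc, ⟨hA, hB⟩, ⟨hA', hB'⟩, hm⟩
    have hTs := Finset.subset_insert k T
    have hsub : insert k (T.erase (π k)) ⊆ insert k T :=
      Finset.insert_subset_insert _ (Finset.erase_subset _ _)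
    exact hbig A B A' B' k hcirc ⟨hTc.mono (Finset.coe_subset.2 hA),
      hTc.mono (Finset.coe_subset.2 hB), (hs1 k hk).2.mono (Finset.coe_subset.2 hA'),
      (hs1 k hk).2.mono (Finset.coe_subset.2 hB')⟩ (hA.trans hTs) (hB.trans hTs)
      (hA'.trans hsub) (hB'.trans hsub) hm
  have hsum3 : ∀ {Z A B : Finset α}, Z ⊆ T → A ⊆ T → B ⊆ T →
      (∀ f ∈ T, (f ∈ Z ∧ f ∈ A ∧ f ∉ B) ∨ (f ∈ Z ∧ f ∉ A ∧ f ∈ B) ∨ (f ∉ Z ∧ f ∈ A ∧ f ∈ B)) →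
      Z.card + A.card + B.card ≤ 2 * T.card := by
    intro Z A B hZ hA hB htr
    have := card_add_card_le_of_multFour_le hZ hA hB (Finset.empty_subset T) fun f => by
      unfold multFour
      rw [if_neg (Finset.notMem_empty f)]
      by_cases hf : f ∈ T
      · rcases htr f hf with h' | h' | h' <;> simp [h']
      · rw [if_neg fun h' => hf (hZ h'), if_neg fun h' => hf (hA h'), if_neg fun h' => hf (hB h')]
        omega
    simpa using this
  have hmult : ∀ {Z A B Z' A' B' : Finset α},
      (∀ f ∈ T, (f ∈ Z ∧ f ∈ A ∧ f ∉ B) ∨ (f ∈ Z ∧ f ∉ A ∧ f ∈ B) ∨ (f ∉ Z ∧ f ∈ A ∧ f ∈ B)) →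
      (∀ f ∈ T, (f ∈ Z' → f ∈ Z) ∧ (f ∈ A' → f ∈ A) ∧ (f ∈ B' → f ∈ B)) →
      (∀ f, f ∉ T → ¬ (f ∈ Z' ∧ f ∈ A') ∧ ¬ (f ∈ Z' ∧ f ∈ B') ∧ ¬ (f ∈ A' ∧ f ∈ B')) →
      ∀ f, multFour Z' A' B' D f ≤ 2 := by
    intro Z A B Z' A' B' htr hin hout f
    unfold multFour
    by_cases hf : f ∈ T
    · have a1 := htr f hf
      have a2 := hin f hf
      rw [if_neg fun h' => hDT f h' hf]
      clear * - a1 a2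
      split_ifs <;> first | omega | (exfalso; tauto)
    · have a1 := hout f hf
      clear * - a1
      split_ifs <;> first | omega | (exfalso; tauto)
  have hTsub : ∀ {X : Finset α}, X ⊆ T → Set.InjOn c X := fun hX =>
    hTc.mono (Finset.coe_subset.2 hX)
  have hK'T : ∀ {k : α} {K K' : Finset α}, K ⊆ T → K' ⊆ insert k (K.erase (π k)) →
      K' ⊆ insert k (T.erase (π k)) := fun hK hK' =>
    hK'.trans (Finset.insert_subset_insert _ (Finset.erase_subset_erase _ hK))
  have hK'mem : ∀ {k f : α} {K K' : Finset α}, K' ⊆ insert k (K.erase (π k)) → f ∈ K' → f ≠ k →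
      f ∈ K := fun hK' hf hne =>
    Finset.mem_of_mem_erase (Finset.mem_of_mem_insert_of_ne (hK' hf) hne)
  obtain hJ0 | hJ1 | hJ2 : J.card = 0 ∨ J.card = 1 ∨ J.card = 2 := by omega
  · obtain ⟨Z, A, B, ⟨hZ, hA, hB⟩, ⟨hZT, hAT, hBT⟩, htr, -⟩ := hT.exists_triple
    have := hsum3 hZT hAT hBT htr
    refine hnot ⟨Z, A, B, D, ⟨hZ, hA, hB, hD⟩, ⟨hTsub hZT, hTsub hAT, hTsub hBT, hDc⟩,
      hmult htr (fun f _ => ⟨id, id, id⟩) (fun f hf => ?_), by omega⟩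
    exact ⟨fun h' => hf (hZT h'.1), fun h' => hf (hZT h'.1), fun h' => hf (hAT h'.1)⟩
  · obtain ⟨k, hk⟩ := Finset.card_pos.1 (by omega : 0 < J.card)
    obtain ⟨Z, P, K, K', ⟨hZ, hP, hK, hK'⟩, ⟨hZT, hPT, hKT⟩, -, htr, -, hsub, -, hlt⟩ := hex k hk
    have := hsum3 hZT hPT hKT htr
    refine hnot ⟨Z, P, K', D, ⟨hZ, hP, hK', hD⟩, ⟨hTsub hZT, hTsub hPT,
      (hs1 k hk).2.mono (Finset.coe_subset.2 (hK'T hKT hsub)), hDc⟩,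
      hmult htr (fun f hf => ⟨id, id, fun h' => hK'mem hsub h' ?_⟩) (fun f hf => ?_), by omega⟩
    · rintro rfl
      exact (hJmem f hk).2.2.1 hf
    · exact ⟨fun h' => hf (hZT h'.1), fun h' => hf (hZT h'.1), fun h' => hf (hPT h'.1)⟩
  · obtain ⟨k, l, hkl, hJeq⟩ := Finset.card_eq_two.1 hJ2
    have hk : k ∈ J := by simp [hJeq]
    have hl : l ∈ J := by simp [hJeq]
    have hkT := (hJmem k hk).2.2.1
    have hlT := (hJmem l hl).2.2.1
    obtain ⟨Z, P, K, K', ⟨hZ, hP, hK, hK'⟩, ⟨hZT, hPT, hKT⟩, ⟨-, -, heK⟩, htr, huniq, hsub, hkK',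
      hlt⟩ := hex k hk
    obtain ⟨-, -, L, L', ⟨-, -, hL, hL'⟩, ⟨-, -, hLT⟩, ⟨-, -, heL⟩, -, -, hsubL, -, hltL⟩ :=
      hex l hl
    have hcards := hsum3 hZT hPT hKT htr
    have hK'r := (hs1 k hk).2.mono (Finset.coe_subset.2 (hK'T hKT hsub))
    have hL'r := (hs1 l hl).2.mono (Finset.coe_subset.2 (hK'T hLT hsubL))
    have hK'K : ∀ f ∈ T, f ∈ K' → f ∈ K := fun f hf h' =>
      hK'mem hsub h' (by rintro rfl; exact hkT hf)
    have hL'L : ∀ f ∈ T, f ∈ L' → f ∈ L := fun f hf h' =>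
      hK'mem hsubL h' (by rintro rfl; exact hlT hf)
    have hKL' : ∀ f, f ∉ T → ¬ (f ∈ L' ∧ f ∈ K') := by
      rintro f hf ⟨h1, h2⟩
      by_cases hfk : f = k
      · subst hfk
        exact hf (hLT (hK'mem hsubL h1 hkl))
      · exact hf (hKT (hK'mem hsub h2 hfk))
    -- Either the two chords shorten different cycles of `T` and both are replaced, or they shorten
    -- the same cycle `K` and the combined exchange saves two.
    rcases huniq L hL hLT with rfl | rfl | rfl
    · refine hnot ⟨L', P, K', D, ⟨hL', hP, hK', hD⟩, ⟨hL'r, hTsub hPT, hK'r, hDc⟩,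
        hmult htr (fun f hf => ⟨hL'L f hf, id, hK'K f hf⟩) (fun f hf => ?_), by omega⟩
      exact ⟨fun h' => hf (hPT h'.2), hKL' f hf, fun h' => hf (hPT h'.1)⟩
    · refine hnot ⟨Z, L', K', D, ⟨hZ, hL', hK', hD⟩, ⟨hTsub hZT, hL'r, hK'r, hDc⟩,
        hmult htr (fun f hf => ⟨id, hL'L f hf, hK'K f hf⟩) (fun f hf => ?_), by omega⟩
      exact ⟨fun h' => hf (hZT h'.1), fun h' => hf (hZT h'.1), hKL' f hf⟩
    · obtain ⟨C, hC, hCsub, hCcard⟩ := h.exists_double_exchange hTE (hπT k hk) (hπT l hl)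
        (hπinj k hk l hl hkl) hkT hlT hkl (hJmem k hk).2.1 (hJmem l hl).2.1 hT (hs1 k hk).1
        (hs1 l hl).1 (hs2 k hk l hl hkl).1 hK hK' hL' hKT heK heL hsub hsubL hkK'
        (hℓinj k hk l hl hkl) (hℓ3 k hk) (hℓ3 l hl) (hℓe k hk) (hℓk k hk) (hℓe l hl) (hℓk l hl)
      have hkπ : k ≠ π l := fun h' => hkT (h' ▸ hπT l hl)
      have hCT : C ⊆ insert l ((insert k (T.erase (π k))).erase (π l)) := by
        intro f hf
        have a1 := hCsub hf
        have a2 := @hKT f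
        simp only [Finset.mem_insert, Finset.mem_erase] at a1 ⊢
        rcases a1 with rfl | rfl | a1
        · exact Or.inr ⟨hkπ, Or.inl rfl⟩
        · exact Or.inl rfl
        · exact Or.inr ⟨a1.1, Or.inr ⟨a1.2.1, a2 a1.2.2⟩⟩
      refine hnot ⟨Z, P, C, D, ⟨hZ, hP, hC, hD⟩, ⟨hTsub hZT, hTsub hPT,
        (hs2 k hk l hl hkl).2.mono (Finset.coe_subset.2 hCT), hDc⟩,
        hmult htr (fun f hf => ⟨id, id, fun h' => ?_⟩) (fun f hf => ?_), by omega⟩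
      · have a1 := hCsub h'
        simp only [Finset.mem_insert, Finset.mem_erase] at a1
        rcases a1 with rfl | rfl | a1
        · exact absurd hf hkT
        · exact absurd hf hlT
        · exact a1.2.2
      · exact ⟨fun h' => hf (hZT h'.1), fun h' => hf (hZT h'.1), fun h' => hf (hPT h'.1)⟩

/-- The case in which some vertex `z` is avoided by an edge of each colour. -/
theorem hasShortTuple_of_avoiding (h : IsCycleSystem x y E Circ)
    (hS : ∀ e ∈ E, x e ∈ S ∧ y e ∈ S) (hcard : S.card ≤ Fintype.card κ)
    (hc : ∀ s, (E.filter fun e => c e = s).card = 2) {z : V} (hz : z ∈ S)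
    (hav : ∀ s, ∃ e ∈ E, c e = s ∧ x e ≠ z ∧ y e ≠ z) :
    HasShortTuple Circ c (2 * Fintype.card κ + 2) := by
  by_contra hnot
  choose d hdE hdc hdx hdy using hav
  have hdinj : Function.Injective d := fun s s' hs => by rw [← hdc s, ← hdc s', hs]
  have hcd : (Finset.univ.image d).card = Fintype.card κ := by
    rw [Finset.card_image_of_injective _ hdinj, Finset.card_univ]
  have hpos := Finset.card_pos.2 ⟨z, hz⟩
  have hstart : Finset.univ.image d ⊆ E ∧ (Finset.univ.image d).Nonempty ∧
      Set.InjOn c (Finset.univ.image d : Finset α) ∧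
      (endSet x y (Finset.univ.image d)).card + 1 ≤ (Finset.univ.image d).card := by
    refine ⟨Finset.image_subset_iff.2 fun s _ => hdE s, Finset.card_pos.1 (by omega), ?_, ?_⟩
    · intro e he e' he' hee
      obtain ⟨s, -, rfl⟩ := Finset.mem_image.1 he
      obtain ⟨s', -, rfl⟩ := Finset.mem_image.1 he'
      rw [hdc, hdc] at hee
      rw [hee]
    · have h1 : endSet x y (Finset.univ.image d) ⊆ S.erase z := by
        refine endSet_subset_iff.2 fun e he => ?_
        obtain ⟨s, -, rfl⟩ := Finset.mem_image.1 he
        exact ⟨Finset.mem_erase.2 ⟨hdx s, (hS _ (hdE s)).1⟩,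
          Finset.mem_erase.2 ⟨hdy s, (hS _ (hdE s)).2⟩⟩
      have h2 := Finset.card_le_card h1
      have h3 := Finset.card_erase_add_one hz
      omega
  -- The minimality of `|T|` applies equally to every rainbow set of that size on the vertices of
  -- `T`, so `isTheta` covers them all.
  obtain ⟨T, ⟨hTE, hTne, hTc, hTd⟩, hmin⟩ := WellFounded.has_min
    (measure (Finset.card (α := α))).wf {T | T ⊆ E ∧ T.Nonempty ∧ Set.InjOn c (T : Finset α) ∧
      (endSet x y T).card + 1 ≤ T.card} ⟨_, hstart⟩
  refine hnot (h.hasShortTuple_of_theta hS ⟨z, hz⟩ hcard hc hTE hTc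
    fun X hXE hXc hXT hX => h.isTheta hXE ?_ ?_ ?_ ?_)
  · exact Finset.card_pos.1 (hX ▸ Finset.card_pos.2 hTne)
  · have := Finset.card_le_card hXT
    omega
  · intro Y hY
    by_contra hlt
    have h1 := Finset.card_lt_card hY
    refine hmin Y ⟨hY.subset.trans hXE, Finset.card_pos.1 (by omega),
      hXc.mono (Finset.coe_subset.2 hY.subset), by omega⟩ ?_
    change Y.card < T.card
    omega
  · intro C D hC hD hCX hDX hdisj
    have h1 : X.card ≤ Fintype.card κ :=
      Finset.card_le_card_of_injOn c (fun _ _ => Finset.mem_univ _) hXc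
    have h2 := Finset.card_union_of_disjoint hdisj
    have h3 := Finset.card_le_card (Finset.union_subset hCX hDX)
    exact hnot (HasShortTuple.of_pair hC hD (hXc.mono (Finset.coe_subset.2 hCX))
      (hXc.mono (Finset.coe_subset.2 hDX)) hdisj (by omega))

theorem hasShortTuple (h : IsCycleSystem x y E Circ)
    (hS : ∀ e ∈ E, x e ∈ S ∧ y e ∈ S) (hne : S.Nonempty) (hcard : S.card ≤ Fintype.card κ)
    (hc : ∀ s, (E.filter fun e => c e = s).card = 2) :
    HasShortTuple Circ c (2 * Fintype.card κ + 2) := by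
  by_cases hdom : ∀ v ∈ S, ∃ s, ∀ e ∈ E, c e = s → x e = v ∨ y e = v
  · exact h.hasShortTuple_of_dominating hS hne hcard hc hdom
  · push Not at hdom
    obtain ⟨z, hz, hav⟩ := hdom
    exact h.hasShortTuple_of_avoiding hS hcard hc hz hav

end IsCycleSystem

/-! ### Disjoint rainbow vertex cuts for the cographic case. -/

/-- Every cut of the graph with vertex set `S` contains one of the sets in `Circ`. -/
structure IsCutSystem {α V : Type*} (x y : α → V) (S : Finset V) (E : Finset α)
    (Circ : Finset α → Prop) : Prop where
  mem : ∀ e ∈ E, x e ∈ S ∧ y e ∈ S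
  exists_circ : ∀ K : Set V, (∃ a ∈ S, a ∈ K) → (∃ b ∈ S, b ∉ K) →
    ∃ C ⊆ E, Circ C ∧ ∀ e ∈ C, ¬ (x e ∈ K ↔ y e ∈ K)

theorem Finset.eq_or_eq_of_card_le_two {α : Type*} [DecidableEq α] {X : Finset α}
    (hX : X.card ≤ 2) {e f g : α} (he : e ∈ X) (hf : f ∈ X) (hg : g ∈ X) (hef : e ≠ f) :
    g = e ∨ g = f := by
  by_contra hcon
  push Not at hcon
  have h1 : ({g, e, f} : Finset α) ⊆ X := by
    intro e' he'
    simp only [Finset.mem_insert, Finset.mem_singleton] at he'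
    rcases he' with rfl | rfl | rfl <;> assumption
  have h2 := (Finset.card_le_card h1).trans hX
  rw [Finset.card_insert_of_notMem (by simp [hcon.1, hcon.2]), Finset.card_pair hef] at h2
  omega

namespace IsCutSystem

variable {α V κ : Type*} [DecidableEq V] {x y : α → V} {S : Finset V} {E : Finset α}
  {Circ : Finset α → Prop}

/-- Identifying the vertex `a` with `b`. -/
theorem identify (h : IsCutSystem x y S E Circ) {a b : V} (hb : b ∈ S) (hab : a ≠ b) :
    IsCutSystem (fun e => if x e = a then b else x e) (fun e => if y e = a then b else y e)
      (S.erase a) E Circ := by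
  have hmem : ∀ v ∈ S, (if v = a then b else v) ∈ S.erase a := by
    intro v hv
    split_ifs with h1
    · exact Finset.mem_erase.2 ⟨hab.symm, hb⟩
    · exact Finset.mem_erase.2 ⟨h1, hv⟩
  refine ⟨fun e he => ⟨hmem _ (h.mem e he).1, hmem _ (h.mem e he).2⟩, ?_⟩
  rintro K ⟨p, hp, hpK⟩ ⟨q, hq, hqK⟩
  refine h.exists_circ {v | (if v = a then b else v) ∈ K} ⟨p, Finset.mem_of_mem_erase hp, ?_⟩
    ⟨q, Finset.mem_of_mem_erase hq, ?_⟩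
  · simpa [Finset.ne_of_mem_erase hp] using hpK
  · simpa [Finset.ne_of_mem_erase hq] using hqK

variable [DecidableEq α] [Fintype κ] [DecidableEq κ] {c : α → κ}

/-- Two disjoint rainbow vertex cuts, if no colour class is a pair of parallel edges. -/
theorem exists_pair_of_not_parallel (h : IsCutSystem x y S E Circ)
    (h3 : ∀ C, Circ C → 3 ≤ C.card) (hc : ∀ s, (E.filter fun e => c e = s).card ≤ 2)
    (hS : (Finset.univ.filter fun s => ∃ e ∈ E, c e = s ∧ x e ≠ y e).card + 2 ≤ S.card)
    (hpar : ∀ e ∈ E, ∀ f ∈ E, e ≠ f → c e = c f → ∀ v w, v ≠ w → (x e = v ∨ y e = v) →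
      (x e = w ∨ y e = w) → (x f = v ∨ y f = v) → (x f = w ∨ y f = w) → False) :
    ∃ C D, Circ C ∧ Circ D ∧ Set.InjOn c C ∧ Set.InjOn c D ∧ Disjoint C D ∧
      C.card + D.card ≤ Fintype.card κ := by
  classical
  set N := Finset.univ.filter fun s => ∃ e ∈ E, c e = s ∧ x e ≠ y e with hN
  set F := E.filter fun e => x e ≠ y e with hF
  have hFE : F ⊆ E := Finset.filter_subset _ _
  have hFmem : ∀ e ∈ F, e ∈ E ∧ x e ≠ y e := fun e he => Finset.mem_filter.1 he
  let δ : V → Finset α := fun v => F.filter fun e => x e = v ∨ y e = v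
  have hδmem : ∀ {v e}, e ∈ δ v ↔ e ∈ F ∧ (x e = v ∨ y e = v) := Finset.mem_filter
  have hclass : ∀ X ⊆ F, ∀ s, (X.filter fun e => c e = s).card ≤ 2 := fun X hX s =>
    (Finset.card_le_card (Finset.filter_subset_filter _ (hX.trans hFE))).trans (hc s)
  have hFN : ∀ e ∈ F, c e ∈ N := fun e he => by
    obtain ⟨h1, h2⟩ := hFmem e he
    exact Finset.mem_filter.2 ⟨Finset.mem_univ _, e, h1, rfl, h2⟩
  have hFcard : F.card ≤ 2 * N.card :=
    Finset.card_le_mul_card_image_of_maps_to hFN 2 fun s _ => hclass F (Finset.Subset.refl _) s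
  have hsum : ∑ v ∈ S, (δ v).card = 2 * F.card :=
    sum_endDeg (fun e he => (hFmem e he).2)
      (endSet_subset_iff.2 fun e he => h.mem e (hFE he))
  have hstar : ∀ v ∈ S, ∃ C ⊆ δ v, Circ C := by
    intro v hv
    obtain ⟨w, hw, hwv⟩ := Finset.exists_mem_ne (by omega : 1 < S.card) v
    obtain ⟨C, hCE, hC, hcut⟩ := h.exists_circ {v} ⟨v, hv, rfl⟩ ⟨w, hw, hwv⟩
    refine ⟨C, fun e he => ?_, hC⟩
    have h1 := hcut e he
    simp only [Set.mem_singleton_iff] at h1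
    refine hδmem.2 ⟨Finset.mem_filter.2 ⟨hCE he, fun h2 => ?_⟩, by tauto⟩
    rw [h2] at h1
    exact h1 Iff.rfl
  have hδ3 : ∀ v ∈ S, 3 ≤ (δ v).card := by
    intro v hv
    obtain ⟨C, hC, hCc⟩ := hstar v hv
    exact (h3 C hCc).trans (Finset.card_le_card hC)
  set G := S.filter fun v => Set.InjOn c (δ v) with hG
  set B := S.filter fun v => ¬ Set.InjOn c (δ v) with hB
  have hGB : G.card + B.card = S.card := Finset.card_filter_add_card_filter_not _
  have hbad : ∀ v ∈ B, ∃ e f, e ∈ δ v ∧ f ∈ δ v ∧ e ≠ f ∧ c e = c f := by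
    intro v hv
    have h1 := (Finset.mem_filter.1 hv).2
    simp only [Set.InjOn, Finset.mem_coe] at h1
    push Not at h1
    obtain ⟨e, he, f, hf, hef, hne⟩ := h1
    exact ⟨e, f, he, hf, hne, hef⟩
  have hthird : ∀ {e f g}, e ∈ F → f ∈ F → g ∈ F → e ≠ f → c e = c f → c g = c e →
      g = e ∨ g = f := by
    intro e f g he hf hg hef hcef hcg
    exact Finset.eq_or_eq_of_card_le_two (hc (c e)) (Finset.mem_filter.2 ⟨hFE he, rfl⟩)
      (Finset.mem_filter.2 ⟨hFE hf, hcef.symm⟩) (Finset.mem_filter.2 ⟨hFE hg, hcg⟩) hef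
  have hcen : ∃ s : V → κ, ∀ v ∈ B, ∃ e f, e ∈ δ v ∧ f ∈ δ v ∧ e ≠ f ∧ c e = s v ∧ c f = s v := by
    by_cases hκ : Nonempty κ
    · have : ∀ v ∈ B, ∃ s, ∃ e f, e ∈ δ v ∧ f ∈ δ v ∧ e ≠ f ∧ c e = s ∧ c f = s := by
        intro v hv
        obtain ⟨e, f, he, hf, hef, hcef⟩ := hbad v hv
        exact ⟨c e, e, f, he, hf, hef, rfl, hcef.symm⟩
      choose! s hs using this
      exact ⟨s, hs⟩
    · obtain ⟨v, hv⟩ := Finset.card_pos.1 (by omega : 0 < S.card)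
      obtain ⟨e, -⟩ := Finset.card_pos.1 (by have := hδ3 v hv; omega : 0 < (δ v).card)
      exact absurd ⟨c e⟩ hκ
  obtain ⟨s, hs⟩ := hcen
  -- A colour repeated at two bad vertices would be a parallel pair.
  have hsinj : Set.InjOn s B := by
    intro v hv w hw hvw
    by_contra hne
    obtain ⟨e, f, he, hf, hef, hce, hcf⟩ := hs v hv
    obtain ⟨e', f', he', hf', hef', hce', hcf'⟩ := hs w hw
    rw [hδmem] at he hf he' hf'
    have h1 := hthird he'.1 hf'.1 he.1 hef' (hce'.trans hcf'.symm) (by rw [hce, hce', hvw])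
    have h2 := hthird he'.1 hf'.1 hf.1 hef' (hce'.trans hcf'.symm) (by rw [hcf, hce', hvw])
    have h4 : x e = w ∨ y e = w := by
      rcases h1 with rfl | rfl
      · exact he'.2
      · exact hf'.2
    have h5 : x f = w ∨ y f = w := by
      rcases h2 with rfl | rfl
      · exact he'.2
      · exact hf'.2
    exact hpar e (hFE he.1) f (hFE hf.1) hef (hce.trans hcf.symm) v w hne he.2 h4 hf.2 h5
  have hBN : B.image s ⊆ N := by
    intro t ht
    obtain ⟨v, hv, rfl⟩ := Finset.mem_image.1 ht
    obtain ⟨e, f, he, -, -, hce, -⟩ := hs v hv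
    exact hce ▸ hFN e (hδmem.1 he).1
  have hBcard := Finset.card_image_of_injOn hsinj
  have hBN' := Finset.card_sdiff_add_card_eq_card hBN
  set H := F.filter fun e => x e ∈ G ∧ y e ∈ G with hH
  have hHF : H ⊆ F := Finset.filter_subset _ _
  -- Both edges of a colour `s v` meet the bad vertex `v`, so edges between good vertices use only
  -- the other colours of `N`.
  have hHcard : H.card ≤ 2 * (N \ B.image s).card := by
    refine Finset.card_le_mul_card_image_of_maps_to (f := c) (fun e he => ?_) 2
      fun t _ => hclass H hHF t
    obtain ⟨heF, hx, hy⟩ := Finset.mem_filter.1 he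
    refine Finset.mem_sdiff.2 ⟨hFN e heF, fun hmem => ?_⟩
    obtain ⟨v, hv, hsv⟩ := Finset.mem_image.1 hmem
    obtain ⟨e₁, f₁, he₁, hf₁, hef, hce, hcf⟩ := hs v hv
    rw [hδmem] at he₁ hf₁
    have h1 : x e = v ∨ y e = v := by
      rcases hthird he₁.1 hf₁.1 heF hef (hce.trans hcf.symm) (by rw [hce, hsv]) with rfl | rfl
      · exact he₁.2
      · exact hf₁.2
    have hvB := (Finset.mem_filter.1 hv).2
    rcases h1 with rfl | rfl
    · exact hvB (Finset.mem_filter.1 hx).2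
    · exact hvB (Finset.mem_filter.1 hy).2
  -- With `g = |G|`, the bound on `H` gives at most `2 * (g - 2)` edges between good vertices. If
  -- these were pairwise adjacent, `g * (g - 1) ≤ 4 * (g - 2)`, that is `(2 * g - 5) ^ 2 + 7 ≤ 0`.
  have hnonadj : ∃ u ∈ G, ∃ v ∈ G, u ≠ v ∧ ∀ e ∈ F, ¬ ((x e = u ∨ y e = u) ∧ (x e = v ∨ y e = v)) := by
    by_contra hcon
    push Not at hcon
    have hsub : G.offDiag ⊆ (H.image fun e => (x e, y e)) ∪ H.image fun e => (y e, x e) := by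
      rintro ⟨u, v⟩ huv
      obtain ⟨hu, hv, hne⟩ := Finset.mem_offDiag.1 huv
      obtain ⟨e, he, h1, h2⟩ := hcon u hu v hv hne
      have h4 : (x e = u ∧ y e = v) ∨ (y e = u ∧ x e = v) := by
        rcases h1 with h1 | h1 <;> rcases h2 with h2 | h2
        · exact absurd (h1.symm.trans h2) hne
        · exact Or.inl ⟨h1, h2⟩
        · exact Or.inr ⟨h1, h2⟩
        · exact absurd (h1.symm.trans h2) hne
      rw [Finset.mem_union, Finset.mem_image, Finset.mem_image]
      rcases h4 with ⟨rfl, rfl⟩ | ⟨rfl, rfl⟩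
      · exact Or.inl ⟨e, Finset.mem_filter.2 ⟨he, hu, hv⟩, rfl⟩
      · exact Or.inr ⟨e, Finset.mem_filter.2 ⟨he, hv, hu⟩, rfl⟩
    have h1 := (Finset.card_le_card hsub).trans (Finset.card_union_le _ _)
    have h2 := Finset.card_image_le (s := H) (f := fun e => (x e, y e))
    have h4 := Finset.card_image_le (s := H) (f := fun e => (y e, x e))
    rw [Finset.offDiag_card] at h1
    have h5 : G.card * G.card + 8 ≤ 5 * G.card := by omega
    nlinarith [sq_nonneg (2 * (G.card : ℤ) - 5)]
  obtain ⟨u, hu, v, hv, huv, hadj⟩ := hnonadj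
  obtain ⟨huS, hur⟩ := Finset.mem_filter.1 hu
  obtain ⟨hvS, hvr⟩ := Finset.mem_filter.1 hv
  obtain ⟨C, hC, hCc⟩ := hstar u huS
  obtain ⟨D, hD, hDc⟩ := hstar v hvS
  refine ⟨C, D, hCc, hDc, hur.mono (Finset.coe_subset.2 hC), hvr.mono (Finset.coe_subset.2 hD),
    Finset.disjoint_left.2 fun e he he' => ?_, ?_⟩
  · have h1 := hδmem.1 (hC he)
    have h2 := hδmem.1 (hD he')
    exact hadj e h1.1 ⟨h1.2, h2.2⟩
  -- The degrees sum to at most `4 * |N|`, and the other `|S| - 2 ≥ |N|` vertices have degree at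
  -- least three, which leaves at most `|N|` for `u` and `v`.
  · have hvSu : v ∈ S.erase u := Finset.mem_erase.2 ⟨huv.symm, hvS⟩
    have h1 := Finset.sum_erase_add S (fun w => (δ w).card) huS
    have h2 := Finset.sum_erase_add (S.erase u) (fun w => (δ w).card) hvSu
    have h4 := Finset.card_nsmul_le_sum ((S.erase u).erase v) (fun w => (δ w).card) 3
      fun w hw => hδ3 w (Finset.mem_of_mem_erase (Finset.mem_of_mem_erase hw))
    have h5 := Finset.card_erase_add_one huS
    have h6 := Finset.card_erase_add_one hvSu
    have h7 := Finset.card_le_card hC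
    have h8 := Finset.card_le_card hD
    have h9 := Finset.card_le_univ N
    rw [smul_eq_mul] at h4
    omega

/-- If a graph has two more vertices than there are colours with a non-loop edge, each colour class
having at most two edges, then two disjoint rainbow sets in `Circ` are short. -/
theorem exists_pair (h : IsCutSystem x y S E Circ)
    (h3 : ∀ C, Circ C → 3 ≤ C.card) (hc : ∀ s, (E.filter fun e => c e = s).card ≤ 2)
    (hS : (Finset.univ.filter fun s => ∃ e ∈ E, c e = s ∧ x e ≠ y e).card + 2 ≤ S.card) :
    ∃ C D, Circ C ∧ Circ D ∧ Set.InjOn c C ∧ Set.InjOn c D ∧ Disjoint C D ∧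
      C.card + D.card ≤ Fintype.card κ := by
  induction hn : S.card generalizing S x y with
  | zero => omega
  | succ n ih =>
  by_cases hpar : ∀ e ∈ E, ∀ f ∈ E, e ≠ f → c e = c f → ∀ v w, v ≠ w → (x e = v ∨ y e = v) →
      (x e = w ∨ y e = w) → (x f = v ∨ y f = v) → (x f = w ∨ y f = w) → False
  · exact h.exists_pair_of_not_parallel h3 hc hS hpar
  push Not at hpar
  obtain ⟨e, he, f, hf, hef, hcef, v, w, hvw, hev, hew, hfv, hfw, -⟩ := hpar
  have hvS : v ∈ S := by
    rcases hev with rfl | rfl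
    · exact (h.mem e he).1
    · exact (h.mem e he).2
  have hwS : w ∈ S := by
    rcases hew with rfl | rfl
    · exact (h.mem e he).1
    · exact (h.mem e he).2
  have hcardS := Finset.card_erase_add_one hvS
  -- Identifying the ends of a monochromatic parallel pair removes one vertex and turns its whole
  -- colour class into loops, so the inequality `hS` survives.
  refine ih (h.identify hwS hvw) ?_ (by omega)
  suffices hlt : (Finset.univ.filter fun s => ∃ e ∈ E, c e = s ∧
      (if x e = v then w else x e) ≠ (if y e = v then w else y e)).card <
      (Finset.univ.filter fun s => ∃ e ∈ E, c e = s ∧ x e ≠ y e).card by omega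
  refine Finset.card_lt_card (Finset.ssubset_iff_of_subset ?_ |>.2 ⟨c e, ?_, ?_⟩)
  · intro s hs
    obtain ⟨-, g, hg, hgs, hgne⟩ := Finset.mem_filter.1 hs
    exact Finset.mem_filter.2 ⟨Finset.mem_univ _, g, hg, hgs, fun h' => hgne (by rw [h'])⟩
  · refine Finset.mem_filter.2 ⟨Finset.mem_univ _, e, he, rfl, fun h' => hvw ?_⟩
    rw [h', or_self] at hev hew
    exact hev.symm.trans hew
  · intro hmem
    obtain ⟨-, g, hg, hgs, hgne⟩ := Finset.mem_filter.1 hmem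
    have hcoll : ∀ g, (x g = v ∨ y g = v) → (x g = w ∨ y g = w) →
        (if x g = v then w else x g) = (if y g = v then w else y g) := by
      intro g h1 h2
      split_ifs <;> grind
    have hgef : g = e ∨ g = f :=
      Finset.eq_or_eq_of_card_le_two (hc (c e)) (Finset.mem_filter.2 ⟨he, rfl⟩)
        (Finset.mem_filter.2 ⟨hf, hcef.symm⟩) (Finset.mem_filter.2 ⟨hg, hgs⟩) hef
    rcases hgef with rfl | rfl
    · exact hgne (hcoll _ hev hew)
    · exact hgne (hcoll _ hfv hfw)

end IsCutSystem

/-- If a cut were independent in `M`, its complement would contain a base of `M✶`. The fundamental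
circuit of a crossing element would then meet the cut in that element alone, against parity. -/
theorem Matroid.IsCutRep.isCutSystem_dual {α V : Type*} {M : Matroid α} {x y : α → V} {S : Finset V}
    (h : M✶.IsCutRep x y S) (hconn : ∀ K : Set V, (∃ a ∈ S, a ∈ K) → (∃ b ∈ S, b ∉ K) →
      ∃ e ∈ M✶.E, ¬ (x e ∈ K ↔ y e ∈ K)) {E : Finset α} (hE : (E : Set α) = M.E) :
    IsCutSystem x y S E (fun C => M.IsCircuit (C : Set α)) := by
  classical
  refine ⟨fun e he => ?_, fun K ha hb => ?_⟩
  · have heE : e ∈ M✶.E := by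
      rw [Matroid.dual_ground, ← hE]
      exact he
    exact ⟨h.left_mem e heE, h.right_mem e heE⟩
  obtain ⟨e, heE, heK⟩ := hconn K ha hb
  set X : Set α := {f | f ∈ M.E ∧ ¬ (x f ∈ K ↔ y f ∈ K)} with hX
  have hXE : X ⊆ M.E := fun f hf => hf.1
  have hfin : ∀ {Y : Set α}, Y ⊆ M.E → Y.Finite := fun hY =>
    E.finite_toSet.subset (hY.trans hE.symm.subset)
  have hdep : ¬ M.Indep X := by
    intro hind
    have hco : M✶.Coindep X := by
      rw [Matroid.coindep_def, Matroid.dual_dual]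
      exact hind
    obtain ⟨B, hB, hBX⟩ := hco.compl_spanning.exists_isBase_subset
    have heB : e ∉ B := fun he => (hBX he).2 ⟨heE, heK⟩
    have hC := hB.fundCircuit_isCircuit heE heB
    have hCsub := Matroid.fundCircuit_subset_insert M✶ e B
    have hCfin : (M✶.fundCircuit e B).Finite := hfin hC.subset_ground
    have heC : e ∈ hCfin.toFinset := hCfin.mem_toFinset.2 (M✶.mem_fundCircuit e B)
    have hsum := h.circuit_sum hCfin.toFinset (by rwa [hCfin.coe_toFinset])
      fun v => if v ∈ K then 1 else 0
    rw [Finset.sum_eq_single_of_mem e heC] at hsum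
    · by_cases h1 : x e ∈ K <;> by_cases h2 : y e ∈ K <;> simp [h1, h2] at hsum heK
    · intro f hf hfe
      have hfB := (hCsub (hCfin.mem_toFinset.1 hf)).resolve_left hfe
      have h1 : x f ∈ K ↔ y f ∈ K := by
        by_contra hcon
        exact (hBX hfB).2 ⟨(hBX hfB).1, hcon⟩
      by_cases h2 : y f ∈ K
      · rw [if_pos (h1.2 h2), if_pos h2]
        decide
      · rw [if_neg (fun h3 => h2 (h1.1 h3)), if_neg h2, add_zero]
  obtain ⟨C, hCX, hC⟩ := ((Matroid.not_indep_iff hXE).1 hdep).exists_isCircuit_subset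
  have hCfin := hfin hC.subset_ground
  refine ⟨hCfin.toFinset, fun f hf => ?_, by rwa [hCfin.coe_toFinset], fun f hf => ?_⟩
  · rw [← Finset.mem_coe, hE]
    exact hC.subset_ground (hCfin.mem_toFinset.1 hf)
  · exact (hCX (hCfin.mem_toFinset.1 hf)).2

/-! ### From finite sets back to the matroid. -/

theorem HasShortTuple.exists_isShortRainbowCircuitFourTuple {α κ : Type*} [DecidableEq α]
    {M : Matroid α} {c : α → κ} {r : ℕ} (hr : M.eRank = r)
    (h : HasShortTuple (fun C => M.IsCircuit (C : Set α)) c (2 * r + 4)) :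
    ∃ C : Fin 4 → Set α, M.IsShortRainbowCircuitFourTuple c C := by
  obtain ⟨A, B, C, D, ⟨hA, hB, hC, hD⟩, ⟨hcA, hcB, hcC, hcD⟩, hmult, hcard⟩ := h
  refine ⟨![A, B, C, D], fun i => ?_, ?_, fun e _ => ?_⟩
  · fin_cases i
    · exact ⟨hA, hcA⟩
    · exact ⟨hB, hcB⟩
    · exact ⟨hC, hcC⟩
    · exact ⟨hD, hcD⟩
  · rw [Fin.sum_univ_four, hr]
    simp only [Matrix.cons_val_zero, Matrix.cons_val_one, Matrix.cons_val,
      Set.encard_coe_eq_coe_finsetCard]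
    exact_mod_cast hcard
  · have h1 : {i | e ∈ (![A, B, C, D] : Fin 4 → Set α) i} =
        ((Finset.univ.filter fun i => e ∈ (![A, B, C, D] : Fin 4 → Finset α) i : Finset (Fin 4)) :
          Set (Fin 4)) := by
      ext i
      fin_cases i <;> simp
    have h2 : (Finset.univ.filter fun i => e ∈ (![A, B, C, D] : Fin 4 → Finset α) i).card =
        multFour A B C D e := by
      rw [Finset.card_filter, Fin.sum_univ_four]
      rfl
    rw [h1, Set.encard_coe_eq_coe_finsetCard, h2]
    exact_mod_cast hmult e

theorem theorem4p1 {α κ : Type*} [Fintype κ] (M : Matroid α) [M.Finite]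
    (hM : M.IsSimpleMatroid) (c : α → κ)
    (hκ : (Fintype.card κ : ℕ∞) = M.eRank + 1)
    (hc : M.IsUniformColouring c 2) :
    (M.IsGraphic ∨ M.IsCographic →
      ∃ C : Fin 4 → Set α, M.IsShortRainbowCircuitFourTuple c C) ∧
    (M.IsCographic →
      ∃ C₁ C₂ : Set α, M.IsShortRainbowCircuitPair c C₁ C₂) := by
  classical
  obtain ⟨r, hr⟩ : ∃ r : ℕ, M.eRank = r := by
    refine ⟨M.eRank.toNat, (ENat.natCast_toNat fun htop => ?_).symm⟩
    rw [htop, top_add] at hκ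
    exact ENat.natCast_ne_top _ hκ
  have hκr : Fintype.card κ = r + 1 := by
    rw [hr] at hκ
    exact_mod_cast hκ
  obtain ⟨E, hE⟩ : ∃ E : Finset α, (E : Set α) = M.E :=
    ⟨M.ground_finite.toFinset, M.ground_finite.coe_toFinset⟩
  have hc2 : ∀ s, (E.filter fun e => c e = s).card = 2 := by
    intro s
    have h1 := hc s
    have h2 : {e | e ∈ M.E ∧ c e = s} = ((E.filter fun e => c e = s : Finset α) : Set α) := by
      ext e
      simp [← hE]
    rw [h2, Set.encard_coe_eq_coe_finsetCard] at h1
    exact_mod_cast h1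
  obtain ⟨s₀⟩ : Nonempty κ := Fintype.card_pos_iff.1 (by omega)
  obtain ⟨e₀, he₀⟩ : E.Nonempty := by
    obtain ⟨e, he⟩ := Finset.card_pos.1 (by rw [hc2 s₀]; omega)
    exact ⟨e, (Finset.mem_filter.1 he).1⟩
  have h3 : ∀ C : Finset α, M.IsCircuit (C : Set α) → 3 ≤ C.card := by
    intro C hC
    have h1 := hM C hC
    rw [Set.encard_coe_eq_coe_finsetCard] at h1
    exact_mod_cast h1
  have hpair : M.IsCographic → ∃ C D : Finset α, M.IsCircuit (C : Set α) ∧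
      M.IsCircuit (D : Set α) ∧ Set.InjOn c C ∧ Set.InjOn c D ∧ Disjoint C D ∧
      C.card + D.card ≤ Fintype.card κ := by
    intro hco
    obtain ⟨V, x, y, S, h⟩ := Matroid.IsGraphic.exists_isCutRep hco
    obtain ⟨x, y, S, h, hconn⟩ := h.exists_connected
    have hcut := h.isCutSystem_dual hconn hE
    refine hcut.exists_pair h3 (fun s => (hc2 s).le) ?_
    -- The dual has rank `2 * (r + 1) - r = r + 2`, so its graph has at least `r + 3` vertices, two
    -- more than the number of colours.
    obtain ⟨B, hB⟩ := M✶.exists_isBase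
    have hBfin : B.Finite := M✶.ground_finite.subset hB.subset_ground
    have hBE : ∀ e ∈ hBfin.toFinset, e ∈ M✶.E := fun e he =>
      hB.subset_ground (hBfin.mem_toFinset.1 he)
    have h1 := h.card_add_one_le (X := hBfin.toFinset) (K := S)
      (by rw [hBfin.coe_toFinset]; exact hB.indep) ⟨_, (hcut.mem e₀ he₀).1⟩
      (fun e he => h.left_mem e (hBE e he)) (fun e he => h.right_mem e (hBE e he))
    have h2 : E.card = 2 * Fintype.card κ := by
      rw [Finset.card_eq_sum_card_fiberwise (f := c) (t := Finset.univ)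
        (fun _ _ => Finset.mem_univ _), Finset.sum_congr rfl fun s _ => hc2 s, Finset.sum_const,
        smul_eq_mul, Finset.card_univ, mul_comm]
    have h4 : r + hBfin.toFinset.card = E.card := by
      have h5 := M.eRank_add_eRank_dual
      rw [hr, ← hB.encard_eq_eRank, ← hE, Set.encard_coe_eq_coe_finsetCard,
        hBfin.encard_eq_coe_toFinset_card] at h5
      exact_mod_cast h5
    have h5 := Finset.card_le_univ (Finset.univ.filter fun s => ∃ e ∈ E, c e = s ∧ x e ≠ y e)
    omega
  refine ⟨?_, fun hco => ?_⟩
  · rintro (hg | hco)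
    · obtain ⟨V, x, y, S, h⟩ := hg.exists_isCutRep
      obtain ⟨x, y, S, h, hconn⟩ := h.exists_connected
      have hmem : ∀ e ∈ E, x e ∈ S ∧ y e ∈ S := fun e he => by
        have heM : e ∈ M.E := hE ▸ Finset.mem_coe.2 he
        exact ⟨h.left_mem e heM, h.right_mem e heM⟩
      have hne : S.Nonempty := ⟨_, (hmem e₀ he₀).1⟩
      obtain ⟨I, hI, hIc⟩ := h.exists_indep_card hconn hne
      have h1 : I.card ≤ r := by
        have h2 := hI.encard_le_eRank
        rw [hr, Set.encard_coe_eq_coe_finsetCard] at h2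
        exact_mod_cast h2
      have h2 := (h.isCycleSystem hM hE).hasShortTuple hmem hne (by omega) hc2
      rw [hκr] at h2
      exact h2.exists_isShortRainbowCircuitFourTuple hr
    · obtain ⟨C, D, hC, hD, hcC, hcD, hdisj, hcard⟩ := hpair hco
      refine HasShortTuple.exists_isShortRainbowCircuitFourTuple hr
        (HasShortTuple.of_pair hC hD hcC hcD hdisj (by omega))
  · obtain ⟨C, D, hC, hD, hcC, hcD, hdisj, hcard⟩ := hpair hco
    refine ⟨C, D, ⟨hC, hcC⟩, ⟨hD, hcD⟩, Finset.disjoint_coe.2 hdisj, ?_⟩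
    rw [Set.encard_coe_eq_coe_finsetCard, Set.encard_coe_eq_coe_finsetCard, hr]
    exact_mod_cast (by omega : C.card + D.card ≤ r + 2)
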